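/- **Theorem.** There are one fixed randomized program $P$ and one absolute constant $C$ such that the following holds for all integers $n\ge 1$, $s\ge 1$, $d\ge 0$ and all real $0<\epsilon\le 1$. A *decision tree* over $x_1,\dots,x_n$ is a rooted binary tree whose internal nodes are labelled by variables and whose leaves are labelled by bits; on an input $x\in\{0,1\}^n$ it goes left or right at a node labelled $x_i$ according to whether $x_i=0$ or $x_i=1$ and outputs the label of the leaf that it reaches. Its size is its number of leaves and its depth is the maximal number of edges from the root to a leaf. Let $\mathbb{DT}_d^s$ be the class of all functions $\{0,1\}^n\to\{0,1\}$ computed by decision trees of depth at most $d$ and size at most $s$. The program $P$ runs on a random access machine with unit-cost word operations and random bits. It receives $n,s,d$ and $\lceil 1/\epsilon\rceil$ as input and has access to an arbitrary unknown function $f:\{0,1\}^n\to\{0,1\}$ and an arbitrary unknown distribution $\mathcal D$ on $\{0,1\}^n$ only through black-box queries (which return $f(x)$ for a chosen $x$) and random-example queries (which return $(x,f(x))$ for a fresh independent $x\sim\mathcal D$); each query costs $n+1$ time units. For every $f$ and every $\mathcal D$: 0. $P$ always halts, the total number of its queries of both kinds is $\tilde O(s^2/\epsilon)$, and its running time is at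 most $s^{O(d)}/\epsilon+n\cdot\tilde O(s^2/\epsilon)$. Precisely, with $m=s^2/\epsilon$, it makes at most $C\,m\,(1+\ln m)^{C}$ queries and runs in time at most $s^{Cd}/\epsilon+n\cdot C\,m\,(1+\ln m)^{C}$. All words that occur are at most $(n+s+d+1/\epsilon+s^d)^{C}$ (that is, words have logarithmic length). 1. If $f\in\mathbb{DT}_d^s$, then $P$ accepts with probability at least $2/3$. 2. If $f$ is $\epsilon$-far from $\mathbb{DT}_d^s$ with respect to $\mathcal D$, that is, $\Pr_{x\sim\mathcal D}[f(x)\ne g(x)]>\epsilon$ for every $g\in\mathbb{DT}_d^s$, then $P$ rejects with probability at least $2/3$. -/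

import Mathlib

namespace DTTest

/-! ### Decision trees -/

/-- Decision trees over the variables `x_0, …, x_{n-1}`: an internal node carries a variable and a
left (value `0`) and right (value `1`) subtree, a leaf carries an output bit. -/
inductive DecTree (n : ℕ) where
  | leaf (b : Bool) : DecTree n
  | node (i : Fin n) (left right : DecTree n) : DecTree n

namespace DecTree

/-- The Boolean function computed by a decision tree. -/
def eval {n : ℕ} : DecTree n → (Fin n → Bool) → Bool
  | leaf b, _ => b
  | node i l r, x => if x i then r.eval x else l.eval x

/-- The size of a decision tree is its number of leaves. -/
def size {n : ℕ} : DecTree n → ℕ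
  | leaf _ => 1
  | node _ l r => l.size + r.size

/-- The depth of a decision tree is the largest number of edges from the root to a leaf. -/
def depth {n : ℕ} : DecTree n → ℕ
  | leaf _ => 0
  | node _ l r => max l.depth r.depth + 1

end DecTree

/-- The class of all Boolean functions on `{0,1}^n` that are computed by a decision tree of depth at
most `d` and size at most `s`. -/
def DT (n d s : ℕ) : Set ((Fin n → Bool) → Bool) :=
  {f | ∃ T : DecTree n, T.depth ≤ d ∧ T.size ≤ s ∧ T.eval = f}

/-- The probability of the event `S` under the discrete distribution `p`. -/
noncomputable def prob {α : Type*} (p : PMF α) (S : Set α) : ENNReal := p.toOuterMeasure S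

/-- `f` is `ε`-close to `g` with respect to `D`: `Pr_{x ∼ D}[f x ≠ g x] ≤ ε`. -/
def Close {n : ℕ} (D : PMF (Fin n → Bool)) (ε : ℝ) (f g : (Fin n → Bool) → Bool) : Prop :=
  prob D {x | f x ≠ g x} ≤ ENNReal.ofReal ε

/-- `f` is `ε`-far from the class `H` with respect to `D`: it is `ε`-close to no member of `H`. -/
def Far {n : ℕ} (D : PMF (Fin n → Bool)) (ε : ℝ) (f : (Fin n → Bool) → Bool)
    (H : Set ((Fin n → Bool) → Bool)) : Prop :=
  ∀ g ∈ H, ¬ Close D ε f g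

/-! ### Randomized random access machines with black-box and random-example queries

A machine has registers, arrays (finitely many of them are named in a program) with indirect
addressing, and unit-cost instructions on words.  The largest word that occurs is recorded, so
that the word length can be bounded. -/

/-- The arithmetic operations on words: subtraction is truncated at `0`, division rounds down. -/
inductive ArithOp where
  | add | sub | mul | div

/-- The value of an arithmetic operation. -/
def ArithOp.eval : ArithOp → ℕ → ℕ → ℕ
  | add, a, b => a + b
  | sub, a, b => a - b
  | mul, a, b => a * b
  | div, a, b => a / b

/-- Programs. Registers and arrays are named by (fixed) natural numbers. -/
inductive Prog where
  /-- `const x c`: `R[x] ← c` -/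
  | const (x c : ℕ) : Prog
  /-- `arith o x y z`: `R[x] ← R[y] o R[z]` -/
  | arith (o : ArithOp) (x y z : ℕ) : Prog
  /-- `load x a y`: `R[x] ← A_a[R[y]]` -/
  | load (x a y : ℕ) : Prog
  /-- `store a y z`: `A_a[R[y]] ← R[z]` -/
  | store (a y z : ℕ) : Prog
  /-- `coin x`: `R[x] ←` a fresh uniformly random bit -/
  | coin (x : ℕ) : Prog
  /-- `query x a`: black-box query, `R[x] ← f(A_a[0], …, A_a[n-1])`, nonzero entries read as `1` -/
  | query (x a : ℕ) : Prog
  /-- `sample a x`: random-example query, a fresh `u ∼ D` is written to `A_a[0], …, A_a[n-1]`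
  and `R[x] ← f(u)` -/
  | sample (a x : ℕ) : Prog
  /-- sequential composition -/
  | seq (p q : Prog) : Prog
  /-- `ite x p q`: if `R[x] ≠ 0` then `p` else `q` -/
  | ite (x : ℕ) (p q : Prog) : Prog
  /-- `loop x p`: while `R[x] ≠ 0` do `p` -/
  | loop (x : ℕ) (p : Prog) : Prog

/-- The state of a machine: registers, arrays, and three counters that programs cannot read: the
time used, the number of queries (of both kinds) made, and the largest word so far. -/
structure State where
  reg : ℕ → ℕ
  arr : ℕ → ℕ → ℕ
  time : ℕ
  queries : ℕ
  peak : ℕ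

namespace State

/-- Spend `t` units of time. -/
def tick (σ : State) (t : ℕ) : State := { σ with time := σ.time + t }

/-- `R[x] ← v` -/
def setReg (σ : State) (x v : ℕ) : State :=
  { σ with reg := Function.update σ.reg x v, peak := max σ.peak v }

/-- `A_a[j] ← v` -/
def setArr (σ : State) (a j v : ℕ) : State :=
  { σ with arr := Function.update σ.arr a (Function.update (σ.arr a) j v) }

/-- Read the first `n` entries of the array `a` as a point of `{0,1}^n`. -/
def readPoint (σ : State) (n a : ℕ) : Fin n → Bool := fun i => decide (σ.arr a i ≠ 0)

/-- Write the point `u` of `{0,1}^n` to the first `n` entries of the array `a`. -/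
def writePoint (σ : State) {n : ℕ} (a : ℕ) (u : Fin n → Bool) : State :=
  { σ with
    arr := Function.update σ.arr a
      (fun j => if h : j < n then (u ⟨j, h⟩).toNat else σ.arr a j) }

/-- Count one query on `n` variables; it costs `n + 1` units of time. -/
def countQuery (σ : State) (n : ℕ) : State :=
  { σ with time := σ.time + (n + 1), queries := σ.queries + 1 }

/-- The state in which a computation on the inputs `n, s, d, N` starts: the inputs are in the
registers `0, 1, 2, 3`, all other registers and all array entries are `0`. -/
def start (n s d N : ℕ) : State where
  reg := fun x => if x = 0 then n else if x = 1 then s else if x = 2 then d else if x = 3 then N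
    else 0
  arr := fun _ _ => 0
  time := 0
  queries := 0
  peak := max (max n s) (max d N)

end State

/-- Run `q` on the result of a computation; `none` (not halted) is propagated. -/
noncomputable def andThen (p : PMF (Option State)) (q : State → PMF (Option State)) :
    PMF (Option State) :=
  p.bind fun o => match o with
    | none => PMF.pure none
    | some τ => q τ

/-- `while R[x] ≠ 0 do body`, cut off with outcome `none` unless it ends after fewer than `k`
iterations, where `k` is the fourth argument. Each test costs one unit of time. -/
noncomputable def iterate (x : ℕ) (body : State → PMF (Option State)) :
    ℕ → State → PMF (Option State)
  | 0, _ => PMF.pure none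
  | k + 1, σ =>
      if σ.reg x = 0 then PMF.pure (some (σ.tick 1))
      else andThen (body (σ.tick 1)) (iterate x body k)

/-- The distribution of the final state of a program, with access to the function `f` and to the
distribution `D`. Every loop is cut off, with outcome `none`, when it does not end in fewer than
`fuel` iterations; if `none` has probability `0`, this is the true outcome of the program. Every
instruction and every test costs one unit of time, every query costs `n + 1` units. -/
noncomputable def exec {n : ℕ} (f : (Fin n → Bool) → Bool) (D : PMF (Fin n → Bool)) (fuel : ℕ) :
    Prog → State → PMF (Option State)
  | .const x c, σ => PMF.pure (some ((σ.setReg x c).tick 1))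
  | .arith o x y z, σ => PMF.pure (some ((σ.setReg x (o.eval (σ.reg y) (σ.reg z))).tick 1))
  | .load x a y, σ => PMF.pure (some ((σ.setReg x (σ.arr a (σ.reg y))).tick 1))
  | .store a y z, σ => PMF.pure (some ((σ.setArr a (σ.reg y) (σ.reg z)).tick 1))
  | .coin x, σ => (PMF.uniformOfFintype Bool).bind fun b =>
      PMF.pure (some ((σ.setReg x b.toNat).tick 1))
  | .query x a, σ => PMF.pure (some ((σ.setReg x (f (σ.readPoint n a)).toNat).countQuery n))
  | .sample a x, σ => D.bind fun u =>
      PMF.pure (some (((σ.writePoint a u).setReg x (f u).toNat).countQuery n))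
  | .seq p q, σ => andThen (exec f D fuel p σ) (exec f D fuel q)
  | .ite x p q, σ =>
      if σ.reg x ≠ 0 then exec f D fuel p (σ.tick 1) else exec f D fuel q (σ.tick 1)
  | .loop x p, σ => iterate x (exec f D fuel p) fuel σ

/-- The outcomes in which the program halts and accepts: register `0` is nonzero. -/
def accepts : Set (Option State) := {o | ∃ τ, o = some τ ∧ τ.reg 0 ≠ 0}

/-- The outcomes in which the program halts and rejects: register `0` is zero. -/
def rejects : Set (Option State) := {o | ∃ τ, o = some τ ∧ τ.reg 0 = 0}

/-- A bound of the form `Õ(m)`, with constants given by `C`: `C · m · (1 + log m)^C`. It is used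
for `m ≥ 1`. -/
noncomputable def softO (C : ℕ) (m : ℝ) : ℝ := C * m * (1 + Real.log m) ^ C

end DTTest

/-! A tree with at most `s` leaves has fewer than `s` variables. The tester therefore learns the
relevant variables implicitly, as black boxes that can be evaluated at any point, and then asks
whether some small tree over them fits a labelled sample.

Let `E = s⌈1/ε⌉`, let `l` be its binary length, and put `N = 16lE`, `t = 100l`. The variables are
thrown at random into `2^(2l+4)` blocks. Random examples are compared with their copies in which
every block not yet found is set to `0`. A disagreement leads, by binary search over the blocks, to
a new block and to a witness point at which it matters; the search is complete after `N` agreements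
in a row. Varying the coordinates of a found block around its witness gives a function `h`, and `h b
xor h (b xor z)` with random `b` estimates the variable of the block at `z`. Each value that is read
is checked by `t` rounds of a dictator test. Finally, dynamic programming over all paths of literals
decides whether the `N` test examples, labelled by the zeroed-out `f`, fit a tree of size at most
`s` and depth at most `min d s`.

Completeness: two variables of the tree share a block with probability at most `1/16`. Otherwise
acceptance is certain (`verdict_of_injOn`): every found block contains exactly one variable of the
tree, the estimates are exact (`est_support`), fewer than `s` blocks can be found
(`Found.length_lt`), and the tree with the missing variables set to `0` fits the sample.

Soundness: with `η = 1/(2⌈1/ε⌉) ≤ ε/2`, the search rarely ends while zeroing changes `f` with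
probability above `η` (`Ex_grow_bad_le`). By `round_dichotomy`, a block either fails each round with
constant probability, or its estimates follow some coordinate `τ` of the cube, so that wrong
readings are caught. If all readings are correct, a fitting tree becomes a member of the class under
renaming, hence differs from the zeroed-out `f` with probability at least `η`; a union bound over
the at most `(k+2)^(2s)` trees over `k` found blocks excludes this (`Ex_test_verdict_le`).

The machine program is tied to the abstract process `alg` by a calculus of triples `Impl` that also
bounds time, queries and words; `Impl.prog` is its result. The tree of paths has at most
`(2s+1)^(min d s)` nodes, which gives the term `s^(Cd)/ε`. -/

namespace DTTest

open scoped ENNReal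

/-! ### Expectations -/

/-- The expectation of a nonnegative function under a discrete distribution. -/
noncomputable def Ex {α : Type*} (p : PMF α) (F : α → ℝ≥0∞) : ℝ≥0∞ := ∑' a, p a * F a

section Ex
variable {α β : Type*}

theorem Ex_pure (a : α) (F : α → ℝ≥0∞) : Ex (PMF.pure a) F = F a := by
  unfold Ex
  rw [tsum_eq_single a]
  · simp
  · intro b hb; simp [PMF.pure_apply, hb]

theorem Ex_bind (p : PMF α) (g : α → PMF β) (F : β → ℝ≥0∞) :
    Ex (p.bind g) F = Ex p fun a => Ex (g a) F := by
  unfold Ex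
  simp only [PMF.bind_apply, ← ENNReal.tsum_mul_right, ← ENNReal.tsum_mul_left]
  rw [ENNReal.tsum_comm]
  simp only [mul_assoc]

theorem Ex_mono_support {p : PMF α} {F G : α → ℝ≥0∞} (h : ∀ a ∈ p.support, F a ≤ G a) :
    Ex p F ≤ Ex p G := by
  refine ENNReal.tsum_le_tsum fun a => ?_
  by_cases ha : p a = 0
  · simp [ha]
  · gcongr; exact h a ((p.mem_support_iff a).2 ha)

theorem Ex_mono {p : PMF α} {F G : α → ℝ≥0∞} (h : ∀ a, F a ≤ G a) : Ex p F ≤ Ex p G :=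
  Ex_mono_support fun a _ => h a

theorem Ex_congr_support {p : PMF α} {F G : α → ℝ≥0∞} (h : ∀ a ∈ p.support, F a = G a) :
    Ex p F = Ex p G :=
  le_antisymm (Ex_mono_support fun a ha => (h a ha).le) (Ex_mono_support fun a ha => (h a ha).ge)

theorem Ex_const (p : PMF α) (c : ℝ≥0∞) : Ex p (fun _ => c) = c := by
  unfold Ex; rw [ENNReal.tsum_mul_right, p.tsum_coe, one_mul]

theorem Ex_add (p : PMF α) (F G : α → ℝ≥0∞) : Ex p (fun a => F a + G a) = Ex p F + Ex p G := by
  unfold Ex; simp only [mul_add, ENNReal.tsum_add]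

theorem Ex_mul_left (p : PMF α) (c : ℝ≥0∞) (F : α → ℝ≥0∞) :
    Ex p (fun a => c * F a) = c * Ex p F := by
  unfold Ex; rw [← ENNReal.tsum_mul_left]; exact tsum_congr fun a => by ring

theorem Ex_mul_right (p : PMF α) (c : ℝ≥0∞) (F : α → ℝ≥0∞) :
    Ex p (fun a => F a * c) = Ex p F * c := by
  simp only [mul_comm _ c, Ex_mul_left]

theorem Ex_finset_sum {ι : Type*} (p : PMF α) (s : Finset ι) (F : ι → α → ℝ≥0∞) :
    Ex p (fun a => ∑ i ∈ s, F i a) = ∑ i ∈ s, Ex p (F i) := by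
  classical
  induction s using Finset.induction_on with
  | empty => simp [Ex_const]
  | insert i s hi ih => simp only [Finset.sum_insert hi, Ex_add, ih]

theorem Ex_le_of_le {p : PMF α} {F : α → ℝ≥0∞} {c : ℝ≥0∞} (h : ∀ a, F a ≤ c) : Ex p F ≤ c :=
  (Ex_mono h).trans (Ex_const p c).le

theorem Ex_comm (p : PMF α) (q : PMF β) (F : α → β → ℝ≥0∞) :
    (Ex p fun a => Ex q fun b => F a b) = Ex q fun b => Ex p fun a => F a b := by
  unfold Ex
  simp only [← ENNReal.tsum_mul_left]
  rw [ENNReal.tsum_comm]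
  exact tsum_congr fun b => tsum_congr fun a => by ring

open Classical in
/-- The indicator of a proposition. -/
noncomputable def ind (P : Prop) : ℝ≥0∞ := if P then 1 else 0

theorem ind_of {P : Prop} (h : P) : ind P = 1 := by simp [ind, h]
theorem ind_not {P : Prop} (h : ¬ P) : ind P = 0 := by simp [ind, h]
theorem ind_le_one (P : Prop) : ind P ≤ 1 := by unfold ind; split_ifs <;> simp
theorem ind_mono {P Q : Prop} (h : P → Q) : ind P ≤ ind Q := by
  by_cases hP : P
  · rw [ind_of hP, ind_of (h hP)]
  · rw [ind_not hP]; exact zero_le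
theorem ind_le {P : Prop} {c : ℝ≥0∞} (h : P → 1 ≤ c) : ind P ≤ c := by
  by_cases hP : P
  · rw [ind_of hP]; exact h hP
  · rw [ind_not hP]; exact zero_le

theorem prob_eq_Ex (p : PMF α) (S : Set α) : prob p S = Ex p fun a => ind (a ∈ S) := by
  unfold prob Ex ind
  rw [PMF.toOuterMeasure_apply]
  refine tsum_congr fun a => ?_
  by_cases h : a ∈ S <;> simp [h]

theorem Ex_ind_add_not (p : PMF α) (P : α → Prop) :
    (Ex p fun a => ind (P a)) + (Ex p fun a => ind (¬ P a)) = 1 := by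
  rw [← Ex_add, ← Ex_const p 1]
  congr 1; funext a
  by_cases h : P a
  · rw [ind_of h, ind_not (not_not.2 h), add_zero]
  · rw [ind_of h, ind_not h, zero_add]

theorem Ex_ne_top_of_le_one {p : PMF α} {F : α → ℝ≥0∞} (h : ∀ a, F a ≤ 1) : Ex p F ≠ ⊤ :=
  ((Ex_le_of_le h).trans_lt ENNReal.one_lt_top).ne

end Ex

/-! ### Coupling a computation with an abstract random process -/

/-- The computation with outcome distribution `μ` halts, and simulates the random process `p`: its
outcome and an outcome `b` of `p` can be coupled such that `Q b` holds. -/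
def Sim {β : Type*} (μ : PMF (Option State)) (p : PMF β) (Q : β → State → Prop) : Prop :=
  ∀ (φ : Option State → ℝ≥0∞) (F : β → ℝ≥0∞),
    (∀ b τ, Q b τ → φ (some τ) ≤ F b) → Ex μ φ ≤ Ex p F

namespace Sim
variable {β γ : Type*} {μ : PMF (Option State)} {p : PMF β} {Q : β → State → Prop}

theorem pure {b : β} {τ : State} (h : Q b τ) : Sim (PMF.pure (some τ)) (PMF.pure b) Q := by
  intro φ F hF
  rw [Ex_pure, Ex_pure]
  exact hF b τ h

theorem bind_pure {D : PMF β} {g : β → State} (h : ∀ u, Q u (g u)) :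
    Sim (D.bind fun u => PMF.pure (some (g u))) D Q := by
  intro φ F hF
  rw [Ex_bind]
  exact Ex_mono fun u => by rw [Ex_pure]; exact hF u _ (h u)

/-- No coupling has to be constructed: the expected values after the continuations are again a pair
of test functions that is ordered along `Q`. -/
theorem andThen {k : State → PMF (Option State)} {p' : β → PMF γ} {Q' : γ → State → Prop}
    (h : Sim μ p Q) (hk : ∀ b τ, Q b τ → Sim (k τ) (p' b) Q') :
    Sim (DTTest.andThen μ k) (p.bind p') Q' := by
  intro φ F hF
  unfold DTTest.andThen
  rw [Ex_bind, Ex_bind]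
  exact h _ _ fun b τ hb => hk b τ hb φ F hF

theorem mono {Q' : β → State → Prop} (h : Sim μ p Q) (hQ : ∀ b τ, Q b τ → Q' b τ) :
    Sim μ p Q' :=
  fun φ F hF => h φ F fun b τ hb => hF b τ (hQ b τ hb)

/-- Exchanges the abstract process for another one, for instance a sequence of coins for a random
point; a comparison of expectations is all that is needed. -/
theorem of_Ex_le {p' : PMF γ} {Q' : γ → State → Prop} (h : Sim μ p Q)
    (hp : ∀ F : γ → ℝ≥0∞, ∃ G : β → ℝ≥0∞, Ex p G ≤ Ex p' F ∧
      ∀ b τ, Q b τ → ∃ c, Q' c τ ∧ F c ≤ G b) : Sim μ p' Q' := by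
  intro φ F hF
  obtain ⟨G, hG, hQ⟩ := hp F
  refine (h φ G fun b τ hb => ?_).trans hG
  obtain ⟨c, hc, hle⟩ := hQ b τ hb
  exact (hF c τ hc).trans hle

/-- In `Sim` the test function is unconstrained at `none` and at unrelated states. The indicator of
such an outcome may thus be compared with the function `0`. Halting and all resource bounds are
extracted in this way. -/
theorem exists_of_mem_support (h : Sim μ p Q) {o : Option State} (ho : o ∈ μ.support) :
    ∃ τ, o = some τ ∧ ∃ b, Q b τ := by
  by_contra hc
  classical
  have key := h (fun o' => if o' = o then 1 else 0) (fun _ => 0) (by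
    intro b τ hb
    rw [if_neg]
    intro e; exact hc ⟨τ, e.symm, b, hb⟩)
  rw [Ex_const] at key
  have : μ o ≤ Ex μ (fun o' => if o' = o then 1 else 0) := by
    unfold Ex
    refine le_trans ?_ (ENNReal.le_tsum o)
    simp
  exact ((μ.mem_support_iff o).1 ho) (le_antisymm (this.trans key) zero_le)

theorem prob_le (h : Sim μ p Q) {S : Set (Option State)} {B : β → Prop}
    (hB : ∀ b τ, Q b τ → some τ ∈ S → B b) : prob μ S ≤ Ex p fun b => ind (B b) := by
  rw [prob_eq_Ex]
  exact h _ _ fun b τ hb => ind_mono (hB b τ hb)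

end Sim

/-! ### A structured language on top of the machine -/

/-- The registers below `100`; the others are used for the evaluation of expressions. -/
def low (R : ℕ → ℕ) : ℕ → ℕ := fun x => if x < 100 then R x else 0

theorem low_apply {R : ℕ → ℕ} {x : ℕ} (h : x < 100) : low R x = R x := if_pos h

theorem low_update {R : ℕ → ℕ} {x v : ℕ} (h : x < 100) :
    low (Function.update R x v) = Function.update (low R) x v := by
  funext y; unfold low Function.update
  by_cases hy : y = x
  · subst hy; simp [h]
  · simp [hy]

theorem low_update_temp {R : ℕ → ℕ} {x v : ℕ} (h : 100 ≤ x) :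
    low (Function.update R x v) = low R := by
  funext y; unfold low Function.update
  by_cases hy : y = x
  · subst hy; simp [h.not_gt]
  · simp [hy]

/-- Arithmetic expressions over registers and array entries. -/
inductive Exp where
  | reg (x : ℕ) : Exp
  | lit (c : ℕ) : Exp
  | bin (o : ArithOp) (a b : Exp) : Exp
  | get (a : ℕ) (i : Exp) : Exp

namespace Exp

/-- The value of an expression. -/
def eval (R : ℕ → ℕ) (A : ℕ → ℕ → ℕ) : Exp → ℕ
  | reg x => R x
  | lit c => c
  | bin o a b => o.eval (a.eval R A) (b.eval R A)
  | get a i => A a (i.eval R A)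

/-- Code that evaluates an expression into the register `t`. -/
def code (t : ℕ) : Exp → Prog
  | reg x => .seq (.const t 0) (.arith .add t x t)
  | lit c => .const t c
  | bin o a b => .seq (a.code t) (.seq (b.code (t + 1)) (.arith o t t (t + 1)))
  | get a i => .seq (i.code t) (.load t a t)

/-- The number of steps of the evaluation of an expression. -/
def cost : Exp → ℕ
  | reg _ => 2
  | lit _ => 1
  | bin _ a b => a.cost + b.cost + 1
  | get _ i => i.cost + 1

/-- The expression refers only to registers below `100`. -/
def wf : Exp → Bool
  | reg x => decide (x < 100)
  | lit _ => true
  | bin _ a b => a.wf && b.wf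
  | get _ i => i.wf

/-- All words that occur in the evaluation are at most `W`, provided that this holds for the
registers and the arrays. -/
def ok (W : ℕ) (R : ℕ → ℕ) (A : ℕ → ℕ → ℕ) : Exp → Prop
  | reg _ => True
  | lit c => c ≤ W
  | bin .add a b => a.ok W R A ∧ b.ok W R A ∧ a.eval R A + b.eval R A ≤ W
  | bin .mul a b => a.ok W R A ∧ b.ok W R A ∧ a.eval R A * b.eval R A ≤ W
  | bin .sub a b => a.ok W R A ∧ b.ok W R A
  | bin .div a b => a.ok W R A ∧ b.ok W R A
  | get _ i => i.ok W R A

instance : Add Exp := ⟨bin .add⟩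
instance : Sub Exp := ⟨bin .sub⟩
instance : Mul Exp := ⟨bin .mul⟩
instance : Div Exp := ⟨bin .div⟩

end Exp

/-- All words of a state are at most `W`. -/
def State.Ok (W : ℕ) (σ : State) : Prop :=
  σ.peak ≤ W ∧ (∀ x, σ.reg x ≤ W) ∧ ∀ a j, σ.arr a j ≤ W

theorem State.Ok.setReg {W : ℕ} {σ : State} (h : σ.Ok W) (x : ℕ) {v : ℕ} (hv : v ≤ W) (t : ℕ) :
    ((σ.setReg x v).tick t).Ok W := by
  refine ⟨max_le h.1 hv, fun y => ?_, h.2.2⟩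
  by_cases hy : y = x
  · subst hy; simpa [State.setReg, State.tick] using hv
  · simpa [State.setReg, State.tick, Function.update, hy] using h.2.1 y

/-! ### Triples for code, with bounds on time, queries and words -/

section Machine
variable {n : ℕ} (f : (Fin n → Bool) → Bool) (D : PMF (Fin n → Bool)) (fuel W : ℕ)

theorem andThen_pure (τ : State) (k : State → PMF (Option State)) :
    andThen (PMF.pure (some τ)) k = k τ := by
  unfold andThen; rw [PMF.pure_bind]

/-- The temporaries form a stack: code at level `t` leaves all registers below `t` alone, so the
left operand survives in `t` while the right one is evaluated from `t + 1` on. -/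
theorem exec_code (e : Exp) : ∀ (t : ℕ), 100 ≤ t → e.wf = true → ∀ σ : State,
    ∃ τ, exec f D fuel (e.code t) σ = PMF.pure (some τ) ∧ τ.arr = σ.arr ∧
      (∀ y < t, τ.reg y = σ.reg y) ∧ τ.reg t = e.eval (low σ.reg) σ.arr ∧
      τ.time = σ.time + e.cost ∧ τ.queries = σ.queries ∧
      (σ.Ok W → e.ok W (low σ.reg) σ.arr → τ.Ok W) := by
  have hlow : ∀ {t : ℕ} {σ τ : State}, 100 ≤ t → (∀ y < t, τ.reg y = σ.reg y) →
      low τ.reg = low σ.reg := by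
    intro t σ τ ht h; funext y; unfold low
    split_ifs with hy
    · exact h y (by omega)
    · rfl
  induction e with
  | reg x =>
    intro t ht hwf σ
    have hx : x < 100 := by simpa [Exp.wf] using hwf
    simp only [Exp.code, exec, andThen_pure]
    refine ⟨_, rfl, rfl, ?_, ?_, rfl, rfl, ?_⟩
    · intro y hy; simp [State.setReg, State.tick, Function.update, hy.ne]
    · have : x ≠ t := by omega
      simp [State.setReg, State.tick, Function.update, this, ArithOp.eval, Exp.eval, low, hx]
    · intro h _
      refine State.Ok.setReg (h.setReg t (Nat.zero_le _) 1) t ?_ 1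
      have : x ≠ t := by omega
      simpa [State.setReg, State.tick, Function.update, this, ArithOp.eval] using h.2.1 x
  | lit c =>
    intro t ht _ σ
    simp only [Exp.code, exec]
    refine ⟨_, rfl, rfl, ?_, ?_, rfl, rfl, ?_⟩
    · intro y hy; simp [State.setReg, State.tick, Function.update, hy.ne]
    · simp [State.setReg, State.tick, Exp.eval]
    · intro h hc; exact h.setReg t hc 1
  | get a i ih =>
    intro t ht hwf σ
    obtain ⟨τ, h1, h2, h3, h4, h5, h6, h7⟩ := ih t ht hwf σ
    simp only [Exp.code, exec, h1, andThen_pure]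
    refine ⟨_, rfl, h2, ?_, ?_, ?_, h6, ?_⟩
    · intro y hy; simpa [State.setReg, State.tick, Function.update, hy.ne] using h3 y hy
    · simp [State.setReg, State.tick, Exp.eval, h2, h4]
    · simp [State.setReg, State.tick, Exp.cost, h5]; ring
    · intro h hc; exact (h7 h hc).setReg t ((h7 h hc).2.2 _ _) 1
  | bin o a b iha ihb =>
    intro t ht hwf σ
    simp only [Exp.wf, Bool.and_eq_true] at hwf
    obtain ⟨τ, h1, h2, h3, h4, h5, h6, h7⟩ := iha t ht hwf.1 σ
    obtain ⟨υ, g1, g2, g3, g4, g5, g6, g7⟩ := ihb (t + 1) (by omega) hwf.2 τ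
    have hl := hlow ht h3
    rw [hl, h2] at g4 g7
    have gt : υ.reg t = a.eval (low σ.reg) σ.arr := by rw [g3 t (by omega), h4]
    simp only [Exp.code, exec, h1, g1, andThen_pure]
    refine ⟨_, rfl, g2.trans h2, ?_, ?_, ?_,
      g6.trans h6, ?_⟩
    · intro y hy
      simpa [State.setReg, State.tick, Function.update, hy.ne, g3 y (by omega)] using h3 y hy
    · simp [State.setReg, State.tick, Exp.eval, g4, gt]
    · simp [State.setReg, State.tick, Exp.cost, h5, g5]; ring
    · intro h hc
      have hab : a.ok W (low σ.reg) σ.arr ∧ b.ok W (low σ.reg) σ.arr := by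
        cases o <;> simp only [Exp.ok] at hc <;> exact ⟨hc.1, by first | exact hc.2.1 | exact hc.2⟩
      have h8 := g7 (h7 h hab.1) hab.2
      refine h8.setReg t ?_ 1
      rw [gt, g4]
      have ha : a.eval (low σ.reg) σ.arr ≤ W := gt ▸ h8.2.1 t
      cases o <;> simp only [Exp.ok] at hc
      · exact hc.2.2
      · exact (Nat.sub_le _ _).trans ha
      · exact hc.2.2
      · exact (Nat.div_le_self _ _).trans ha

/-- Basic statements: assignments to registers and to array entries, and black-box queries. -/
inductive Stmt where
  | set (x : ℕ) (e : Exp) : Stmt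
  | put (a : ℕ) (i e : Exp) : Stmt
  | ask (x a : ℕ) : Stmt

namespace Stmt

/-- The machine code of a statement. -/
def code : Stmt → Prog
  | set x e => .seq (e.code 100) (.seq (.const x 0) (.arith .add x x 100))
  | put a i e => .seq (i.code 100) (.seq (e.code 101) (.store a 100 101))
  | ask x a => .query x a

/-- The number of steps of a statement, without those of the queries. -/
def cost : Stmt → ℕ
  | set _ e => e.cost + 2
  | put _ i e => i.cost + e.cost + 1
  | ask _ _ => 0

/-- The number of queries of a statement. -/
def queries : Stmt → ℕ
  | ask _ _ => 1
  | _ => 0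

/-- The statement refers only to registers below `100`. -/
def wf : Stmt → Bool
  | set x e => decide (x < 100) && e.wf
  | put _ i e => i.wf && e.wf
  | ask x _ => decide (x < 100)

/-- The registers after a statement. -/
def runReg (R : ℕ → ℕ) (A : ℕ → ℕ → ℕ) : Stmt → ℕ → ℕ
  | set x e => Function.update R x (e.eval R A)
  | put _ _ _ => R
  | ask x a => Function.update R x (f fun i => decide (A a i ≠ 0)).toNat

/-- The arrays after a statement. -/
def runArr (R : ℕ → ℕ) (A : ℕ → ℕ → ℕ) : Stmt → ℕ → ℕ → ℕ
  | put a i e => Function.update A a (Function.update (A a) (i.eval R A) (e.eval R A))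
  | _ => A

/-- All words that occur in the execution of a statement are at most `W`. -/
def ok (R : ℕ → ℕ) (A : ℕ → ℕ → ℕ) : Stmt → Prop
  | set _ e => e.ok W R A
  | put _ i e => i.ok W R A ∧ e.ok W R A
  | ask _ _ => True

theorem exec_code (hW : 1 ≤ W) (c : Stmt) (hwf : c.wf = true) (σ : State) :
    ∃ τ, exec f D fuel c.code σ = PMF.pure (some τ) ∧ τ.arr = c.runArr (low σ.reg) σ.arr ∧
      low τ.reg = c.runReg f (low σ.reg) σ.arr ∧
      τ.time = σ.time + (c.cost + c.queries * (n + 1)) ∧ τ.queries = σ.queries + c.queries ∧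
      (σ.Ok W → c.ok W (low σ.reg) σ.arr → τ.Ok W) := by
  cases c with
  | set x e =>
    simp only [wf, Bool.and_eq_true, decide_eq_true_eq] at hwf
    obtain ⟨τ, h1, h2, h3, h4, h5, h6, h7⟩ := DTTest.exec_code f D fuel W e 100 le_rfl hwf.2 σ
    have hx : (100 : ℕ) ≠ x := by omega
    simp only [code, exec, h1, andThen_pure]
    refine ⟨_, rfl, h2, ?_, ?_, h6, ?_⟩
    · have : low τ.reg = low σ.reg := by
        funext y; unfold low
        split_ifs with hy
        · exact h3 y hy
        · rfl
      simp [State.setReg, State.tick, low_update hwf.1, this, runReg, ArithOp.eval,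
        Function.update, hx, h4]
    · simp [State.setReg, State.tick, cost, queries, h5]; ring
    · intro h hc
      refine State.Ok.setReg ((h7 h hc).setReg x (Nat.zero_le _) 1) x ?_ 1
      simpa [State.setReg, State.tick, ArithOp.eval, Function.update, hx] using (h7 h hc).2.1 100
  | put a i e =>
    simp only [wf, Bool.and_eq_true] at hwf
    obtain ⟨τ, h1, h2, h3, h4, h5, h6, h7⟩ := DTTest.exec_code f D fuel W i 100 le_rfl hwf.1 σ
    obtain ⟨υ, g1, g2, g3, g4, g5, g6, g7⟩ := DTTest.exec_code f D fuel W e 101 (by omega) hwf.2 τ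
    have hl : low τ.reg = low σ.reg := by
      funext y; unfold low
      split_ifs with hy
      · exact h3 y hy
      · rfl
    have hl' : low υ.reg = low τ.reg := by
      funext y; unfold low
      split_ifs with hy
      · exact g3 y (by omega)
      · rfl
    rw [hl, h2] at g4 g7
    have g100 : υ.reg 100 = _ := (g3 100 (by omega)).trans h4
    simp only [code, exec, h1, g1, andThen_pure]
    refine ⟨_, rfl, ?_, hl'.trans hl, ?_, ?_, ?_⟩
    · simp [State.setArr, State.tick, runArr, g100, g4, g2, h2]
    · simp [State.setArr, State.tick, cost, queries, h5, g5]; ring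
    · simp [State.setArr, State.tick, queries, h6, g6]
    · intro h hc
      have h8 := g7 (h7 h hc.1) hc.2
      refine ⟨h8.1, h8.2.1, fun b j => ?_⟩
      simp only [State.setArr, State.tick]
      by_cases hb : b = a
      · subst hb
        by_cases hj : j = υ.reg 100
        · subst hj; simpa using h8.2.1 _
        · simpa [hj] using h8.2.2 _ _
      · simpa [hb] using h8.2.2 _ _
  | ask x a =>
    simp only [wf, decide_eq_true_eq] at hwf
    simp only [code, exec]
    refine ⟨_, rfl, rfl, ?_, ?_, rfl, ?_⟩
    · simp only [State.setReg, State.countQuery, low_update hwf, runReg]; rfl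
    · simp [State.setReg, State.countQuery, cost, queries]
    · intro h _
      have := h.setReg x (v := (f (σ.readPoint n a)).toNat) ((Bool.toNat_le _).trans hW) 0
      exact this

end Stmt

/-- Commands: straight-line code, random bits, random examples, composition and counted loops,
where `for_ i m c body` lets the register `i` run from `0` to `R[c] - 1`. -/
inductive Cmd where
  | block (l : List Stmt) : Cmd
  | coin (x : ℕ) : Cmd
  | sample (a x : ℕ) : Cmd
  | seq (c₁ c₂ : Cmd) : Cmd
  | for_ (i m c : ℕ) (body : Cmd) : Cmd

namespace Cmd

/-- The machine code of a command. -/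
def code : Cmd → Prog
  | block l => l.foldr (fun c p => .seq c.code p) (.const 100 0)
  | coin x => .coin x
  | sample a x => .sample a x
  | seq c₁ c₂ => .seq c₁.code c₂.code
  | for_ i m c body =>
      .seq (.const i 0) (.seq (.arith .sub m c i) (.loop m (.seq body.code
        (.seq (.const m 1) (.seq (.arith .add i i m) (.arith .sub m c i))))))

/-- The registers that a statement may change. -/
def _root_.DTTest.Stmt.wr : Stmt → ℕ → Bool
  | .set x _, y => decide (y = x)
  | .put _ _ _, _ => false
  | .ask x _, y => decide (y = x)

/-- The arrays that a statement may change. -/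
def _root_.DTTest.Stmt.wa : Stmt → ℕ → Bool
  | .put a _ _, y => decide (y = a)
  | _, _ => false

/-- The registers that a command may change. -/
def wr : Cmd → ℕ → Bool
  | block l, y => l.any fun c => c.wr y
  | coin x, y => decide (y = x)
  | sample _ x, y => decide (y = x)
  | seq c₁ c₂, y => c₁.wr y || c₂.wr y
  | for_ i m _ body, y => decide (y = i) || decide (y = m) || body.wr y

/-- The arrays that a command may change. -/
def wa : Cmd → ℕ → Bool
  | block l, y => l.any fun c => c.wa y
  | coin _, _ => false
  | sample a _, y => decide (y = a)
  | seq c₁ c₂, y => c₁.wa y || c₂.wa y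
  | for_ _ _ _ body, y => body.wa y

end Cmd

/-- Registers and arrays that the command does not change agree. -/
def Same (c : Cmd) (R : ℕ → ℕ) (A : ℕ → ℕ → ℕ) (R' : ℕ → ℕ) (A' : ℕ → ℕ → ℕ) : Prop :=
  (∀ x, c.wr x = false → R' x = R x) ∧ ∀ a, c.wa a = false → A' a = A a

/-- Started with the registers `R` (below `100`) and the arrays `A`, the command `c` simulates the
random process `p` such that the outcomes are related by `Q`; it takes at most `T` steps, makes at
most `q` queries, and keeps all words below `W`. -/
def Impl {β : Type*} (T q : ℕ) (c : Cmd) (R : ℕ → ℕ) (A : ℕ → ℕ → ℕ) (p : PMF β)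
    (Q : β → (ℕ → ℕ) → (ℕ → ℕ → ℕ) → Prop) : Prop :=
  ∀ σ : State, low σ.reg = R → σ.arr = A → σ.Ok W →
    Sim (exec f D fuel c.code σ) p fun b τ =>
      Q b (low τ.reg) τ.arr ∧ τ.Ok W ∧ τ.time ≤ σ.time + T ∧ τ.queries ≤ σ.queries + q ∧
        Same c R A (low τ.reg) τ.arr

namespace Impl
variable {f D fuel W}
variable {β γ : Type*} {T q : ℕ} {c : Cmd} {R : ℕ → ℕ} {A : ℕ → ℕ → ℕ} {p : PMF β}
  {Q : β → (ℕ → ℕ) → (ℕ → ℕ → ℕ) → Prop}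

theorem mono {T' q' : ℕ} {Q' : β → (ℕ → ℕ) → (ℕ → ℕ → ℕ) → Prop}
    (h : Impl f D fuel W T q c R A p Q) (hT : T ≤ T') (hq : q ≤ q')
    (hQ : ∀ b R' A', Q b R' A' → Same c R A R' A' → Q' b R' A') :
    Impl f D fuel W T' q' c R A p Q' := by
  intro σ h1 h2 h3
  exact (h σ h1 h2 h3).mono fun b τ hb =>
    ⟨hQ _ _ _ hb.1 hb.2.2.2.2, hb.2.1, by linarith [hb.2.2.1], by linarith [hb.2.2.2.1],
      hb.2.2.2.2⟩

/-- The bounds on the words of the initial state may be assumed. -/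
theorem of_ok (h : (∀ x, R x ≤ W) → (∀ a j, A a j ≤ W) → Impl f D fuel W T q c R A p Q) :
    Impl f D fuel W T q c R A p Q := by
  intro σ h1 h2 h3
  refine h (fun x => ?_) (fun a j => h2 ▸ h3.2.2 a j) σ h1 h2 h3
  rw [← h1]; unfold low
  split_ifs
  · exact h3.2.1 x
  · exact Nat.zero_le _

theorem of_Ex_le {p' : PMF γ} {Q' : γ → (ℕ → ℕ) → (ℕ → ℕ → ℕ) → Prop}
    (h : Impl f D fuel W T q c R A p Q)
    (hp : ∀ F : γ → ℝ≥0∞, ∃ G : β → ℝ≥0∞, Ex p G ≤ Ex p' F ∧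
      ∀ b R' A', Q b R' A' → ∃ c, Q' c R' A' ∧ F c ≤ G b) :
    Impl f D fuel W T q c R A p' Q' := by
  intro σ h1 h2 h3
  refine (h σ h1 h2 h3).of_Ex_le fun F => ?_
  obtain ⟨G, hG, hQ⟩ := hp F
  refine ⟨G, hG, fun b τ hb => ?_⟩
  obtain ⟨c, hc, hle⟩ := hQ _ _ _ hb.1
  exact ⟨c, ⟨hc, hb.2⟩, hle⟩

theorem seq {T' q' : ℕ} {c' : Cmd} {p' : β → PMF γ}
    {Q' : γ → (ℕ → ℕ) → (ℕ → ℕ → ℕ) → Prop} (h : Impl f D fuel W T q c R A p Q)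
    (h' : ∀ b R' A', Q b R' A' → Same c R A R' A' → Impl f D fuel W T' q' c' R' A' (p' b) Q') :
    Impl f D fuel W (T + T') (q + q') (.seq c c') R A (p.bind p') Q' := by
  intro σ h1 h2 h3
  refine (h σ h1 h2 h3).andThen fun b τ hb => ?_
  refine (h' b _ _ hb.1 hb.2.2.2.2 τ rfl rfl hb.2.1).mono fun b' υ hb' => ?_
  refine ⟨hb'.1, hb'.2.1, by linarith [hb'.2.2.1, hb.2.2.1],
    by linarith [hb'.2.2.2.1, hb.2.2.2.1], ?_, ?_⟩
  · intro x hx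
    simp only [Cmd.wr, Bool.or_eq_false_iff] at hx
    rw [hb'.2.2.2.2.1 x hx.2, hb.2.2.2.2.1 x hx.1]
  · intro a ha
    simp only [Cmd.wa, Bool.or_eq_false_iff] at ha
    rw [hb'.2.2.2.2.2 a ha.2, hb.2.2.2.2.2 a ha.1]

theorem pure_seq {T' q' : ℕ} {c' : Cmd} {b : β} {p' : PMF γ}
    {Q' : γ → (ℕ → ℕ) → (ℕ → ℕ → ℕ) → Prop} (h : Impl f D fuel W T q c R A (PMF.pure b) Q)
    (h' : ∀ R' A', Q b R' A' → Same c R A R' A' → Impl f D fuel W T' q' c' R' A' p' Q') :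
    Impl f D fuel W (T + T') (q + q') (.seq c c') R A p' Q' := by
  -- A test function that is infinite away from `b` costs nothing under the point mass at `b`; hence
  -- the abstract outcome may be taken to be `b`.
  have h2 : Impl f D fuel W T q c R A (PMF.pure b) fun b' R' A' => b' = b ∧ Q b R' A' := by
    intro σ h1 h2 h3 φ F hF
    classical
    have := h σ h1 h2 h3 φ (fun b' => if b' = b then F b else ⊤) ?_
    · simpa [Ex_pure] using this
    · intro b' τ hb'
      by_cases hb : b' = b
      · subst hb; simpa using hF b' τ ⟨⟨rfl, hb'.1⟩, hb'.2⟩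
      · simp [hb]
  have := h2.seq (p' := fun _ => p') (Q' := Q') (T' := T') (q' := q') (c' := c')
    fun b' R' A' hQ hS => h' R' A' hQ.2 hS
  rwa [PMF.pure_bind] at this

theorem ex_change {p' : PMF β} (h : Impl f D fuel W T q c R A p Q)
    (hp : ∀ F, Ex p F ≤ Ex p' F) : Impl f D fuel W T q c R A p' Q :=
  h.of_Ex_le fun F => ⟨F, hp F, fun b _ _ hb => ⟨b, hb, le_rfl⟩⟩

/-- A computation that is followed by a deterministic one. -/
theorem seq_pure {T' q' : ℕ} {c' : Cmd} {g : β → γ}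
    {Q' : γ → (ℕ → ℕ) → (ℕ → ℕ → ℕ) → Prop} (h : Impl f D fuel W T q c R A p Q)
    (h' : ∀ b R' A', Q b R' A' → Same c R A R' A' →
      Impl f D fuel W T' q' c' R' A' (PMF.pure (g b)) Q') :
    Impl f D fuel W (T + T') (q + q') (.seq c c') R A (p.bind fun b => PMF.pure (g b)) Q' :=
  h.seq h'

end Impl

/-- The registers and arrays after straight-line code. -/
def runs : List Stmt → (ℕ → ℕ) × (ℕ → ℕ → ℕ) → (ℕ → ℕ) × (ℕ → ℕ → ℕ)
  | [], m => m
  | c :: l, m => runs l (c.runReg f m.1 m.2, c.runArr m.1 m.2)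

/-- All words that occur in the execution of straight-line code are at most `W`. -/
def oks : List Stmt → (ℕ → ℕ) × (ℕ → ℕ → ℕ) → Prop
  | [], _ => True
  | c :: l, m => c.ok W m.1 m.2 ∧ oks l (c.runReg f m.1 m.2, c.runArr m.1 m.2)

/-- The number of steps of straight-line code, without those of the queries. -/
def costs : List Stmt → ℕ
  | [] => 1
  | c :: l => c.cost + costs l

/-- The number of queries of straight-line code. -/
def qs : List Stmt → ℕ
  | [] => 0
  | c :: l => c.queries + qs l

namespace Impl
variable {f D fuel W}
variable {β : Type*} {R : ℕ → ℕ} {A : ℕ → ℕ → ℕ} {Q : β → (ℕ → ℕ) → (ℕ → ℕ → ℕ) → Prop}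

theorem block (hW : 1 ≤ W) {b : β} (l : List Stmt) (hwf : l.all (·.wf) = true)
    (hok : (∀ x, R x ≤ W) → (∀ a j, A a j ≤ W) → oks f W l (R, A))
    (hQ : Q b (runs f l (R, A)).1 (runs f l (R, A)).2) :
    Impl f D fuel W (costs l + qs l * (n + 1)) (qs l) (.block l) R A (PMF.pure b) Q := by
  refine of_ok fun hR hA => ?_
  replace hok := hok hR hA
  clear hR hA
  suffices h : Impl f D fuel W (costs l + qs l * (n + 1)) (qs l) (.block l) R A (PMF.pure b)
      (fun _ R' A' => R' = (runs f l (R, A)).1 ∧ A' = (runs f l (R, A)).2) by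
    have h' : Impl f D fuel W (costs l + qs l * (n + 1)) (qs l) (.block l) R A (PMF.pure b)
        (fun _ R' A' => Q b R' A') :=
      h.mono le_rfl le_rfl fun b' R' A' hb _ => by rw [hb.1, hb.2]; exact hQ
    exact h'.of_Ex_le fun F => ⟨fun _ => F b, by simp [Ex_pure], fun _ _ _ hb => ⟨b, hb, le_rfl⟩⟩
  clear hQ
  induction l generalizing R A with
  | nil =>
    intro σ h1 h2 h3
    simp only [Cmd.code, List.foldr_nil, exec]
    refine Sim.pure ⟨⟨?_, h2⟩, h3.setReg _ (Nat.zero_le _) 1, ?_, le_rfl, ?_, ?_⟩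
    · simp [State.setReg, State.tick, low_update_temp, runs, h1]
    · simp [State.setReg, State.tick, costs, qs]
    · intro x _; simp [State.setReg, State.tick, low_update_temp, h1]
    · intro a _; simp [State.setReg, State.tick, h2]
  | cons c l ih =>
    intro σ h1 h2 h3
    simp only [List.all_cons, Bool.and_eq_true] at hwf
    obtain ⟨τ, g1, g2, g3, g4, g5, g6⟩ := c.exec_code f D fuel W hW hwf.1 σ
    simp only [Cmd.code, List.foldr_cons, exec, g1, andThen_pure]
    rw [h1, h2] at g2 g3 g6
    refine (ih hwf.2 hok.2 τ g3 g2 (g6 h3 hok.1)).mono fun b' υ hb => ?_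
    refine ⟨hb.1, hb.2.1, ?_, ?_, ?_, ?_⟩
    · have := hb.2.2.1
      rw [g4] at this
      refine this.trans (le_of_eq ?_)
      simp only [costs, qs]; ring
    · have := hb.2.2.2.1
      rw [g5] at this
      refine this.trans (le_of_eq ?_)
      simp only [qs]; ring
    · intro x hx
      simp only [Cmd.wr, List.any_cons, Bool.or_eq_false_iff] at hx
      rw [hb.2.2.2.2.1 x hx.2]
      have := hx.1
      cases c <;> simp_all [Stmt.runReg, Stmt.wr, Function.update]
    · intro x hx
      simp only [Cmd.wa, List.any_cons, Bool.or_eq_false_iff] at hx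
      rw [hb.2.2.2.2.2 x hx.2]
      have := hx.1
      cases c <;> simp_all [Stmt.runArr, Stmt.wa, Function.update]

theorem coin (hW : 1 ≤ W) {x : ℕ} (hx : x < 100)
    {Q : Bool → (ℕ → ℕ) → (ℕ → ℕ → ℕ) → Prop}
    (hQ : ∀ b : Bool, Q b (Function.update R x b.toNat) A) :
    Impl f D fuel W 1 0 (.coin x) R A (PMF.uniformOfFintype Bool) Q := by
  intro σ h1 h2 h3
  simp only [Cmd.code, exec]
  refine Sim.bind_pure fun b => ⟨?_, h3.setReg _ ((Bool.toNat_le _).trans hW) 1, le_rfl, le_rfl,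
    ?_, ?_⟩
  · simpa [State.setReg, State.tick, low_update hx, h1, h2] using hQ b
  · intro y hy
    have : y ≠ x := by simpa [Cmd.wr] using hy
    simp [State.setReg, State.tick, low_update hx, h1, this]
  · intro a _; simp [State.setReg, State.tick, h2]

theorem sample (hW : 1 ≤ W) {a x : ℕ} (hx : x < 100)
    {Q : (Fin n → Bool) → (ℕ → ℕ) → (ℕ → ℕ → ℕ) → Prop}
    (hQ : ∀ u : Fin n → Bool, Q u (Function.update R x (f u).toNat)
      (Function.update A a fun j => if h : j < n then (u ⟨j, h⟩).toNat else A a j)) :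
    Impl f D fuel W (n + 1) 1 (.sample a x) R A D Q := by
  intro σ h1 h2 h3
  simp only [Cmd.code, exec]
  refine Sim.bind_pure fun u => ⟨?_, ?_, le_rfl, le_rfl, ?_, ?_⟩
  · simpa [State.setReg, State.countQuery, State.writePoint, low_update hx, h1, h2] using hQ u
  · have h : (σ.writePoint a u).Ok W := by
      refine ⟨h3.1, h3.2.1, fun b j => ?_⟩
      simp only [State.writePoint]
      by_cases hb : b = a
      · subst hb
        simp only [Function.update_self]
        split_ifs
        · exact (Bool.toNat_le _).trans hW
        · exact h3.2.2 _ _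
      · simpa [hb] using h3.2.2 _ _
    exact h.setReg x ((Bool.toNat_le (f u)).trans hW) 0
  · intro y hy
    have : y ≠ x := by simpa [Cmd.wr] using hy
    simp [State.setReg, State.countQuery, State.writePoint, low_update hx, h1, this]
  · intro b hb
    have : b ≠ a := by simpa [Cmd.wa] using hb
    simp [State.setReg, State.countQuery, State.writePoint, h2, this]

end Impl

/-- `k` steps of a random process, where the steps are numbered from `i`. -/
noncomputable def iter {α : Type*} (step : ℕ → α → PMF α) : ℕ → ℕ → α → PMF α
  | _, 0, a => PMF.pure a
  | i, k + 1, a => (step i a).bind (iter step (i + 1) k)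

namespace Impl
variable {f D fuel W}

/-- The register `m` holds the number `N - j` of remaining iterations, so the test for zero stops
the loop after exactly `k` more of them. The strict inequality `k < fu` is needed because the final,
failing test also uses up one unit of fuel. -/
theorem iterate_loop {α : Type*} {step : ℕ → α → PMF α} {I : ℕ → α → (ℕ → ℕ) → (ℕ → ℕ → ℕ) → Prop}
    {R : ℕ → ℕ} {A : ℕ → ℕ → ℕ} {T q : ℕ} {i m c : ℕ} {body : Cmd} {N : ℕ} {b : Prog}
    (hm : m < 100)
    (hb : ∀ j a (σ : State), j < N → σ.Ok W → low σ.reg c = N → low σ.reg i = j →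
      low σ.reg m = N - j → I j a (low σ.reg) σ.arr →
      Same (.for_ i m c body) R A (low σ.reg) σ.arr →
      Sim (exec f D fuel b σ) (step j a) fun a' τ =>
        (τ.Ok W ∧ low τ.reg c = N ∧ low τ.reg i = j + 1 ∧ low τ.reg m = N - (j + 1) ∧
          I (j + 1) a' (low τ.reg) τ.arr ∧ Same (.for_ i m c body) R A (low τ.reg) τ.arr) ∧
        τ.time ≤ σ.time + T ∧ τ.queries ≤ σ.queries + q) :
    ∀ (k fu j : ℕ) (a : α) (σ : State), k < fu → j + k = N → σ.Ok W → low σ.reg c = N →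
      low σ.reg i = j → low σ.reg m = N - j → I j a (low σ.reg) σ.arr →
      Same (.for_ i m c body) R A (low σ.reg) σ.arr →
      Sim (DTTest.iterate m (exec f D fuel b) fu σ) (iter step j k a) fun a' τ =>
        I N a' (low τ.reg) τ.arr ∧ τ.Ok W ∧ τ.time ≤ σ.time + (k * (T + 1) + 1) ∧
          τ.queries ≤ σ.queries + k * q ∧ Same (.for_ i m c body) R A (low τ.reg) τ.arr := by
  intro k
  induction k with
  | zero =>
    intro fu j a σ hk hj hok hc hi hm' hI hS
    obtain ⟨fu, rfl⟩ : ∃ g, fu = g + 1 := ⟨fu - 1, by omega⟩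
    have h0 : σ.reg m = 0 := by rw [← low_apply hm (R := σ.reg), hm']; omega
    simp only [DTTest.iterate, h0, if_true, iter]
    obtain rfl : j = N := by omega
    exact Sim.pure ⟨hI, hok, by simp [State.tick], by simp [State.tick], hS⟩
  | succ k ih =>
    intro fu j a σ hk hj hok hc hi hm' hI hS
    obtain ⟨fu, rfl⟩ : ∃ g, fu = g + 1 := ⟨fu - 1, by omega⟩
    have h0 : σ.reg m ≠ 0 := by rw [← low_apply hm (R := σ.reg), hm']; omega
    simp only [DTTest.iterate, h0, if_false, iter]
    refine (hb j a (σ.tick 1) (by omega) hok hc hi hm' hI hS).andThen fun a' τ hτ => ?_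
    refine (ih fu (j + 1) a' τ (by omega) (by omega) hτ.1.1 hτ.1.2.1 hτ.1.2.2.1 hτ.1.2.2.2.1
      hτ.1.2.2.2.2.1 hτ.1.2.2.2.2.2).mono fun a'' υ hυ => ?_
    refine ⟨hυ.1, hυ.2.1, ?_, ?_, hυ.2.2.2.2⟩
    · have h1 := hυ.2.2.1
      have h2 := hτ.2.1
      simp only [State.tick] at h2
      refine h1.trans ?_
      rw [add_mul]; omega
    · have h1 := hυ.2.2.2.1
      have h2 := hτ.2.2
      simp only [State.tick] at h2
      rw [add_mul]; omega

/-- The rule for counted loops. -/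
theorem for_ (hW : 1 ≤ W) (hfuel : W < fuel) {α : Type*} (step : ℕ → α → PMF α)
    (I : ℕ → α → (ℕ → ℕ) → (ℕ → ℕ → ℕ) → Prop) {R : ℕ → ℕ} {A : ℕ → ℕ → ℕ} {T q : ℕ} {i m c : ℕ}
    {body : Cmd} {N : ℕ} {a₀ : α} (hN : R c = N)
    (hreg : (decide (i < 100) && decide (m < 100) && decide (c < 100) && !decide (i = m) &&
      !decide (i = c) && !decide (m = c) && !body.wr i && !body.wr c) = true)
    (h0 : I 0 a₀ R A)
    (hI : ∀ j a R' A' v w, I j a R' A' →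
      I j a (Function.update (Function.update R' i v) m w) A')
    (hb : ∀ j a R' A', j < N → R' i = j → Same (.for_ i m c body) R A R' A' → I j a R' A' →
      Impl f D fuel W T q body R' A' (step j a) (I (j + 1))) :
    Impl f D fuel W (N * (T + 4) + 3) (N * q) (.for_ i m c body) R A (iter step 0 N a₀) (I N) := by
  simp only [Bool.and_eq_true, decide_eq_true_eq, Bool.not_eq_true', decide_eq_false_iff_not]
    at hreg
  obtain ⟨⟨⟨⟨⟨⟨⟨hi, hm⟩, hc⟩, him⟩, hic⟩, hmc⟩, hbi⟩, hbc⟩ := hreg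
  intro σ h1 h2 h3
  -- The number of iterations is read from a register, so it is itself a word and at most `W <
  -- fuel`. One value of the fuel thus serves every loop.
  have hNW : N ≤ W := by
    rw [← hN, ← h1, low_apply hc]; exact h3.2.1 c
  have hupd : ∀ (R' : ℕ → ℕ) v w, (Function.update (Function.update R' i v) m w) c = R' c := by
    intro R' v w
    rw [Function.update_of_ne (Ne.symm hmc), Function.update_of_ne (Ne.symm hic)]
  have hwr : ∀ x, (Cmd.for_ i m c body).wr x = false → x ≠ i ∧ x ≠ m ∧ body.wr x = false := by
    intro x hx
    simpa [Cmd.wr, Bool.or_eq_false_iff, and_assoc] using hx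
  set σ' : State := (((σ.setReg i 0).tick 1).setReg m
    (ArithOp.sub.eval (((σ.setReg i 0).tick 1).reg c) (((σ.setReg i 0).tick 1).reg i))).tick 1
    with hσ'
  have hrun : exec f D fuel (Cmd.for_ i m c body).code σ = iterate m (exec f D fuel
      (.seq body.code (.seq (.const m 1) (.seq (.arith .add i i m) (.arith .sub m c i))))) fuel σ' := by
    change andThen (PMF.pure _) _ = _
    rw [andThen_pure]
    change andThen (PMF.pure _) _ = _
    rw [andThen_pure]
    rfl
  rw [hrun]
  have hσc : σ.reg c = N := by rw [← low_apply hc (R := σ.reg), h1, hN]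
  have hlow : low σ'.reg = Function.update (Function.update R i 0) m N := by
    rw [← h1]
    simp only [hσ', State.setReg, State.tick, low_update hi, low_update hm, ArithOp.eval]
    simp [Function.update_of_ne (Ne.symm hic), hσc]
  have harr : σ'.arr = A := h2
  have hok : σ'.Ok W := by
    refine (h3.setReg i (Nat.zero_le _) 1).setReg m ?_ 1
    simp [ArithOp.eval, State.setReg, State.tick, Function.update_of_ne (Ne.symm hic), hσc, hNW]
  -- The three extra steps per iteration load the constant `1` into `m`, used as a temporary,
  -- increment `i`, and restore `m` to the number of remaining iterations.
  have key := iterate_loop (W := W) (f := f) (D := D) (fuel := fuel) (R := R) (A := A)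
    (step := step) (I := I) (T := T + 3) (q := q) (i := i) (m := m) (c := c) (body := body)
    (N := N) (b := .seq body.code (.seq (.const m 1) (.seq (.arith .add i i m)
      (.arith .sub m c i)))) hm ?_ N fuel 0 a₀ σ' (by omega) (by omega) hok
    (by rw [hlow, hupd, hN]) (by rw [hlow]; simp [him]) (by rw [hlow]; simp)
    (by rw [hlow, harr]; exact hI _ _ _ _ _ _ h0) ?_
  · refine key.mono fun a' τ hτ => ⟨hτ.1, hτ.2.1, ?_, ?_, hτ.2.2.2.2⟩
    · have := hτ.2.2.1
      have h4 : σ'.time = σ.time + 2 := rfl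
      rw [h4] at this
      refine this.trans (le_of_eq ?_); ring
    · exact hτ.2.2.2.1
  · intro j a τ hj hokτ hcτ hiτ hmτ hIτ hSτ
    simp only [exec]
    have h5 := hb j a (low τ.reg) τ.arr hj hiτ hSτ hIτ τ rfl rfl hokτ
    rw [← PMF.bind_pure (step j a)]
    refine h5.andThen fun a' υ hυ => ?_
    simp only [andThen_pure]
    obtain ⟨hυ1, hυ2, hυ3, hυ4, hυ5⟩ := hυ
    have hυi : υ.reg i = j := by
      rw [← low_apply hi (R := υ.reg), hυ5.1 i hbi, hiτ]
    have hυc : υ.reg c = N := by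
      rw [← low_apply hc (R := υ.reg), hυ5.1 c hbc, hcτ]
    have e1 : (Function.update υ.reg m 1) i = j := by
      rw [Function.update_of_ne him, hυi]
    have e2 : ∀ v, (Function.update (Function.update υ.reg m 1) i v) c = N := by
      intro v
      rw [Function.update_of_ne (Ne.symm hic), Function.update_of_ne (Ne.symm hmc), hυc]
    have hl : low (Function.update (Function.update (Function.update υ.reg m 1) i (j + 1)) m
        (N - (j + 1))) =
        Function.update (Function.update (low υ.reg) i (j + 1)) m (N - (j + 1)) := by
      rw [low_update hm, low_update hi, low_update hm, Function.update_comm him,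
        Function.update_idem, Function.update_comm (Ne.symm him)]
    refine Sim.pure ⟨⟨?_, ?_, ?_, ?_, ?_, ?_, ?_⟩, ?_, ?_⟩
    · refine ((hυ2.setReg m hW 1).setReg i ?_ 1).setReg m ?_ 1
      · simp only [State.setReg, State.tick, ArithOp.eval, e1, Function.update_self]; omega
      · simp only [State.setReg, State.tick, ArithOp.eval, e2, Function.update_self]; omega
    all_goals simp only [State.setReg, State.tick, ArithOp.eval, e1, e2, Function.update_self, hl]
    · rw [hupd, low_apply hc, hυc]
    · simp [him]
    · exact hI _ _ _ _ _ _ hυ1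
    · intro x hx
      have hx' := hwr x hx
      rw [Function.update_of_ne hx'.2.1, Function.update_of_ne hx'.1, hυ5.1 x hx'.2.2,
        hSτ.1 x hx]
    · intro x hx
      rw [hυ5.2 x hx, hSτ.2 x hx]
    · omega
    · exact hυ4
  · constructor
    · intro x hx
      have hx' := hwr x hx
      rw [hlow, Function.update_of_ne hx'.2.1, Function.update_of_ne hx'.1]
    · intro x _; rw [harr]

theorem iter_pure {α : Type*} (g : ℕ → α → α) (i k : ℕ) (a : α) :
    ∃ b, iter (fun i a => PMF.pure (g i a)) i k a = PMF.pure b := by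
  induction k generalizing i a with
  | zero => exact ⟨a, rfl⟩
  | succ k ih => simp only [iter, PMF.pure_bind]; exact ih _ _

/-- The rule for deterministic counted loops. -/
theorem for_pure (hW : 1 ≤ W) (hfuel : W < fuel)
    (I : ℕ → (ℕ → ℕ) → (ℕ → ℕ → ℕ) → Prop) {R : ℕ → ℕ} {A : ℕ → ℕ → ℕ} {T q : ℕ} {i m c : ℕ}
    {body : Cmd} {N : ℕ} (hN : R c = N)
    (hreg : (decide (i < 100) && decide (m < 100) && decide (c < 100) && !decide (i = m) &&
      !decide (i = c) && !decide (m = c) && !body.wr i && !body.wr c) = true)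
    (h0 : I 0 R A)
    (hI : ∀ j R' A' v w, I j R' A' → I j (Function.update (Function.update R' i v) m w) A')
    (hb : ∀ j R' A', j < N → R' i = j → Same (.for_ i m c body) R A R' A' → I j R' A' →
      Impl f D fuel W T q body R' A' (PMF.pure ()) (fun _ => I (j + 1))) :
    Impl f D fuel W (N * (T + 4) + 3) (N * q) (.for_ i m c body) R A (PMF.pure ())
      (fun _ => I N) := by
  have h := for_ hW hfuel (fun _ (_ : Unit) => PMF.pure ()) (fun j _ => I j) (a₀ := ()) hN hreg h0
    (fun j _ => hI j) (fun j _ R' A' hj hi hS hIj => hb j R' A' hj hi hS hIj)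
  obtain ⟨b, hb'⟩ := iter_pure (fun _ (_ : Unit) => ()) 0 N ()
  rwa [hb'] at h

end Impl
end Machine

end DTTest

namespace DTTest

open scoped ENNReal

/-! ### The abstract algorithm -/

section Abstract
variable {n : ℕ} (f : (Fin n → Bool) → Bool) (D : PMF (Fin n → Bool))

/-- A uniformly random point of the cube. -/
noncomputable def cube (n : ℕ) : PMF (Fin n → Bool) := PMF.uniformOfFintype (Fin n → Bool)

/-- Append a random bit to every block number. -/
noncomputable def splitStep (_ : ℕ) (blk : Fin n → ℕ) : PMF (Fin n → ℕ) :=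
  (cube n).bind fun b => PMF.pure fun j => 2 * blk j + (b j).toNat

/-- Set to `0` all coordinates of `x` that lie in a block with a number less than `c` that is not
listed in `L`. -/
def cutPt (blk : Fin n → ℕ) (L : List (ℕ × (Fin n → Bool))) (c : ℕ) (x : Fin n → Bool) :
    Fin n → Bool :=
  fun j => x j && (decide (blk j ∈ L.map Prod.fst) || decide (c ≤ blk j))

/-- Replace the block `β` of `w` by that of `b`. -/
def blend (blk : Fin n → ℕ) (β : ℕ) (w b : Fin n → Bool) : Fin n → Bool :=
  fun j => if blk j = β then b j else w j

/-- Binary search for a number `lo` such that the values of `f` at `cutPt blk L lo x` and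
`cutPt blk L (lo + 1) x` differ. -/
def bsearch (blk : Fin n → ℕ) (L : List (ℕ × (Fin n → Bool))) (x : Fin n → Bool) : ℕ → ℕ → ℕ
  | 0, lo => lo
  | k + 1, lo =>
      if f (cutPt blk L (lo + 2 ^ k) x) ≠ f x then bsearch blk L x k lo
      else bsearch blk L x k (lo + 2 ^ k)

/-- One example in the search for relevant blocks: the state consists of the blocks found so far
with their witnesses and of the number of consecutive examples without a new block. -/
def grow (s N K : ℕ) (blk : Fin n → ℕ) (a : List (ℕ × (Fin n → Bool)) × ℕ) (x : Fin n → Bool) :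
    List (ℕ × (Fin n → Bool)) × ℕ :=
  if a.2 < N ∧ a.1.length < s then
    if f (cutPt blk a.1 (2 ^ K) x) ≠ f x then
      (a.1 ++ [(bsearch f blk a.1 x K 0, cutPt blk a.1 (bsearch f blk a.1 x K 0) x)], 0)
    else (a.1, a.2 + 1)
  else a

/-- A random estimate of the value at `z` of the literal of the block `β`. -/
noncomputable def est (blk : Fin n → ℕ) (B : ℕ × (Fin n → Bool)) (z : Fin n → Bool) : PMF Bool :=
  (cube n).bind fun b => PMF.pure
    (xor (f (blend blk B.1 B.2 b)) (f (blend blk B.1 B.2 fun j => xor (b j) (z j))))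

/-- One round of tests for a block: `x` is the current example, and `y` the estimate of the value
of the literal at `x`. -/
noncomputable def round (blk : Fin n → ℕ) (B : ℕ × (Fin n → Bool)) (x : Fin n → Bool) (y : Bool)
    (_ : ℕ) (g : Bool) : PMF Bool :=
  (est f blk B x).bind fun e => (cube n).bind fun u => (cube n).bind fun v =>
  (est f blk B fun _ => true).bind fun o => (est f blk B u).bind fun e₁ =>
  (est f blk B u).bind fun e₂ => (est f blk B v).bind fun e₃ =>
  (est f blk B fun j => u j && v j).bind fun e₄ =>
  PMF.pure (g && !(xor e y) && o && !(xor e₁ e₂) && !(xor e₄ (e₁ && e₃)))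

/-- Read the literal of block number `i` at `x`, with `t` rounds of tests. -/
noncomputable def reader (blk : Fin n → ℕ) (L : List (ℕ × (Fin n → Bool))) (t : ℕ)
    (x : Fin n → Bool) (i : ℕ) (a : Bool × (ℕ → Bool)) : PMF (Bool × (ℕ → Bool)) :=
  (est f blk (L.getD i (0, fun _ => false)) x).bind fun y =>
  (iter (round f blk (L.getD i (0, fun _ => false)) x y) 0 t a.1).bind fun g =>
  PMF.pure (g, Function.update a.2 i y)

/-- Draw an example and read the literals of all blocks in `L` at this example. -/
noncomputable def testStep (blk : Fin n → ℕ) (L : List (ℕ × (Fin n → Bool))) (t : ℕ) (_ : ℕ)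
    (a : Bool × List ((Fin n → Bool) × (ℕ → Bool))) :
    PMF (Bool × List ((Fin n → Bool) × (ℕ → Bool))) :=
  D.bind fun x => (iter (reader f blk L t x) 0 L.length (a.1, fun _ => false)).bind fun b =>
  PMF.pure (b.1, (x, b.2) :: a.2)

end Abstract

/-- The point `y` of `{0,1}^k` satisfies all literals on the path from the root to the node `p`
of the complete tree in which the children of a node are labelled by the `2k` literals: the child
`2ki + 2v + b + 1` of the node `i` corresponds to the literal `y_v = b`. -/
def reach (k : ℕ) (y : ℕ → Bool) : ℕ → Bool
  | 0 => true
  | q + 1 => reach k y (q / (2 * k)) && !(xor (y (q % (2 * k) / 2)) (decide (q % (2 * k) % 2 = 1)))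
  decreasing_by exact Nat.lt_succ_of_le (Nat.div_le_self _ _)

/-- The value `s + 1 - σ`, where `σ` is the smallest size of a decision tree of depth less than
`e` below the node `p`; here `sn b p` says whether an example with label `b` reaches `p`. -/
def cred (k s : ℕ) (sn : Bool → ℕ → Bool) : ℕ → ℕ → ℕ
  | 0, _ => 0
  | e + 1, p =>
      max ((!(sn false p && sn true p)).toNat * s)
        ((Finset.range k).sup fun i => cred k s sn e (p * (2 * k) + 2 * i + 1) +
          cred k s sn e (p * (2 * k) + 2 * i + 2) - (s + 1))

section Abstract
variable {n : ℕ} (f : (Fin n → Bool) → Bool) (D : PMF (Fin n → Bool))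

/-- Whether an example with label `b` reaches the node `p`. -/
def seen (k : ℕ) (lab : (Fin n → Bool) → Bool) (S : List ((Fin n → Bool) × (ℕ → Bool))) (b : Bool)
    (p : ℕ) : Bool :=
  S.any fun z => !(xor (lab z.1) b) && reach k z.2 p

/-- The final decision. -/
def verdict (s N K dd : ℕ) (blk : Fin n → ℕ) (a : List (ℕ × (Fin n → Bool)) × ℕ)
    (b : Bool × List ((Fin n → Bool) × (ℕ → Bool))) : Prop :=
  b.1 = true ∧ N ≤ a.2 ∧
    0 < cred a.1.length s (seen a.1.length (fun x => f (cutPt blk a.1 (2 ^ K) x)) b.2) (dd + 1) 0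

/-- The abstract algorithm. -/
noncomputable def alg (s N K t dd : ℕ) : PMF Prop :=
  (iter splitStep 0 K fun _ => 0).bind fun blk =>
  (iter (fun _ a => D.bind fun x => PMF.pure (grow f s N K blk a x)) 0 (s * N) ([], 0)).bind fun a =>
  (iter (testStep f D blk a.1 t) 0 N (true, [])).bind fun b =>
  PMF.pure (verdict f s N K dd blk a b)

end Abstract

/-! ### The program -/

namespace Exp

/-- `a xor b` for bits -/
def xor (a b : Exp) : Exp := (a - b) + (b - a)
/-- the negation of a bit -/
def not (a : Exp) : Exp := lit 1 - a
/-- `1` if `a ≤ b` -/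
def le (a b : Exp) : Exp := lit 1 - (a - b)
/-- `1` if `a = b` -/
def eq (a b : Exp) : Exp := lit 1 - ((a - b) + (b - a))
/-- `a or b` for bits -/
def or (a b : Exp) : Exp := lit 1 - ((lit 1 - a) - b)

end Exp

namespace Tester
open Exp Stmt Cmd

/-- fill the array `a` with random bits -/
def randVec (a : ℕ) : Cmd := for_ 20 21 0 (seq (coin 60) (block [put a (reg 20) (reg 60)]))

/-- the parameters -/
def params : Cmd :=
  seq (block [set 4 (reg 1 * reg 3), set 5 (lit 1), set 6 (lit 0)])
  -- The binary length of `E` is found by `E` rounds of conditional doubling; time linear in `E` is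
  -- affordable.
  (seq (for_ 22 23 4 (block [set 60 (Exp.le (reg 5) (reg 4)), set 6 (reg 6 + reg 60),
    set 5 (reg 5 * (lit 1 + reg 60))]))
  -- With `l` in register `6` and `2^l` in register `5`, the registers `7` to `12` receive `K = 2l +
  -- 4`, `2^K`, `t = 100l`, `N = 16lE`, `min d s` (by truncated subtraction) and `sN`.
  (block [set 7 (lit 2 * reg 6 + lit 4), set 8 (lit 16 * (reg 5 * reg 5)),
    set 9 (lit 100 * reg 6), set 10 (lit 16 * reg 6 * reg 4), set 11 (reg 2 - (reg 2 - reg 1)),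
    set 12 (reg 1 * reg 10)]))

/-- the random partition -/
def split : Cmd :=
  for_ 22 23 7 (seq (randVec 5) (for_ 20 21 0 (block
    [put 0 (reg 20) (lit 2 * get 0 (reg 20) + get 5 (reg 20))])))

/-- `cutPt` of the array `4` at the value of register `44`, in the array `6` -/
def cut : Cmd :=
  for_ 20 21 0 (block [put 6 (reg 20) (get 4 (reg 20) *
    Exp.or (get 1 (get 0 (reg 20))) (Exp.le (reg 44) (get 0 (reg 20))))])

/-- binary search -/
def search : Cmd :=
  seq (block [set 40 (lit 0), set 41 (reg 8)])
  (for_ 22 23 7 (seq (block [set 41 (reg 41 / lit 2), set 44 (reg 40 + reg 41)])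
    (seq cut (block [ask 42 6, set 40 (reg 40 + reg 41 * Exp.not (Exp.xor (reg 42) (reg 16)))]))))

/-- one example in the search for relevant blocks -/
def growCmd : Cmd :=
  seq (sample 4 16) (seq (block [set 44 (reg 8)]) (seq cut
  (seq (block [ask 42 6, set 46 (Exp.le (reg 14 + lit 1) (reg 10) * Exp.le (reg 13 + lit 1) (reg 1)),
    set 43 (reg 46 * Exp.xor (reg 42) (reg 16))])
  -- There is no branching: the search runs on every example and its result is written to the first
  -- free row. The bit in register `43` decides whether this row is counted.
  (seq search (seq (block [set 44 (reg 40)]) (seq cut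
  (seq (for_ 20 21 0 (block [put 2 (reg 13 * reg 0 + reg 20) (get 6 (reg 20))]))
  (block [put 3 (reg 13) (reg 40), put 1 (reg 40) (Exp.or (get 1 (reg 40)) (reg 43)),
    set 13 (reg 13 + reg 43), set 14 ((reg 14 + reg 46) * Exp.not (reg 43))]))))))))

/-- an estimate of the literal of block number `R[26]` at the point in the array `z` -/
def estCmd (z out : ℕ) : Cmd :=
  seq (randVec 5)
  (seq (for_ 20 21 0 (block
    [set 61 (Exp.eq (get 0 (reg 20)) (get 3 (reg 26))),
     set 62 (Exp.not (reg 61) * get 2 (reg 26 * reg 0 + reg 20)),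
     put 6 (reg 20) (reg 61 * get 5 (reg 20) + reg 62),
     put 7 (reg 20) (reg 61 * Exp.xor (get 5 (reg 20)) (get z (reg 20)) + reg 62)]))
  (block [ask 63 6, ask 64 7, set out (Exp.xor (reg 63) (reg 64))]))

/-- one round of tests -/
def roundCmd : Cmd :=
  seq (estCmd 4 47) (seq (randVec 8) (seq (randVec 9)
  (seq (for_ 20 21 0 (block [put 10 (reg 20) (get 8 (reg 20) * get 9 (reg 20)),
    put 11 (reg 20) (lit 1)]))
  (seq (estCmd 11 48) (seq (estCmd 8 49) (seq (estCmd 8 50) (seq (estCmd 9 51) (seq (estCmd 10 52)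
  (block [set 15 (reg 15 * Exp.not (Exp.xor (reg 47) (reg 45)) * reg 48 *
    Exp.not (Exp.xor (reg 49) (reg 50)) * Exp.not (Exp.xor (reg 52) (reg 49 * reg 51)))])))))))))

/-- read the literals of all blocks -/
def readCmd : Cmd :=
  for_ 26 27 13 (seq (estCmd 4 45) (seq (for_ 28 29 9 roundCmd)
    (block [put 12 (reg 26) (reg 45)])))

/-- mark the nodes that the current example reaches -/
def markCmd : Cmd :=
  seq (block [set 65 (reg 16 * reg 18), put 14 (reg 65) (lit 1)])
  (for_ 30 31 19 (block
    [set 66 (reg 30 - reg 30 / reg 17 * reg 17),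
     set 67 (reg 66 / lit 2),
     -- The node `q + 1` has the parent `q / 2k`, whose entry is already known, and the literal on
     -- the edge is encoded by `q mod 2k`. Register `65` selects the half of the table that belongs
     -- to the label.
     put 13 (reg 30 + lit 1) (get 13 (reg 30 / reg 17) *
       Exp.not (Exp.xor (get 12 (reg 67)) (reg 66 - lit 2 * reg 67))),
     set 66 (reg 65 + (reg 30 + lit 1)),
     put 14 (reg 66) (Exp.or (get 14 (reg 66)) (get 13 (reg 30 + lit 1)))]))

/-- one example of the test -/
def testCmd : Cmd :=
  seq (sample 4 16) (seq (block [set 44 (reg 8)]) (seq cut (seq (block [ask 16 6])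
    (seq readCmd markCmd))))

/-- the size of the tree of all paths -/
def sizeCmd : Cmd :=
  seq (block [set 17 (lit 2 * reg 13), set 18 (lit 1)])
  (seq (for_ 30 31 11 (block [set 18 (reg 18 * reg 17 + lit 1)]))
  (block [set 19 (reg 18 - lit 1), put 13 (lit 0) (lit 1), set 15 (lit 1)]))

/-- find the smallest consistent tree -/
def credCmd : Cmd :=
  -- Nodes are treated in decreasing order, so that children precede their parents.
  for_ 30 31 18 (seq (block [set 56 (reg 19 - reg 30), set 55 (lit 0)])
    (seq (for_ 32 33 13 (block
      [set 57 (reg 56 * reg 17 + lit 2 * reg 32),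
       set 58 (get 15 (reg 57 + lit 1) + get 15 (reg 57 + lit 2) - (reg 1 + lit 1)),
       -- Under truncated subtraction, `a + (b - a)` is the maximum of `a` and `b`.
       set 55 (reg 55 + (reg 58 - reg 55))]))
    (block [set 57 (Exp.not (get 14 (reg 56) * get 14 (reg 18 + reg 56)) * reg 1),
      put 15 (reg 56) (reg 57 + (reg 55 - reg 57))])))

/-- the whole program -/
def prog : Cmd :=
  seq params (seq split (seq (for_ 24 25 12 growCmd) (seq sizeCmd
    (seq (for_ 24 25 10 testCmd) (seq credCmd
    (block [set 0 (reg 15 * Exp.le (reg 10) (reg 14) * get 15 (lit 0))]))))))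

end Tester
end DTTest

namespace DTTest

open scoped ENNReal

/-! ### Random points of the cube, and their generation by coins -/

section Cube
variable {n : ℕ}

theorem Ex_uniform {α : Type*} [Fintype α] [Nonempty α] (F : α → ℝ≥0∞) :
    Ex (PMF.uniformOfFintype α) F = (Fintype.card α : ℝ≥0∞)⁻¹ * ∑ a, F a := by
  unfold Ex
  rw [tsum_fintype, Finset.mul_sum]
  exact Finset.sum_congr rfl fun a _ => by rw [PMF.uniformOfFintype_apply]

theorem Ex_uniform_equiv {α : Type*} [Fintype α] [Nonempty α] (e : α ≃ α) (F : α → ℝ≥0∞) :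
    Ex (PMF.uniformOfFintype α) (fun a => F (e a)) = Ex (PMF.uniformOfFintype α) F := by
  rw [Ex_uniform, Ex_uniform, Equiv.sum_comp e F]

/-- The bijection `b ↦ b xor z` of the cube. -/
def xorEquiv (z : Fin n → Bool) : (Fin n → Bool) ≃ (Fin n → Bool) where
  toFun b := fun j => xor (b j) (z j)
  invFun b := fun j => xor (b j) (z j)
  left_inv b := by funext j; simp
  right_inv b := by funext j; simp

theorem Ex_cube_xor (z : Fin n → Bool) (F : (Fin n → Bool) → ℝ≥0∞) :
    Ex (cube n) (fun b => F fun j => xor (b j) (z j)) = Ex (cube n) F :=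
  Ex_uniform_equiv (xorEquiv z) F

theorem Ex_coin (F : Bool → ℝ≥0∞) :
    Ex (PMF.uniformOfFintype Bool) F = 2⁻¹ * (F true + F false) := by
  rw [Ex_uniform]; simp

/-- Resampling one bit of a uniformly random point does not change its distribution. -/
theorem Ex_cube_resample (i : Fin n) (F : (Fin n → Bool) → ℝ≥0∞) :
    (Ex (PMF.uniformOfFintype Bool) fun c => Ex (cube n) fun b => F (Function.update b i c)) =
      Ex (cube n) F := by
  rw [Ex_coin, ← Ex_add]
  -- The two settings of bit `i` are `b` and `b` with this bit flipped, and the flip preserves the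
  -- uniform distribution.
  have h : ∀ b : Fin n → Bool, F (Function.update b i true) + F (Function.update b i false) =
      F b + F (fun j => xor (b j) (Function.update (fun _ => false) i true j)) := by
    intro b
    have e : (fun j => xor (b j) (Function.update (fun _ => false) i true j)) =
        Function.update b i (!b i) := by
      funext j
      by_cases hj : j = i
      · subst hj; simp
      · simp [hj]
    rw [e]
    have e2 : Function.update b i (b i) = b := Function.update_eq_self i b
    cases hb : b i
    · rw [hb] at e2; rw [e2, add_comm]; rfl
    · rw [hb] at e2; rw [e2]; rfl
  simp only [h]
  rw [Ex_add, Ex_cube_xor, ← two_mul, ← mul_assoc, ENNReal.inv_mul_cancel (by simp) (by simp),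
    one_mul]

/-- Choose the coordinate `i` at random. -/
noncomputable def coinStep (i : ℕ) (b : Fin n → Bool) : PMF (Fin n → Bool) :=
  (PMF.uniformOfFintype Bool).bind fun c => PMF.pure fun j => if j.val = i then c else b j

/-- The coordinates below `i` have been chosen already; each further coin is absorbed by resampling
coordinate `i` of a random point. -/
theorem Ex_iter_coinStep (F : (Fin n → Bool) → ℝ≥0∞) (k : ℕ) : ∀ (i : ℕ) (b : Fin n → Bool),
    i + k = n → Ex (iter coinStep i k b) F =
      Ex (cube n) fun b' => F fun j => if j.val < i then b j else b' j := by
  induction k with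
  | zero =>
    intro i b hi
    rw [iter, Ex_pure]
    have : ∀ b' : Fin n → Bool, (fun j : Fin n => if j.val < i then b j else b' j) = b := by
      intro b'; funext j; rw [if_pos (by omega)]
    simp only [this, Ex_const]
  | succ k ih =>
    intro i b hi
    rw [iter, Ex_bind, coinStep, Ex_bind]
    simp only [Ex_pure]
    rw [← Ex_cube_resample ⟨i, by omega⟩]
    congr 1; funext c
    rw [ih (i + 1) _ (by omega)]
    congr 1; funext b'
    congr 1; funext j
    by_cases hj : j = ⟨i, by omega⟩
    · subst hj; simp
    · have hj' : j.val ≠ i := fun h => hj (Fin.ext h)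
      rw [Function.update_of_ne hj]
      by_cases h2 : j.val < i
      · rw [if_pos (by omega), if_neg hj', if_pos h2]
      · rw [if_neg (by omega), if_neg h2]

theorem iter_coinStep (b : Fin n → Bool) (F : (Fin n → Bool) → ℝ≥0∞) :
    Ex (iter coinStep 0 n b) F = Ex (cube n) F := by
  rw [Ex_iter_coinStep F n 0 b (by omega)]; simp

end Cube

/-! ### Verification of the program -/

@[simp] theorem Exp.eval_reg (R : ℕ → ℕ) (A : ℕ → ℕ → ℕ) (x : ℕ) : (Exp.reg x).eval R A = R x := rfl
@[simp] theorem Exp.eval_lit (R : ℕ → ℕ) (A : ℕ → ℕ → ℕ) (c : ℕ) : (Exp.lit c).eval R A = c := rfl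
@[simp] theorem Exp.eval_get (R : ℕ → ℕ) (A : ℕ → ℕ → ℕ) (a : ℕ) (i : Exp) :
    (Exp.get a i).eval R A = A a (i.eval R A) := rfl
@[simp] theorem Exp.eval_add (R : ℕ → ℕ) (A : ℕ → ℕ → ℕ) (a b : Exp) :
    (a + b).eval R A = a.eval R A + b.eval R A := rfl
@[simp] theorem Exp.eval_sub (R : ℕ → ℕ) (A : ℕ → ℕ → ℕ) (a b : Exp) :
    (a - b).eval R A = a.eval R A - b.eval R A := rfl
@[simp] theorem Exp.eval_mul (R : ℕ → ℕ) (A : ℕ → ℕ → ℕ) (a b : Exp) :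
    (a * b).eval R A = a.eval R A * b.eval R A := rfl
@[simp] theorem Exp.eval_div (R : ℕ → ℕ) (A : ℕ → ℕ → ℕ) (a b : Exp) :
    (a / b).eval R A = a.eval R A / b.eval R A := rfl
@[simp] theorem Exp.eval_xor (R : ℕ → ℕ) (A : ℕ → ℕ → ℕ) (a b : Exp) :
    (Exp.xor a b).eval R A = (a.eval R A - b.eval R A) + (b.eval R A - a.eval R A) := rfl
@[simp] theorem Exp.eval_not (R : ℕ → ℕ) (A : ℕ → ℕ → ℕ) (a : Exp) :
    (Exp.not a).eval R A = 1 - a.eval R A := rfl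
@[simp] theorem Exp.eval_le (R : ℕ → ℕ) (A : ℕ → ℕ → ℕ) (a b : Exp) :
    (Exp.le a b).eval R A = 1 - (a.eval R A - b.eval R A) := rfl
@[simp] theorem Exp.eval_eq (R : ℕ → ℕ) (A : ℕ → ℕ → ℕ) (a b : Exp) :
    (Exp.eq a b).eval R A = 1 - ((a.eval R A - b.eval R A) + (b.eval R A - a.eval R A)) := rfl
@[simp] theorem Exp.eval_or (R : ℕ → ℕ) (A : ℕ → ℕ → ℕ) (a b : Exp) :
    (Exp.or a b).eval R A = 1 - ((1 - a.eval R A) - b.eval R A) := rfl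

section Ok
variable (W : ℕ) (R : ℕ → ℕ) (A : ℕ → ℕ → ℕ)
@[simp] theorem Exp.ok_reg (x : ℕ) : (Exp.reg x).ok W R A ↔ True := Iff.rfl
@[simp] theorem Exp.ok_lit (c : ℕ) : (Exp.lit c).ok W R A ↔ c ≤ W := Iff.rfl
@[simp] theorem Exp.ok_get (a : ℕ) (i : Exp) : (Exp.get a i).ok W R A ↔ i.ok W R A := Iff.rfl
@[simp] theorem Exp.ok_add (a b : Exp) : (a + b).ok W R A ↔
    a.ok W R A ∧ b.ok W R A ∧ a.eval R A + b.eval R A ≤ W := Iff.rfl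
@[simp] theorem Exp.ok_mul (a b : Exp) : (a * b).ok W R A ↔
    a.ok W R A ∧ b.ok W R A ∧ a.eval R A * b.eval R A ≤ W := Iff.rfl
@[simp] theorem Exp.ok_sub (a b : Exp) : (a - b).ok W R A ↔ a.ok W R A ∧ b.ok W R A := Iff.rfl
@[simp] theorem Exp.ok_div (a b : Exp) : (a / b).ok W R A ↔ a.ok W R A ∧ b.ok W R A := Iff.rfl
@[simp] theorem Exp.ok_xor (a b : Exp) : (Exp.xor a b).ok W R A ↔
    (a.ok W R A ∧ b.ok W R A) ∧ (b.ok W R A ∧ a.ok W R A) ∧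
      (a.eval R A - b.eval R A) + (b.eval R A - a.eval R A) ≤ W := Iff.rfl
@[simp] theorem Exp.ok_not (a : Exp) : (Exp.not a).ok W R A ↔ 1 ≤ W ∧ a.ok W R A := Iff.rfl
@[simp] theorem Exp.ok_le (a b : Exp) : (Exp.le a b).ok W R A ↔
    1 ≤ W ∧ (a.ok W R A ∧ b.ok W R A) := Iff.rfl
@[simp] theorem Exp.ok_eq (a b : Exp) : (Exp.eq a b).ok W R A ↔
    1 ≤ W ∧ ((a.ok W R A ∧ b.ok W R A) ∧ (b.ok W R A ∧ a.ok W R A) ∧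
      (a.eval R A - b.eval R A) + (b.eval R A - a.eval R A) ≤ W) := Iff.rfl
@[simp] theorem Exp.ok_or (a b : Exp) : (Exp.or a b).ok W R A ↔
    1 ≤ W ∧ (1 ≤ W ∧ a.ok W R A) ∧ b.ok W R A := Iff.rfl
end Ok

theorem absdiff_le {a b W : ℕ} (ha : a ≤ W) (hb : b ≤ W) : (a - b) + (b - a) ≤ W := by omega

/-- Truncated subtraction expresses the Boolean connectives on bits. These rules turn evaluated
machine expressions back into operations on `Bool`. -/
theorem bit_xor (a b : Bool) : (a.toNat - b.toNat) + (b.toNat - a.toNat) = (xor a b).toNat := by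
  cases a <;> cases b <;> rfl
theorem bit_not (a : Bool) : 1 - a.toNat = (!a).toNat := by cases a <;> rfl
theorem bit_and (a b : Bool) : a.toNat * b.toNat = (a && b).toNat := by cases a <;> cases b <;> rfl
theorem bit_or (a b : Bool) : 1 - ((1 - a.toNat) - b.toNat) = (a || b).toNat := by
  cases a <;> cases b <;> rfl
theorem bit_le (a b : ℕ) : 1 - (a - b) = (decide (a ≤ b)).toNat := by
  by_cases h : a ≤ b
  · simp [h]
  · simp [h]; omega
theorem bit_eq (a b : ℕ) : 1 - ((a - b) + (b - a)) = (decide (a = b)).toNat := by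
  by_cases h : a = b
  · simp [h]
  · simp [h]; omega

/-- The first entries of the array `a` are the coordinates of `x`. -/
def Holds {n : ℕ} (A : ℕ → ℕ → ℕ) (a : ℕ) (x : Fin n → Bool) : Prop :=
  ∀ j : Fin n, A a j = (x j).toNat

theorem Holds.read {n : ℕ} {A : ℕ → ℕ → ℕ} {a : ℕ} {x : Fin n → Bool} (h : Holds A a x) :
    (fun i : Fin n => decide (A a i ≠ 0)) = x := by
  funext i; rw [h i]; cases x i <;> rfl

theorem Holds.congr {n : ℕ} {A A' : ℕ → ℕ → ℕ} {a : ℕ} {x : Fin n → Bool} (h : Holds A a x)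
    (hA : A' a = A a) : Holds A' a x := fun j => by rw [hA]; exact h j

section Verify
variable {n : ℕ} {f : (Fin n → Bool) → Bool} {D : PMF (Fin n → Bool)} {fuel W : ℕ}
  {R : ℕ → ℕ} {A : ℕ → ℕ → ℕ}

open Tester

theorem Impl.code_query {β : Type*} {Q : β → (ℕ → ℕ) → (ℕ → ℕ → ℕ) → Prop} (hW : 1 ≤ W) {b : β}
    {l : List Stmt} (T q : ℕ)
    (hok : (∀ x, R x ≤ W) → (∀ a j, A a j ≤ W) → oks f W l (R, A))
    (hQ : Q b (runs f l (R, A)).1 (runs f l (R, A)).2)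
    (hc : (l.all (·.wf) && Nat.ble (costs l) T && Nat.ble (qs l) q) = true := by rfl) :
    Impl f D fuel W (T + q * (n + 1)) q (.block l) R A (PMF.pure b) Q := by
  simp only [Bool.and_eq_true] at hc
  have h1 := Nat.le_of_ble_eq_true hc.1.2
  have h2 := Nat.le_of_ble_eq_true hc.2
  exact (Impl.block hW l hc.1.1 hok hQ).mono (add_le_add h1 (Nat.mul_le_mul_right _ h2)) h2
    fun _ _ _ h _ => h

theorem Impl.code {β : Type*} {Q : β → (ℕ → ℕ) → (ℕ → ℕ → ℕ) → Prop} (hW : 1 ≤ W) {b : β}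
    {l : List Stmt} (T : ℕ)
    (hok : (∀ x, R x ≤ W) → (∀ a j, A a j ≤ W) → oks f W l (R, A))
    (hQ : Q b (runs f l (R, A)).1 (runs f l (R, A)).2)
    (hc : (l.all (·.wf) && Nat.ble (costs l) T && Nat.ble (qs l) 0) = true := by rfl) :
    Impl f D fuel W T 0 (.block l) R A (PMF.pure b) Q :=
  (Impl.code_query hW T 0 hok hQ hc).mono (by omega) le_rfl fun _ _ _ h _ => h

theorem Impl.randVec (hW : 1 ≤ W) (hfuel : W < fuel) (a : ℕ) (hn : R 0 = n) :
    Impl f D fuel W (n * 11 + 3) 0 (randVec a) R A (cube n) fun b _ A' => Holds A' a b := by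
  have h := Impl.for_ (f := f) (D := D) hW hfuel (coinStep (n := n))
    (fun i b _ A' => ∀ j : Fin n, j.val < i → A' a j = (b j).toNat) (R := R) (A := A) (T := 7)
    (q := 0) (i := 20) (m := 21) (c := 0)
    (body := .seq (.coin 60) (.block [.put a (.reg 20) (.reg 60)])) (N := n)
    (a₀ := fun _ => false) hn rfl (fun j hj => absurd hj (Nat.not_lt_zero _))
    (fun j b R' A' v w h => h) ?_
  · refine (h.ex_change fun F => (iter_coinStep _ F).le).mono (by omega) (by omega)
      fun b R' A' h' _ j => h' j j.2
  · intro i b R' A' hi hi' hS hI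
    refine (Impl.seq_pure (T := 1) (q := 0) (T' := 6) (q' := 0) (g := fun c => fun j : Fin n =>
        if j.val = i then c else b j)
      (Q := fun c R'' A'' => R'' = Function.update R' 60 c.toNat ∧ A'' = A')
      (Impl.coin hW (by norm_num) fun c => ⟨rfl, rfl⟩) ?_)
    rintro c _ _ ⟨rfl, rfl⟩ hS'
    refine (Impl.code hW 6 ?_ ?_).mono le_rfl le_rfl fun _ _ _ h _ => h
    · intro _ _; simp [oks, Stmt.ok]
    · intro j hj
      simp only [runs, Stmt.runArr, Exp.eval_reg, Function.update_self]
      by_cases hji : j.val = i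
      · simp [hji, hi']
      · simp only [hji, if_false]
        rw [Function.update_of_ne, hI j (by omega)]
        simp [hi', hji]

end Verify
end DTTest

namespace DTTest

open scoped ENNReal

/-! ### Correctness of the random partition and of the binary search -/

section Verify
variable {n : ℕ} {f : (Fin n → Bool) → Bool} {D : PMF (Fin n → Bool)} {fuel W : ℕ}
  {R : ℕ → ℕ} {A : ℕ → ℕ → ℕ}

open Tester

theorem Impl.split (hW : 2 ≤ W) (hfuel : W < fuel) {K : ℕ} (hK : 2 * 2 ^ K ≤ W)
    (hn : R 0 = n) (hRK : R 7 = K) (hA : ∀ j : Fin n, A 0 j = 0) :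
    Impl f D fuel W (K * (40 * (n + 1)) + 3) 0 Tester.split R A
      (iter splitStep 0 K fun _ : Fin n => 0) fun blk _ A' => ∀ j : Fin n, A' 0 j = blk j := by
  have hW1 : 1 ≤ W := by omega
  have h := Impl.for_ (f := f) (D := D) hW1 hfuel (splitStep (n := n))
    -- The bound `2 ^ i` on the block numbers serves only to keep the words below `W`.
    (fun i blk _ A' => ∀ j : Fin n, A' 0 j = blk j ∧ blk j < 2 ^ i) (R := R) (A := A)
    (T := 36 * (n + 1)) (q := 0) (i := 22) (m := 23) (c := 7)
    (body := .seq (Tester.randVec 5) (.for_ 20 21 0 (.block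
      [.put 0 (.reg 20) (.lit 2 * .get 0 (.reg 20) + .get 5 (.reg 20))]))) (N := K)
    (a₀ := fun _ => 0) hRK rfl (fun j => ⟨hA j, by simp⟩) (fun j b R' A' v w h => h) ?_
  · exact h.mono (by have : K * (36 * (n + 1) + 4) ≤ K * (40 * (n + 1)) := by gcongr; omega
                     omega) (by omega) fun b R' A' h' _ j => (h' j).1
  · intro i blk R' A' hi hi' hS hI
    refine (Impl.seq_pure (T := n * 11 + 3) (q := 0) (T' := n * 20 + 3) (q' := n * 0)
      (g := fun (b : Fin n → Bool) j => 2 * blk j + (b j).toNat)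
      (Impl.randVec hW1 hfuel 5 ((hS.1 0 rfl).trans hn)) ?_).mono (by omega) (by omega)
      fun _ _ _ h _ => h
    intro b R₁ A₁ hb hS₁
    have e0 : A₁ 0 = A' 0 := hS₁.2 0 rfl
    have hpow : 2 ^ i * 4 ≤ W := by
      have : 2 ^ (i + 1) ≤ 2 ^ K := Nat.pow_le_pow_right (by norm_num) hi
      rw [pow_succ] at this; omega
    -- The array is updated in place: below `m` it holds the new block numbers, from `m` on the old
    -- ones.
    have h2 := Impl.for_pure (f := f) (D := D) hW1 hfuel (fun m _ A'' => Holds A'' 5 b ∧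
      (∀ j : Fin n, j.val < m → A'' 0 j = 2 * blk j + (b j).toNat) ∧
      (∀ j : Fin n, m ≤ j.val → A'' 0 j = blk j)) (R := R₁) (A := A₁) (T := 16) (q := 0)
      (i := 20) (m := 21) (c := 0) (body := .block
      [.put 0 (.reg 20) (.lit 2 * .get 0 (.reg 20) + .get 5 (.reg 20))]) (N := n)
      (by rw [hS₁.1 0 rfl, hS.1 0 rfl, hn]) rfl ⟨hb, fun j hj => absurd hj (Nat.not_lt_zero _),
        fun j _ => by rw [e0]; exact (hI j).1⟩ (fun j R' A' v w h => h) ?_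
    · refine h2.of_Ex_le fun F => ⟨fun _ => F _, by rw [Ex_pure, Ex_pure], fun _ R₂ A₂ h3 =>
        ⟨_, fun j => ⟨h3.2.1 j j.2, ?_⟩, le_rfl⟩⟩
      have := (hI j).2
      have := Bool.toNat_le (b j)
      rw [pow_succ]; omega
    · rintro j R₂ A₂ hj hj' hS₂ ⟨hh, hlt, hge⟩
      have e1 := hh ⟨j, hj⟩
      have e2 := hge ⟨j, hj⟩ le_rfl
      have e3 := (hI ⟨j, hj⟩).2
      have e4 := Bool.toNat_le (b ⟨j, hj⟩)
      simp only at e1 e2 e3 e4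
      refine Impl.code hW1 16 ?_ ?_
      · intro _ _
        simp [oks, Stmt.ok, hj', e1, e2]
        omega
      · simp only [runs, Stmt.runArr, Exp.eval_reg, Exp.eval_add, Exp.eval_mul, Exp.eval_lit,
          Exp.eval_get, hj']
        refine ⟨fun j' => ?_, fun j' hj'' => ?_, fun j' hj'' => ?_⟩
        · simpa using hh j'
        · by_cases h : j'.val = j
          · have : j' = ⟨j, hj⟩ := Fin.ext h
            subst this; simp [e1, e2]
          · simpa [h] using hlt j' (by omega)
        · have h : j'.val ≠ j := by omega
          simpa [h] using hge j' (by omega)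

theorem Impl.cut (hW : 1 ≤ W) (hfuel : W < fuel) {blk : Fin n → ℕ}
    {L : List (ℕ × (Fin n → Bool))} {x : Fin n → Bool} {c : ℕ} (hn : R 0 = n) (hc : R 44 = c)
    (h0 : ∀ j : Fin n, A 0 j = blk j) (h1 : ∀ b, A 1 b = (decide (b ∈ L.map Prod.fst)).toNat)
    (h4 : Holds A 4 x) :
    Impl f D fuel W (40 * (n + 1)) 0 Tester.cut R A (PMF.pure ()) fun _ _ A' =>
      Holds A' 6 (cutPt blk L c x) := by
  have h2 := Impl.for_pure (f := f) (D := D) hW hfuel (fun m _ A'' =>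
      ∀ j : Fin n, j.val < m → A'' 6 j = (cutPt blk L c x j).toNat) (R := R) (A := A) (T := 36)
      (q := 0) (i := 20) (m := 21) (c := 0) (body := .block [.put 6 (.reg 20) (.get 4 (.reg 20) *
        Exp.or (.get 1 (.get 0 (.reg 20))) (Exp.le (.reg 44) (.get 0 (.reg 20))))]) (N := n)
      hn rfl (fun j hj => absurd hj (Nat.not_lt_zero _)) (fun j R' A' v w h => h) ?_
  · exact h2.mono (by omega) (by omega) fun _ _ _ h _ j => h j j.2
  · intro j R₂ A₂ hj hj' hS hI
    have e4 : A₂ 4 j = (x ⟨j, hj⟩).toNat := by rw [hS.2 4 rfl]; exact h4 ⟨j, hj⟩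
    have e0 : A₂ 0 j = blk ⟨j, hj⟩ := by rw [hS.2 0 rfl]; exact h0 ⟨j, hj⟩
    have e1 : A₂ 1 = A 1 := hS.2 1 rfl
    have e44 : R₂ 44 = c := (hS.1 44 rfl).trans hc
    refine Impl.code hW 36 ?_ ?_
    · intro _ _
      simp only [oks, Stmt.ok, Exp.ok_reg, Exp.ok_mul, Exp.ok_get, Exp.ok_or, Exp.ok_le,
        Exp.eval_get, Exp.eval_reg, Exp.eval_or, Exp.eval_le, hj', e4, e0, e1, e44, h1, bit_le c,
        bit_or, bit_and, hW, true_and, and_true]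
      exact (Bool.toNat_le _).trans hW
    · intro j' hj''
      simp only [runs, Stmt.runArr, Exp.eval_reg, Exp.eval_mul, Exp.eval_or, Exp.eval_le,
        Exp.eval_get, hj', e4, e0, e1, e44, h1, bit_le c, bit_or, bit_and, Function.update_self]
      by_cases h : j'.val = j
      · have : j' = ⟨j, hj⟩ := Fin.ext h
        subst this; simp [cutPt]
      · rw [Function.update_of_ne h]; exact hI j' (by omega)

theorem Impl.search (hW : 2 ≤ W) (hfuel : W < fuel) {blk : Fin n → ℕ}
    {L : List (ℕ × (Fin n → Bool))} {x : Fin n → Bool} {K : ℕ} (hKW : 2 ^ K ≤ W) (hn : R 0 = n)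
    (hK : R 7 = K) (hr : R 8 = 2 ^ K) (hf : R 16 = (f x).toNat)
    (h0 : ∀ j : Fin n, A 0 j = blk j) (h1 : ∀ b, A 1 b = (decide (b ∈ L.map Prod.fst)).toNat)
    (h4 : Holds A 4 x) :
    Impl f D fuel W (K * (100 * (n + 1)) + 20) K Tester.search R A (PMF.pure ()) fun _ R' _ =>
      R' 40 = bsearch f blk L x K 0 ∧ R' 40 < 2 ^ K := by
  have hW1 : 1 ≤ W := by omega
  refine (Impl.pure_seq (T := 10) (q := 0) (T' := K * (96 * (n + 1) + 4) + 3) (q' := K * 1)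
    (b := ()) (Q := fun _ R' A' => R' = Function.update (Function.update R 40 0) 41 (2 ^ K) ∧ A' = A)
    (Impl.code hW1 10 ?_ ?_) ?_).mono ?_ (by omega) fun _ _ _ h _ => h
  · intro _ _; simp [oks, Stmt.ok]
  · simp [runs, Stmt.runReg, Stmt.runArr, hr]
  · rintro _ _ ⟨rfl, rfl⟩ -
    -- After `m` rounds the width is `2 ^ (K - m)`, and what remains is `bsearch` with `K - m`
    -- levels from the current position. Position plus width stays at most `2 ^ K`, so the final
    -- position is a block number.
    refine (Impl.for_pure (f := f) (D := D) hW1 hfuel (fun m R' _ =>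
      R' 41 = 2 ^ (K - m) ∧ bsearch f blk L x K 0 = bsearch f blk L x (K - m) (R' 40) ∧
        R' 40 + R' 41 ≤ 2 ^ K) (N := K) (by simpa using hK) rfl (by simp) ?_ ?_).mono le_rfl le_rfl
          ?_
    · intro j R' A' v w h
      simpa using h
    · rintro m R' A' hm hm' hS ⟨g1, g2, g3⟩
      obtain ⟨k, hk⟩ : ∃ k, K - m = k + 1 := ⟨K - m - 1, by omega⟩
      have hk' : K - (m + 1) = k := by omega
      rw [hk] at g1 g2
      have hhalf : R' 41 / 2 = 2 ^ k := by rw [g1, pow_succ]; omega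
      have hp : (2 : ℕ) ^ (k + 1) = 2 ^ k * 2 := pow_succ _ _
      refine (Impl.pure_seq (T := 14) (q := 0) (T' := 40 * (n + 1) + (24 + 1 * (n + 1)))
        (q' := 0 + 1) (b := ()) (Q := fun _ R'' A'' => R'' = Function.update (Function.update R' 41
          (2 ^ k)) 44 (R' 40 + 2 ^ k) ∧ A'' = A')
        (Impl.code hW1 14 ?_ ?_) ?_).mono (by omega) (by omega) fun _ _ _ h _ => h
      · intro _ _; simp [oks, Stmt.ok, Stmt.runReg, hhalf]; omega
      · simp [runs, Stmt.runReg, Stmt.runArr, hhalf]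
      · rintro _ _ ⟨rfl, rfl⟩ hS1
        refine Impl.pure_seq (b := ()) (Impl.cut hW1 hfuel (blk := blk) (L := L) (x := x)
          (c := R' 40 + 2 ^ k) ?_ ?_ ?_ ?_ ?_) ?_
        · simpa using (hS.1 0 rfl).trans (by simpa using hn)
        · simp
        · intro j; rw [hS.2 0 rfl]; exact h0 j
        · intro b; rw [hS.2 1 rfl]; exact h1 b
        · exact h4.congr (hS.2 4 rfl)
        · intro R₂ A₂ h6 hS2
          have e16 : R₂ 16 = (f x).toNat := by
            rw [hS2.1 16 rfl]; simpa using (hS.1 16 rfl).trans (by simpa using hf)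
          have e40 : R₂ 40 = R' 40 := by rw [hS2.1 40 rfl]; simp
          have e41 : R₂ 41 = 2 ^ k := by rw [hS2.1 41 rfl]; simp
          have h6' := h6.read
          simp only [ne_eq] at h6'
          refine Impl.code_query hW1 24 1 ?_ ?_
          · intro _ _
            have hb : ∀ b : Bool, 2 ^ k * b.toNat ≤ W ∧ R' 40 + 2 ^ k * b.toNat ≤ W := by
              intro b; cases b <;> simp <;> omega
            simp only [oks, Stmt.ok, Stmt.runReg, Stmt.runArr, Exp.ok_add, Exp.ok_mul, Exp.ok_reg,
              Exp.ok_not, Exp.ok_xor, Exp.eval_reg, Exp.eval_xor, Exp.eval_not, Exp.eval_mul,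
              Function.update_self, ne_eq, h6', true_and, and_true, hW1]
            simp [e16, e40, e41, bit_xor, bit_not, hb]
            exact (Bool.toNat_le _).trans hW1
          · rw [hk', g2]
            simp only [runs, Stmt.runReg, Stmt.runArr, Exp.eval_reg, Exp.eval_xor, Exp.eval_not,
              Exp.eval_mul, Exp.eval_add, ne_eq, h6']
            simp only [Function.update_self, ne_eq, Nat.reduceEqDiff, not_false_eq_true,
              Function.update_of_ne, e16, e40, e41, bit_xor, bit_not, bsearch]
            by_cases hd : f (cutPt blk L (R' 40 + 2 ^ k) x) = f x
            · simp [hd]; omega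
            · have : (f (cutPt blk L (R' 40 + 2 ^ k) x) ^^ f x) = true := by
                cases h : f (cutPt blk L (R' 40 + 2 ^ k) x) <;> cases h' : f x <;> simp_all
              simp [hd, this]; omega
    · rintro _ R' A' ⟨g1, g2, g3⟩ -
      simp only [Nat.sub_self, bsearch, pow_zero] at g1 g2
      exact ⟨g2.symm, by omega⟩
  · have : K * (96 * (n + 1) + 4) ≤ K * (100 * (n + 1)) := by gcongr; omega
    omega

end Verify
end DTTest

/-! ### Data layout, and one example in the search for blocks -/

namespace DTTest

open scoped ENNReal

/-- The program parameters and the partition, as stored by the program. -/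
structure Ctx {n : ℕ} (s N K t : ℕ) (blk : Fin n → ℕ) (R : ℕ → ℕ) (A : ℕ → ℕ → ℕ) : Prop where
  rn : R 0 = n
  rs : R 1 = s
  rK : R 7 = K
  rr : R 8 = 2 ^ K
  rt : R 9 = t
  rN : R 10 = N
  blk : ∀ j : Fin n, A 0 j = blk j

/-- Bounds on the words of the program. -/
structure WordBound (n s N K W : ℕ) : Prop where
  r : 2 * 2 ^ K ≤ W
  N : N + 2 ≤ W
  idx : (s + 1) * (n + 1) ≤ W

/-- The blocks found so far, as stored by the program. -/
structure Blocks {n : ℕ} (s : ℕ) (L : List (ℕ × (Fin n → Bool))) (R : ℕ → ℕ) (A : ℕ → ℕ → ℕ) :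
    Prop where
  cnt : R 13 = L.length
  inx : ∀ b, A 1 b = (decide (b ∈ L.map Prod.fst)).toNat
  num : ∀ i < L.length, A 3 i = (L.getD i (0, fun _ => false)).1
  wit : ∀ i < L.length, ∀ j : Fin n, A 2 (i * n + j) =
    ((L.getD i (0, fun _ => false)).2 j).toNat
  le : L.length ≤ s

/-- The current example, as stored by the program. -/
structure Point {n : ℕ} (f : (Fin n → Bool) → Bool) (x : Fin n → Bool) (R : ℕ → ℕ)
    (A : ℕ → ℕ → ℕ) : Prop where
  lab : R 16 = (f x).toNat
  pt : Holds A 4 x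

section Transfer
variable {n : ℕ} {s N K t : ℕ} {blk : Fin n → ℕ} {R R' : ℕ → ℕ} {A A' : ℕ → ℕ → ℕ} {c : Cmd}

/-- A frame rule: whether a command leaves the relevant registers and arrays alone is decided by
evaluating `wr` and `wa`, which is why the side condition is left to `rfl`. -/
theorem Ctx.same (h : Ctx s N K t blk R A) (hS : Same c R A R' A')
    (hc : (!(c.wr 0 || c.wr 1 || c.wr 7 || c.wr 8 || c.wr 9 || c.wr 10 || c.wa 0)) = true := by rfl) :
    Ctx s N K t blk R' A' := by
  simp only [Bool.not_eq_true', Bool.or_eq_false_iff, and_assoc] at hc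
  obtain ⟨c0, c1, c7, c8, c9, c10, a0⟩ := hc
  exact ⟨by rw [hS.1 0 c0, h.rn], by rw [hS.1 1 c1, h.rs], by rw [hS.1 7 c7, h.rK],
    by rw [hS.1 8 c8, h.rr], by rw [hS.1 9 c9, h.rt], by rw [hS.1 10 c10, h.rN],
    by rw [hS.2 0 a0]; exact h.blk⟩

theorem Blocks.same {L : List (ℕ × (Fin n → Bool))} (h : Blocks s L R A) (hS : Same c R A R' A')
    (hc : (!(c.wr 13 || c.wa 1 || c.wa 2 || c.wa 3)) = true := by rfl) :
    Blocks s L R' A' := by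
  simp only [Bool.not_eq_true', Bool.or_eq_false_iff, and_assoc] at hc
  obtain ⟨c13, a1, a2, a3⟩ := hc
  exact ⟨by rw [hS.1 13 c13, h.cnt], by rw [hS.2 1 a1]; exact h.inx,
    by rw [hS.2 3 a3]; exact h.num, by rw [hS.2 2 a2]; exact h.wit, h.le⟩

theorem Point.same {f : (Fin n → Bool) → Bool} {x : Fin n → Bool} (h : Point f x R A)
    (hS : Same c R A R' A') (hc : (!(c.wr 16 || c.wa 4)) = true := by rfl) : Point f x R' A' := by
  simp only [Bool.not_eq_true', Bool.or_eq_false_iff] at hc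
  exact ⟨by rw [hS.1 16 hc.1, h.lab], h.pt.congr (hS.2 4 hc.2)⟩

end Transfer

section Verify
variable {n : ℕ} {f : (Fin n → Bool) → Bool} {D : PMF (Fin n → Bool)} {fuel W : ℕ}
  {R : ℕ → ℕ} {A : ℕ → ℕ → ℕ}

open Tester

theorem idx_lt {n s i : ℕ} (j : Fin n) (hi : i < s) : i * n + j < s * n := by
  have := j.2
  have : (i + 1) * n ≤ s * n := Nat.mul_le_mul_right _ hi
  rw [add_mul] at this; omega

theorem Impl.sample_point (hW : 1 ≤ W) :
    Impl f D fuel W (n + 1) 1 (.sample 4 16) R A D fun x R' A' => Point f x R' A' := by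
  refine Impl.sample hW (by norm_num) fun u => ⟨by simp, fun j => ?_⟩
  simp

/-- The extra block entered by the copy loop. -/
theorem Impl.copy {s N K t : ℕ} {blk : Fin n → ℕ} {L : List (ℕ × (Fin n → Bool))}
    {w : Fin n → Bool} (hW : 1 ≤ W) (hfuel : W < fuel) (hB : WordBound n s N K W)
    (h : Ctx s N K t blk R A) (hL : Blocks s L R A) (hw : Holds A 6 w) :
    Impl f D fuel W (24 * (n + 1)) 0
      (.for_ 20 21 0 (.block [.put 2 (.reg 13 * .reg 0 + .reg 20) (.get 6 (.reg 20))])) R A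
      (PMF.pure ()) fun _ R' A' => Blocks s L R' A' ∧
        ∀ j : Fin n, A' 2 (L.length * n + j) = (w j).toNat := by
  refine (Impl.for_pure hW hfuel (T := 16) (q := 0) (fun m _ A'' =>
    (∀ i < L.length, ∀ j : Fin n, A'' 2 (i * n + j) =
      ((L.getD i (0, fun _ => false)).2 j).toNat) ∧
    ∀ j : Fin n, j.val < m → A'' 2 (L.length * n + j) = (w j).toNat) (N := n) h.rn rfl
    ⟨hL.wit, fun j hj => absurd hj (Nat.not_lt_zero _)⟩ (fun j R' A' v w h => h) ?_).mono
      (by omega) (by omega) ?_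
  · rintro j R₂ A₂ hj hj' hS ⟨g1, g2⟩
    have e6 : A₂ 6 j = (w ⟨j, hj⟩).toNat := by rw [hS.2 6 rfl]; exact hw ⟨j, hj⟩
    have e13 : R₂ 13 = L.length := by rw [hS.1 13 rfl]; exact hL.cnt
    have e0 : R₂ 0 = n := by rw [hS.1 0 rfl]; exact h.rn
    -- The copy takes place even when no block is to be added, so the row written may be row `s`;
    -- `WordBound.idx` leaves room for it.
    have hidx : L.length * n + n ≤ W := by
      refine le_trans ?_ hB.idx
      have := Nat.mul_le_mul_right n hL.le
      nlinarith
    refine Impl.code hW 16 ?_ ?_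
    · intro _ _
      simp [oks, Stmt.ok, hj', e13, e0]
      omega
    · simp only [runs, Stmt.runArr, Exp.eval_reg, Exp.eval_add, Exp.eval_mul, Exp.eval_get, hj',
        e13, e0, e6, Function.update_self]
      refine ⟨fun i hi j' => ?_, fun j' hj'' => ?_⟩
      · have := idx_lt j' hi
        rw [Function.update_of_ne (by omega)]
        exact g1 i hi j'
      · by_cases hjj : j'.val = j
        · have : j' = ⟨j, hj⟩ := Fin.ext hjj
          subst this; simp
        · rw [Function.update_of_ne (by omega)]
          exact g2 j' (by omega)
  · rintro _ R' A' ⟨g1, g2⟩ hS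
    exact ⟨⟨by rw [hS.1 13 rfl, hL.cnt], by rw [hS.2 1 rfl]; exact hL.inx,
      by rw [hS.2 3 rfl]; exact hL.num, g1, hL.le⟩, fun j => g2 j j.2⟩

/-- The state of the search for blocks, as stored by the program. -/
def Growing (s N : ℕ) (a : List (ℕ × (Fin n → Bool)) × ℕ) (R : ℕ → ℕ) (A : ℕ → ℕ → ℕ) : Prop :=
  Blocks s a.1 R A ∧ R 14 = a.2 ∧ a.2 ≤ N

/-- Separates the bookkeeping from the code. The bit `act` says that the search is still active,
`dif` that a new block was found. If `dif` is false, the extra row lies beyond the count and the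
marker of the block is only or-ed with `0`, so the list stays the same whatever the binary search
returned. -/
theorem Growing.step {s N K : ℕ} {blk : Fin n → ℕ} {L : List (ℕ × (Fin n → Bool))} {run : ℕ}
    {x : Fin n → Bool} {R' : ℕ → ℕ} {A' : ℕ → ℕ → ℕ} {act dif : Bool} (hb : Blocks s L R A)
    (hrun : run ≤ N) (hact : act = (decide (run + 1 ≤ N) && decide (L.length + 1 ≤ s)))
    (hdif : dif = (act && xor (f (cutPt blk L (2 ^ K) x)) (f x)))
    (hnew : ∀ j : Fin n, A 2 (L.length * n + j) =
      (cutPt blk L (bsearch f blk L x K 0) x j).toNat)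
    (h13 : R' 13 = L.length + dif.toNat)
    (h14 : R' 14 = (run + act.toNat) * (!dif).toNat)
    (h1 : ∀ b, A' 1 b = if b = bsearch f blk L x K 0 then
      (decide (bsearch f blk L x K 0 ∈ L.map Prod.fst) || dif).toNat else A 1 b)
    (h2 : A' 2 = A 2)
    (h3 : ∀ b, A' 3 b = if b = L.length then bsearch f blk L x K 0 else A 3 b) :
    Growing s N (DTTest.grow f s N K blk (L, run) x) R' A' := by
  have hkeep : dif = false → Blocks s L R' A' := by
    rintro rfl
    refine ⟨by simpa using h13, fun b => ?_, fun i hi => ?_, by rw [h2]; exact hb.wit, hb.le⟩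
    · rw [h1]
      split_ifs with h
      · rw [h]; simp
      · exact hb.inx b
    · rw [h3, if_neg hi.ne]; exact hb.num i hi
  have hdis : f (cutPt blk L (2 ^ K) x) ≠ f x ↔ xor (f (cutPt blk L (2 ^ K) x)) (f x) = true := by
    cases f (cutPt blk L (2 ^ K) x) <;> cases f x <;> simp
  unfold Growing grow
  dsimp only
  by_cases hA : run < N ∧ L.length < s
  · obtain rfl : act = true := by rw [hact]; simp; omega
    rw [if_pos hA]
    by_cases hd : f (cutPt blk L (2 ^ K) x) ≠ f x
    · obtain rfl : dif = true := by rw [hdif, hdis.1 hd]; rfl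
      rw [if_pos hd]
      refine ⟨⟨by simpa using h13, fun b => ?_, fun i hi => ?_, fun i hi j => ?_, ?_⟩,
        by simpa using h14, Nat.zero_le _⟩
      · rw [h1]
        split_ifs with h
        · rw [h]; simp
        · rw [hb.inx]; simp [h]
      · simp only [List.length_append, List.length_cons, List.length_nil] at hi
        rw [h3]
        split_ifs with h
        · subst h; simp
        · have hi' : i < L.length := by omega
          rw [List.getD_append _ _ _ _ hi']
          exact hb.num i hi'
      · simp only [List.length_append, List.length_cons, List.length_nil] at hi
        rw [h2]
        by_cases h : i = L.length
        · subst h; simpa using hnew j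
        · have hi' : i < L.length := by omega
          rw [List.getD_append _ _ _ _ hi']
          exact hb.wit i hi' j
      · simp; omega
    · obtain rfl : dif = false := by
        rw [hdis] at hd
        rw [hdif]; simpa using hd
      rw [if_neg hd]
      exact ⟨hkeep rfl, by simpa using h14, hA.1⟩
  · obtain rfl : act = false := by
      rw [hact]
      simp only [Bool.and_eq_false_iff, decide_eq_false_iff_not]; omega
    obtain rfl : dif = false := by rw [hdif]; rfl
    rw [if_neg hA]
    exact ⟨hkeep rfl, by simpa using h14, hrun⟩

theorem Impl.growCmd {s N K t : ℕ} {blk : Fin n → ℕ} {a : List (ℕ × (Fin n → Bool)) × ℕ}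
    (hW : 2 ≤ W) (hfuel : W < fuel) (hB : WordBound n s N K W)
    (h : Ctx s N K t blk R A) (ha : Growing s N a R A) :
    Impl f D fuel W ((K + 4) * (100 * (n + 1))) (K + 2) Tester.growCmd R A
      (D.bind fun x => PMF.pure (DTTest.grow f s N K blk a x)) fun a' R' A' =>
        Growing s N a' R' A' := by
  have hW1 : 1 ≤ W := by omega
  have hN := hB.N
  have hs : s + 1 ≤ W := le_trans (by nlinarith) hB.idx
  have hr := hB.r
  obtain ⟨L, run⟩ := a
  have hrun : run ≤ N := ha.2.2
  have ha1 : Blocks s L R A := ha.1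
  refine (Impl.seq_pure (g := fun x => DTTest.grow f s N K blk (L, run) x) (Impl.sample_point hW1)
    (T' := 8 + (40 * (n + 1) + ((40 + 1 * (n + 1)) + ((K * (100 * (n + 1)) + 20) +
      (8 + (40 * (n + 1) + (24 * (n + 1) + 40)))))))
    (q' := 0 + (0 + (1 + (K + (0 + (0 + (0 + 0)))))))
    fun x R₁ A₁ hx hS₁ => ?_).mono (by nlinarith) (by omega) fun _ _ _ h _ => h
  replace h := h.same hS₁
  have hb := ha1.same hS₁
  have h14 : R₁ 14 = run := by rw [hS₁.1 14 rfl]; exact ha.2.1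
  clear hS₁
  refine Impl.pure_seq (b := ()) (Q := fun _ R' A' => R' 44 = 2 ^ K) (Impl.code hW1 8 ?_ ?_) ?_
  · intro _ _; simp [oks, Stmt.ok]
  · simp [runs, Stmt.runReg, h.rr]
  intro R₂ A₂ h44 hS
  replace h := h.same hS
  replace hb := hb.same hS
  replace hx := hx.same hS
  rw [← hS.1 14 rfl] at h14
  clear hS
  refine Impl.pure_seq (b := ()) (Impl.cut hW1 hfuel h.rn h44 h.blk hb.inx hx.pt) ?_
  intro R₃ A₃ h6 hS
  replace h := h.same hS
  replace hb := hb.same hS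
  replace hx := hx.same hS
  rw [← hS.1 14 rfl] at h14
  clear hS h44
  have h6' := h6.read
  simp only [ne_eq] at h6'
  -- These bits replace the two nested tests of `grow`; a strict inequality is coded as `≤` after
  -- adding `1`.
  set act : Bool := decide (run + 1 ≤ N) && decide (L.length + 1 ≤ s) with hact
  set dif : Bool := act && xor (f (cutPt blk L (2 ^ K) x)) (f x) with hdif
  refine Impl.pure_seq (b := ()) (Q := fun _ R' A' => R' 46 = act.toNat ∧ R' 43 = dif.toNat)
    (Impl.code_query hW1 40 1 ?_ ?_) ?_
  · intro hR _
    simp only [oks, Stmt.ok, Stmt.runReg, Stmt.runArr, Exp.ok_add, Exp.ok_mul, Exp.ok_reg,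
      Exp.ok_le, Exp.ok_xor, Exp.ok_lit, Exp.eval_reg, Exp.eval_xor, Exp.eval_le, Exp.eval_mul,
      Exp.eval_add, Exp.eval_lit, Function.update_self, ne_eq, h6', true_and, and_true, hW1]
    simp only [Function.update_self, ne_eq, Nat.reduceEqDiff, not_false_eq_true,
      Function.update_of_ne, h14, h.rN, h.rs, hb.cnt, hx.lab, bit_xor, bit_le, bit_and]
    have hl := hb.le
    refine ⟨⟨by omega, by omega, ?_⟩, ?_, ?_⟩ <;>
      exact (Bool.toNat_le _).trans hW1
  · simp only [runs, Stmt.runReg, Stmt.runArr, Exp.eval_reg, Exp.eval_xor, Exp.eval_le,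
      Exp.eval_mul, Exp.eval_add, Exp.eval_lit, Function.update_self, ne_eq, h6', true_and]
    simp only [Function.update_self, ne_eq, Nat.reduceEqDiff, not_false_eq_true,
      Function.update_of_ne, h14, h.rN, h.rs, hb.cnt, hx.lab, bit_xor, bit_le, bit_and]
    exact ⟨rfl, rfl⟩
  rintro R₄ A₄ ⟨h46, h43⟩ hS
  replace h := h.same hS
  replace hb := hb.same hS
  replace hx := hx.same hS
  rw [← hS.1 14 rfl] at h14
  clear hS h6 h6'
  refine Impl.pure_seq (b := ()) (Impl.search hW hfuel (by omega) h.rn h.rK h.rr hx.lab h.blk hb.inx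
    hx.pt) ?_
  rintro R₅ A₅ ⟨h40, hlo⟩ hS
  replace h := h.same hS
  replace hb := hb.same hS
  replace hx := hx.same hS
  rw [← hS.1 14 rfl] at h14
  rw [← hS.1 46 rfl] at h46
  rw [← hS.1 43 rfl] at h43
  clear hS
  refine Impl.pure_seq (b := ()) (Q := fun _ R' A' => R' 44 = bsearch f blk L x K 0) (Impl.code hW1 8 ?_ ?_) ?_
  · intro _ _; simp [oks, Stmt.ok]
  · simp [runs, Stmt.runReg, h40]
  intro R₆ A₆ h44 hS
  replace h := h.same hS
  replace hb := hb.same hS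
  replace hx := hx.same hS
  rw [← hS.1 14 rfl] at h14
  rw [← hS.1 46 rfl] at h46
  rw [← hS.1 43 rfl] at h43
  rw [← hS.1 40 rfl] at h40 hlo
  clear hS
  refine Impl.pure_seq (b := ()) (Impl.cut hW1 hfuel h.rn h44 h.blk hb.inx hx.pt) ?_
  intro R₇ A₇ h6 hS
  replace h := h.same hS
  replace hb := hb.same hS
  replace hx := hx.same hS
  rw [← hS.1 14 rfl] at h14
  rw [← hS.1 46 rfl] at h46
  rw [← hS.1 43 rfl] at h43
  rw [← hS.1 40 rfl] at h40 hlo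
  clear hS h44
  refine Impl.pure_seq (b := ()) (Impl.copy hW1 hfuel hB h hb h6) ?_
  rintro R₈ A₈ ⟨hb, hnew⟩ hS
  replace h := h.same hS
  replace hx := hx.same hS
  rw [← hS.1 14 rfl] at h14
  rw [← hS.1 46 rfl] at h46
  rw [← hS.1 43 rfl] at h43
  rw [← hS.1 40 rfl] at h40 hlo
  clear hS h6
  refine Impl.code hW1 40 ?_ ?_
  · intro hR hA
    simp only [oks, Stmt.ok, Stmt.runReg, Stmt.runArr, Exp.ok_add, Exp.ok_mul, Exp.ok_reg,
      Exp.ok_or, Exp.ok_not, Exp.ok_get, Exp.eval_reg, Exp.eval_not, Exp.eval_or, Exp.eval_mul,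
      Exp.eval_add, Exp.eval_get, true_and, and_true, hW1]
    simp only [Function.update_self, ne_eq, Nat.reduceEqDiff, not_false_eq_true,
      Function.update_of_ne, h14, hb.cnt, h40, h43, h46]
    have e1 := Bool.toNat_le dif
    have e2 := Bool.toNat_le act
    have e3 := hb.le
    refine ⟨by omega, by omega, ?_⟩
    refine le_trans (Nat.mul_le_mul_left _ (Nat.sub_le 1 _)) ?_
    omega
  · refine Growing.step (f := f) hb hrun hact hdif hnew ?_ ?_ ?_ ?_ ?_
    · simp [runs, Stmt.runReg, Stmt.runArr, hb.cnt, h43]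
    · simp [runs, Stmt.runReg, Stmt.runArr, h14, h43, h46, bit_not]
    · intro b
      simp only [runs, Stmt.runReg, Stmt.runArr, Exp.eval_reg, Exp.eval_or, Exp.eval_get,
        Function.update_self, h40, h43,
        Function.update_of_ne (show (1 : ℕ) ≠ 3 by decide), hb.inx, bit_or, Function.update_apply]
    · simp [runs, Stmt.runReg, Stmt.runArr, Function.update]
    · intro b
      simp only [runs, Stmt.runReg, Stmt.runArr, Exp.eval_reg, Function.update_self, h40, hb.cnt,
        Function.update_of_ne (show (3 : ℕ) ≠ 1 by decide), Function.update_apply]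

end Verify
end DTTest

namespace DTTest

open scoped ENNReal

/-! ### Estimates, rounds of tests, and the reading of literals -/

section Verify
variable {n : ℕ} {f : (Fin n → Bool) → Bool} {D : PMF (Fin n → Bool)} {fuel W : ℕ}
  {R : ℕ → ℕ} {A : ℕ → ℕ → ℕ} {s N K t : ℕ} {blk : Fin n → ℕ} {L : List (ℕ × (Fin n → Bool))}

open Tester

/-- The arrays `5`, `6`, `7` hold the random point and the two query points, so the argument must be
stored elsewhere. -/
theorem Impl.estCmd {z out i : ℕ} {x : Fin n → Bool} (hW : 2 ≤ W) (hfuel : W < fuel)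
    (hB : WordBound n s N K W) (h : Ctx s N K t blk R A) (hL : Blocks s L R A)
    (h26 : R 26 = i) (hi : i < L.length) (hx : Holds A z x)
    (hz : (!decide (z = 5) && !decide (z = 6) && !decide (z = 7) && decide (out < 100)) = true) :
    Impl f D fuel W (140 * (n + 1)) 2 (estCmd z out) R A
      (est f blk (L.getD i (0, fun _ => false)) x) fun e R' _ => R' out = e.toNat := by
  simp only [Bool.and_eq_true, Bool.not_eq_true', decide_eq_false_iff_not, decide_eq_true_eq,
    and_assoc] at hz
  obtain ⟨z5, z6, z7, hout⟩ := hz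
  have hW1 : 1 ≤ W := by omega
  set β := (L.getD i (0, fun _ => false)).1 with hβ
  set w := (L.getD i (0, fun _ => false)).2 with hw
  refine (Impl.seq_pure (T := n * 11 + 3) (q := 0) (T' := (n * 84 + 3) + (30 + 2 * (n + 1)))
    (q' := n * 0 + 2) (g := fun b => xor (f (blend blk β w b))
      (f (blend blk β w fun j => xor (b j) (x j))))
    (Impl.randVec hW1 hfuel 5 h.rn) ?_).mono (by omega) (by omega) fun _ _ _ h _ => h
  intro b R₁ A₁ hb hS
  have hwa : ∀ y, y ≠ 5 → (Tester.randVec 5).wa y = false := by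
    intro y hy; simp [Tester.randVec, Cmd.wa, Stmt.wa, hy]
  replace h := h.same hS
  replace hL := hL.same hS
  rw [← hS.1 26 rfl] at h26
  have hx : Holds A₁ z x := hx.congr (hS.2 z (hwa z z5))
  clear hS
  refine Impl.pure_seq (b := ()) (Q := fun _ R' A' => Holds A' 6 (blend blk β w b) ∧
    Holds A' 7 (blend blk β w fun j => xor (b j) (x j))) ((Impl.for_pure hW1 hfuel (T := 80)
    (q := 0) (fun m _ A'' =>
      (∀ j : Fin n, j.val < m → A'' 6 j = (blend blk β w b j).toNat) ∧
      (∀ j : Fin n, j.val < m → A'' 7 j = (blend blk β w (fun j => xor (b j) (x j)) j).toNat))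
    (N := n) h.rn rfl ⟨fun j hj => absurd hj (Nat.not_lt_zero _),
      fun j hj => absurd hj (Nat.not_lt_zero _)⟩ (fun j R' A' v w h => h) ?_).mono le_rfl le_rfl
      (fun _ _ _ h _ => ⟨fun j => h.1 j j.2, fun j => h.2 j j.2⟩)) ?_
  · rintro j R₂ A₂ hj hj' hS ⟨g1, g2⟩
    have hwa' : ∀ y, y ≠ 6 → y ≠ 7 → A₂ y = A₁ y := fun y hy hy' =>
      hS.2 y (by simp [Cmd.wa, Stmt.wa, hy, hy'])
    have e0 : A₂ 0 j = blk ⟨j, hj⟩ := by rw [hS.2 0 rfl]; exact h.blk ⟨j, hj⟩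
    have e3 : A₂ 3 i = β := by rw [hS.2 3 rfl]; exact hL.num i hi
    have e2 : A₂ 2 (i * n + j) = (w ⟨j, hj⟩).toNat := by
      rw [hS.2 2 rfl]; exact hL.wit i hi ⟨j, hj⟩
    have e5 : A₂ 5 j = (b ⟨j, hj⟩).toNat := by rw [hS.2 5 rfl]; exact hb ⟨j, hj⟩
    have ez : A₂ z j = (x ⟨j, hj⟩).toNat := by rw [hwa' z z6 z7]; exact hx ⟨j, hj⟩
    have e26 : R₂ 26 = i := by rw [hS.1 26 rfl]; exact h26
    have e0' : R₂ 0 = n := by rw [hS.1 0 rfl]; exact h.rn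
    have hidx : i * n + j ≤ W := by
      have := idx_lt (⟨j, hj⟩ : Fin n) (hi.trans_le hL.le)
      have h2 := hB.idx
      simp only at this
      nlinarith
    refine Impl.code hW1 80 ?_ ?_
    · intro hR hA
      have := Bool.toNat_le (x ⟨j, hj⟩)
      have := Bool.toNat_le (b ⟨j, hj⟩)
      have := Bool.toNat_le (w ⟨j, hj⟩)
      simp only [oks, Stmt.ok, Stmt.runReg, Stmt.runArr, Exp.ok_add, Exp.ok_mul, Exp.ok_reg,
        Exp.ok_eq, Exp.ok_not, Exp.ok_get, Exp.ok_xor, Exp.eval_reg, Exp.eval_not, Exp.eval_eq,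
        Exp.eval_mul, Exp.eval_xor,
        Exp.eval_add, Exp.eval_get, true_and, and_true, hW1, Function.update_self, ne_eq,
        Nat.reduceEqDiff, not_false_eq_true, Function.update_of_ne, hj', e26, e0', e0, e2, e3, e5,
        z6, ez, bit_xor, bit_not, bit_and, bit_eq, (show (5 : ℕ) ≠ 6 by decide)]
      have q1 : ∀ a b : Bool, a.toNat + b.toNat ≤ W := fun a b => by
        cases a <;> cases b <;> simp <;> omega
      have q2 : ∀ a : Bool, a.toNat ≤ W := fun a => (Bool.toNat_le _).trans hW1
      refine ⟨absdiff_le (e0 ▸ hA 0 j) (e3 ▸ hA 3 i), ⟨⟨?_, hidx⟩, q2 _⟩, ⟨q2 _, q1 _ _⟩, ⟨q2 _, q2 _⟩, q1 _ _⟩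
      omega
    · simp only [runs, Stmt.runReg, Stmt.runArr, Exp.eval_reg, Exp.eval_not, Exp.eval_eq,
        Exp.eval_mul, Exp.eval_xor,
        Exp.eval_add, Exp.eval_get, Function.update_self, ne_eq,
        Nat.reduceEqDiff, not_false_eq_true, Function.update_of_ne, hj', e26, e0', e0, e2, e3, e5,
        z6, ez, bit_xor, bit_not, bit_and, bit_eq, (show (5 : ℕ) ≠ 6 by decide),
        (show (6 : ℕ) ≠ 7 by decide), (show (7 : ℕ) ≠ 6 by decide)]
      constructor <;> intro j' hj''
      · by_cases hjj : j'.val = j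
        · have : j' = ⟨j, hj⟩ := Fin.ext hjj
          subst this
          simp only [Function.update_self, blend]
          split_ifs with hb <;> simp [hb]
        · rw [Function.update_of_ne hjj]; exact g1 j' (by omega)
      · by_cases hjj : j'.val = j
        · have : j' = ⟨j, hj⟩ := Fin.ext hjj
          subst this
          simp only [Function.update_self, blend]
          split_ifs with hb <;> simp [hb]
        · rw [Function.update_of_ne hjj]; exact g2 j' (by omega)
  · rintro R₂ A₂ ⟨h6, h7⟩ hS
    have h6' := h6.read
    have h7' := h7.read
    simp only [ne_eq] at h6' h7'
    refine Impl.code_query hW1 30 2 ?_ ?_ ?_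
    · intro _ _
      simp only [oks, Stmt.ok, Stmt.runReg, Stmt.runArr, Exp.ok_reg, Exp.ok_xor, Exp.eval_reg,
        Function.update_self, ne_eq, Nat.reduceEqDiff, not_false_eq_true, Function.update_of_ne,
        h6', h7', true_and, and_true, bit_xor]
      exact (Bool.toNat_le _).trans hW1
    · simp only [runs, Stmt.runReg, Stmt.runArr, Exp.eval_reg, Exp.eval_xor,
        Function.update_self, ne_eq, Nat.reduceEqDiff, not_false_eq_true, Function.update_of_ne,
        h6', bit_xor]
      exact congrArg (fun z => (xor (f (blend blk β w b)) (f z)).toNat) h7.read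
    · simp only [List.all_cons, List.all_nil, Stmt.wf, decide_eq_true hout, Bool.true_and,
        Bool.and_true]
      rfl

/-- A round consists of six estimates with fresh randomness, each with two queries; the rest only
transports stored values past the intermediate commands. -/
theorem Impl.roundCmd {i : ℕ} {x : Fin n → Bool} {y g : Bool} (m : ℕ) (hW : 2 ≤ W) (hfuel : W < fuel)
    (hB : WordBound n s N K W) (h : Ctx s N K t blk R A) (hL : Blocks s L R A)
    (h26 : R 26 = i) (hi : i < L.length) (hx : Holds A 4 x) (h45 : R 45 = y.toNat)
    (h15 : R 15 = g.toNat) :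
    Impl f D fuel W (1100 * (n + 1)) 12 Tester.roundCmd R A
      (round f blk (L.getD i (0, fun _ => false)) x y m g) fun g' R' _ => R' 15 = g'.toNat := by
  have hW1 : 1 ≤ W := by omega
  refine (Impl.seq (Impl.estCmd hW hfuel hB h hL h26 hi hx rfl)
    (T' := (n * 11 + 3) + ((n * 11 + 3) + ((n * 24 + 3) + (140 * (n + 1) + (140 * (n + 1) +
      (140 * (n + 1) + (140 * (n + 1) + (140 * (n + 1) + 70))))))))
    (q' := 0 + (0 + (n * 0 + (2 + (2 + (2 + (2 + (2 + 0))))))))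
    fun e R₁ A₁ h47 hS => ?_).mono (by omega) (by omega) fun _ _ _ h _ => h
  replace h := h.same hS
  replace hL := hL.same hS
  replace hx := hx.congr (hS.2 4 rfl)
  rw [← hS.1 26 rfl] at h26
  rw [← hS.1 45 rfl] at h45
  rw [← hS.1 15 rfl] at h15
  clear hS
  refine Impl.seq (Impl.randVec hW1 hfuel 8 h.rn) fun u R₂ A₂ h8 hS => ?_
  replace h := h.same hS
  replace hL := hL.same hS
  rw [← hS.1 26 rfl] at h26
  rw [← hS.1 45 rfl] at h45
  rw [← hS.1 15 rfl] at h15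
  rw [← hS.1 47 rfl] at h47
  clear hS
  refine Impl.seq (Impl.randVec hW1 hfuel 9 h.rn) fun v R₃ A₃ h9 hS => ?_
  replace h := h.same hS
  replace hL := hL.same hS
  replace h8 := h8.congr (hS.2 8 rfl)
  rw [← hS.1 26 rfl] at h26
  rw [← hS.1 45 rfl] at h45
  rw [← hS.1 15 rfl] at h15
  rw [← hS.1 47 rfl] at h47
  clear hS
  refine Impl.pure_seq (b := ()) (Q := fun _ R' A' => Holds A' 10 (fun j => u j && v j) ∧
    Holds A' 11 (fun _ : Fin n => true)) ((Impl.for_pure hW1 hfuel (T := 20)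
    (q := 0) (fun m _ A'' =>
      (∀ j : Fin n, j.val < m → A'' 10 j = (u j && v j).toNat) ∧
      (∀ j : Fin n, j.val < m → A'' 11 j = true.toNat))
    (N := n) h.rn rfl ⟨fun j hj => absurd hj (Nat.not_lt_zero _),
      fun j hj => absurd hj (Nat.not_lt_zero _)⟩ (fun j R' A' v w h => h) ?_).mono le_rfl le_rfl
      (fun _ _ _ h _ => ⟨fun j => h.1 j j.2, fun j => h.2 j j.2⟩)) ?_
  · rintro j R₂ A₂ hj hj' hS ⟨g1, g2⟩
    have e8 : A₂ 8 j = (u ⟨j, hj⟩).toNat := by rw [hS.2 8 rfl]; exact h8 ⟨j, hj⟩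
    have e9 : A₂ 9 j = (v ⟨j, hj⟩).toNat := by rw [hS.2 9 rfl]; exact h9 ⟨j, hj⟩
    refine Impl.code hW1 20 ?_ ?_
    · intro _ _
      simp only [oks, Stmt.ok, Exp.ok_mul, Exp.ok_get, Exp.ok_reg, Exp.ok_lit, Exp.eval_get,
        Exp.eval_reg, hj', e8, e9, bit_and, true_and, and_true, hW1]
      exact (Bool.toNat_le _).trans hW1
    · simp only [runs, Stmt.runReg, Stmt.runArr, Exp.eval_reg, Exp.eval_mul, Exp.eval_lit,
        Exp.eval_get, hj', e8, e9, bit_and, Function.update_self,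
        Function.update_of_ne (show (10 : ℕ) ≠ 11 by decide),
        Function.update_of_ne (show (11 : ℕ) ≠ 10 by decide)]
      constructor <;> intro j' hj''
      · by_cases hjj : j'.val = j
        · have : j' = ⟨j, hj⟩ := Fin.ext hjj
          subst this; simp
        · rw [Function.update_of_ne hjj]; exact g1 j' (by omega)
      · by_cases hjj : j'.val = j
        · have : j' = ⟨j, hj⟩ := Fin.ext hjj
          subst this; simp
        · rw [Function.update_of_ne hjj]; exact g2 j' (by omega)
  rintro R₄ A₄ ⟨h10, h11⟩ hS
  replace h := h.same hS
  replace hL := hL.same hS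
  replace h8 := h8.congr (hS.2 8 rfl)
  replace h9 := h9.congr (hS.2 9 rfl)
  rw [← hS.1 26 rfl] at h26
  rw [← hS.1 45 rfl] at h45
  rw [← hS.1 15 rfl] at h15
  rw [← hS.1 47 rfl] at h47
  clear hS
  refine Impl.seq (Impl.estCmd hW hfuel hB h hL h26 hi h11 rfl) fun o R₅ A₅ h48 hS => ?_
  replace h := h.same hS
  replace hL := hL.same hS
  replace h8 := h8.congr (hS.2 8 rfl)
  replace h9 := h9.congr (hS.2 9 rfl)
  replace h10 := h10.congr (hS.2 10 rfl)
  rw [← hS.1 26 rfl] at h26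
  rw [← hS.1 45 rfl] at h45
  rw [← hS.1 15 rfl] at h15
  rw [← hS.1 47 rfl] at h47
  clear hS
  refine Impl.seq (Impl.estCmd hW hfuel hB h hL h26 hi h8 rfl) fun e₁ R₆ A₆ h49 hS => ?_
  replace h := h.same hS
  replace hL := hL.same hS
  replace h8 := h8.congr (hS.2 8 rfl)
  replace h9 := h9.congr (hS.2 9 rfl)
  replace h10 := h10.congr (hS.2 10 rfl)
  rw [← hS.1 26 rfl] at h26
  rw [← hS.1 45 rfl] at h45
  rw [← hS.1 15 rfl] at h15
  rw [← hS.1 47 rfl] at h47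
  rw [← hS.1 48 rfl] at h48
  clear hS
  refine Impl.seq (Impl.estCmd hW hfuel hB h hL h26 hi h8 rfl) fun e₂ R₇ A₇ h50 hS => ?_
  replace h := h.same hS
  replace hL := hL.same hS
  replace h9 := h9.congr (hS.2 9 rfl)
  replace h10 := h10.congr (hS.2 10 rfl)
  rw [← hS.1 26 rfl] at h26
  rw [← hS.1 45 rfl] at h45
  rw [← hS.1 15 rfl] at h15
  rw [← hS.1 47 rfl] at h47
  rw [← hS.1 48 rfl] at h48
  rw [← hS.1 49 rfl] at h49
  clear hS
  refine Impl.seq (Impl.estCmd hW hfuel hB h hL h26 hi h9 rfl) fun e₃ R₈ A₈ h51 hS => ?_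
  replace h := h.same hS
  replace hL := hL.same hS
  replace h10 := h10.congr (hS.2 10 rfl)
  rw [← hS.1 26 rfl] at h26
  rw [← hS.1 45 rfl] at h45
  rw [← hS.1 15 rfl] at h15
  rw [← hS.1 47 rfl] at h47
  rw [← hS.1 48 rfl] at h48
  rw [← hS.1 49 rfl] at h49
  rw [← hS.1 50 rfl] at h50
  clear hS
  refine Impl.seq (Impl.estCmd hW hfuel hB h hL h26 hi h10 rfl) fun e₄ R₉ A₉ h52 hS => ?_
  rw [← hS.1 45 rfl] at h45
  rw [← hS.1 15 rfl] at h15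
  rw [← hS.1 47 rfl] at h47
  rw [← hS.1 48 rfl] at h48
  rw [← hS.1 49 rfl] at h49
  rw [← hS.1 50 rfl] at h50
  rw [← hS.1 51 rfl] at h51
  clear hS
  have q2 : ∀ a : Bool, a.toNat ≤ W := fun a => (Bool.toNat_le _).trans hW1
  refine Impl.code hW1 70 ?_ ?_
  · intro _ _
    simp only [oks, Stmt.ok, Exp.ok_mul, Exp.ok_not, Exp.ok_xor, Exp.ok_reg, Exp.eval_mul,
      Exp.eval_not, Exp.eval_xor, Exp.eval_reg, h45, h15, h47, h48, h49, h50, h51, h52, bit_xor,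
      bit_not, bit_and, true_and, and_true, hW1, q2]
  · simp only [runs, Stmt.runReg, Exp.eval_mul,
      Exp.eval_not, Exp.eval_xor, Exp.eval_reg, h45, h15, h47, h48, h49, h50, h51, h52, bit_xor,
      bit_not, bit_and, Function.update_self]

theorem Impl.readCmd {x : Fin n → Bool} {g : Bool} (hW : 2 ≤ W) (hfuel : W < fuel)
    (hB : WordBound n s N K W) (h : Ctx s N K t blk R A) (hL : Blocks s L R A)
    (hx : Holds A 4 x) (h15 : R 15 = g.toNat) :
    Impl f D fuel W (L.length * ((t + 1) * (1104 * (n + 1))) + 3) (L.length * (12 * t + 2))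
      Tester.readCmd R A
      (iter (reader f blk L t x) 0 L.length (g, fun _ => false)) fun a R' A' =>
        R' 15 = a.1.toNat ∧ ∀ j < L.length, A' 12 j = (a.2 j).toNat := by
  have hW1 : 1 ≤ W := by omega
  refine (Impl.for_ hW1 hfuel (reader f blk L t x) (T := 140 * (n + 1) + ((t * (1100 * (n + 1) + 4) + 3)
    + 12)) (q := 2 + (t * 12 + 0)) (fun m a R' A' => R' 15 = a.1.toNat ∧
      ∀ j < m, A' 12 j = (a.2 j).toNat) (N := L.length) (a₀ := (g, fun _ => false)) hL.cnt rfl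
    ⟨h15, fun j hj => absurd hj (Nat.not_lt_zero _)⟩ ?_ ?_).mono ?_ ?_ fun _ _ _ h _ => h
  · intro j a R' A' v w hI
    simpa [Function.update] using hI
  · rintro i ⟨g₀, ys⟩ R₁ A₁ hi h26 hS ⟨g1, g2⟩
    replace h := h.same hS
    replace hL := hL.same hS
    replace hx := hx.congr (hS.2 4 rfl)
    clear hS
    refine Impl.seq (Impl.estCmd hW hfuel hB h hL h26 hi hx rfl) fun y R₂ A₂ h45 hS => ?_
    replace h := h.same hS
    replace hL := hL.same hS
    replace hx := hx.congr (hS.2 4 rfl)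
    rw [← hS.1 26 rfl] at h26
    rw [← hS.1 15 rfl] at g1
    rw [← hS.2 12 rfl] at g2
    clear hS
    refine Impl.seq (Q := fun g' R' A' => R' 15 = g'.toNat) (Impl.for_ hW1 hfuel
      (round f blk (L.getD i (0, fun _ => false)) x y)
      (T := 1100 * (n + 1)) (q := 12) (fun m g' R' _ => R' 15 = g'.toNat) (N := t) (a₀ := g₀)
      h.rt rfl g1 (fun j a R' A' v w hI => by simpa [Function.update] using hI) ?_) ?_
    · intro m g' R₃ A₃ hm hm' hS g3
      exact Impl.roundCmd m hW hfuel hB (h.same hS) (hL.same hS) (by rw [hS.1 26 rfl, h26]) hi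
        (hx.congr (hS.2 4 rfl)) (by rw [hS.1 45 rfl, h45]) g3
    · intro g' R₃ A₃ g3 hS
      rw [← hS.1 26 rfl] at h26
      rw [← hS.1 45 rfl] at h45
      rw [← hS.2 12 rfl] at g2
      refine Impl.code hW1 12 ?_ ?_
      · intro _ _; simp [oks, Stmt.ok]
      · simp only [runs, Stmt.runReg, Stmt.runArr, Exp.eval_reg, h26, h45, g3, true_and,
          Function.update_self]
        intro j hj
        by_cases hji : j = i
        · subst hji; simp
        · rw [Function.update_of_ne hji, Function.update_of_ne hji]
          exact g2 j (by omega)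
  · gcongr
    nlinarith
  · apply le_of_eq; ring

end Verify
end DTTest

/-! ### The table of paths reached by the examples -/

namespace DTTest

open scoped ENNReal

/-- The number of nodes at depth less than `j` of the complete tree with `2k` children per node. -/
def geo (k : ℕ) : ℕ → ℕ
  | 0 => 0
  | j + 1 => geo k j * (2 * k) + 1

theorem geo_mono (k j : ℕ) : geo k j ≤ geo k (j + 1) := by
  induction j with
  | zero => exact Nat.zero_le _
  | succ j ih => simp only [geo] at ih ⊢; gcongr

theorem one_le_geo (k j : ℕ) : 1 ≤ geo k (j + 1) := by simp [geo]

/-- The data about the tree of all paths, as stored by the program. -/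
structure Paths (k M : ℕ) (R : ℕ → ℕ) (A : ℕ → ℕ → ℕ) : Prop where
  r17 : R 17 = 2 * k
  r18 : R 18 = M
  r19 : R 19 = M - 1
  root : A 13 0 = 1

/-- The table of the nodes that are reached by an example with a given label, as stored by the
program. -/
def Table (M : ℕ) (sn : Bool → ℕ → Bool) (A : ℕ → ℕ → ℕ) : Prop :=
  ∀ b p, p < M → A 14 (b.toNat * M + p) = (sn b p).toNat

theorem table_idx {M p p' : ℕ} {b b' : Bool} (hp : p < M) (hp' : p' < M) :
    b.toNat * M + p = b'.toNat * M + p' ↔ b = b' ∧ p = p' := by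
  cases b <;> cases b' <;> simp <;> omega

theorem Paths.same {k M : ℕ} {R R' : ℕ → ℕ} {A A' : ℕ → ℕ → ℕ} {c : Cmd} (h : Paths k M R A)
    (hS : Same c R A R' A')
    (hc : (!(c.wr 17 || c.wr 18 || c.wr 19 || c.wa 13)) = true := by rfl) : Paths k M R' A' := by
  simp only [Bool.not_eq_true', Bool.or_eq_false_iff, and_assoc] at hc
  obtain ⟨a, b, c, d⟩ := hc
  exact ⟨by rw [hS.1 17 a, h.r17], by rw [hS.1 18 b, h.r18], by rw [hS.1 19 c, h.r19],
    by rw [hS.2 13 d, h.root]⟩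

section Verify
variable {n : ℕ} {f : (Fin n → Bool) → Bool} {D : PMF (Fin n → Bool)} {fuel W : ℕ}
  {R : ℕ → ℕ} {A : ℕ → ℕ → ℕ} {s N K t : ℕ} {blk : Fin n → ℕ} {L : List (ℕ × (Fin n → Bool))}

open Tester

theorem Impl.markCmd {k M : ℕ} {l : Bool} {y : ℕ → Bool} {sn : Bool → ℕ → Bool} (hW : 2 ≤ W)
    (hfuel : W < fuel) (hM : 2 * M ≤ W) (hM1 : 1 ≤ M) (hk : k = 0 → M = 1)
    (hp : Paths k M R A) (h16 : R 16 = l.toNat) (hy : ∀ j < k, A 12 j = (y j).toNat)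
    (hT : Table M sn A) :
    Impl f D fuel W (90 * M) 0 Tester.markCmd R A (PMF.pure ()) fun _ _ A' =>
      A' 13 0 = 1 ∧ Table M (fun b p => sn b p || (decide (b = l) && reach k y p)) A' := by
  have hW1 : 1 ≤ W := by omega
  have hlM : l.toNat * M ≤ M := by cases l <;> simp
  refine (Impl.pure_seq (T := 17) (q := 0) (T' := (M - 1) * (86 + 4) + 3) (q' := (M - 1) * 0)
    (b := ()) (Q := fun _ R' A' => R' 65 = l.toNat * M ∧ Table M
      (fun b p => sn b p || (decide (b = l) && decide (p < 1))) A')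
    (Impl.code hW1 17 ?_ ?_) ?_).mono (by omega) (by omega) fun _ _ _ h _ => h
  · intro _ _
    simp [oks, Stmt.ok, h16, hp.r18, hW1]; omega
  · simp only [runs, Stmt.runReg, Stmt.runArr, Exp.eval_reg, Exp.eval_mul, Exp.eval_lit, h16,
      hp.r18, Function.update_self, true_and]
    intro b p hpM
    simp only [Function.update_self]
    by_cases he : b = l ∧ p = 0
    · obtain ⟨rfl, rfl⟩ := he
      simp
    · have : b.toNat * M + p ≠ l.toNat * M := by
        intro h
        exact he ((table_idx hpM (by omega : 0 < M)).1 h)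
      rw [Function.update_of_ne this, hT b p hpM]
      congr 1
      by_cases hb : b = l
      · have : p ≠ 0 := fun h => he ⟨hb, h⟩
        simp [this]
      · simp [hb]
  · rintro R₁ A₁ ⟨h65, hT'⟩ hS
    replace hp := hp.same hS
    rw [← hS.2 12 rfl] at hy
    clear hS
    refine (Impl.for_pure hW1 hfuel (T := 86) (q := 0) (fun m _ A' =>
      (∀ p ≤ m, A' 13 p = (reach k y p).toNat) ∧ Table M
        (fun b p => sn b p || (decide (b = l) && decide (p < m + 1) && reach k y p)) A')
      (N := M - 1) hp.r19 rfl ⟨?_, ?_⟩ (fun j R' A' v w h => h) ?_).mono le_rfl le_rfl ?_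
    · intro p hp0
      obtain rfl : p = 0 := by omega
      rw [hp.root, reach]; rfl
    · intro b p hpM
      rw [hT' b p hpM]
      congr 2
      by_cases h0 : p = 0
      · subst h0; simp [reach]
      · simp [h0]
    · rintro q R₂ A₂ hq h30 hS ⟨g1, g2⟩
      -- For `k = 0` the root is the only node and the loop is empty; hence the divisions by `2k` in
      -- the body are genuine.
      have hk0 : 0 < k := by
        rcases Nat.eq_zero_or_pos k with h | h
        · rw [hk h] at hq; omega
        · exact h
      have e17 : R₂ 17 = 2 * k := by rw [hS.1 17 rfl, hp.r17]
      have e65 : R₂ 65 = l.toNat * M := by rw [hS.1 65 rfl, h65]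
      have hmod : q - q / (2 * k) * (2 * k) = q % (2 * k) := by
        have := Nat.div_add_mod q (2 * k)
        rw [mul_comm] at this; omega
      have hmod2 : q % (2 * k) - 2 * (q % (2 * k) / 2) = (decide (q % (2 * k) % 2 = 1)).toNat := by
        rcases Nat.mod_two_eq_zero_or_one (q % (2 * k)) with h | h
        · rw [h]; simp; omega
        · rw [h]; simp; omega
      have hlt : q % (2 * k) / 2 < k := by
        have := Nat.mod_lt q (by omega : 0 < 2 * k); omega
      have e12 : A₂ 12 (q % (2 * k) / 2) = (y (q % (2 * k) / 2)).toNat := by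
        rw [hS.2 12 rfl]; exact hy _ hlt
      have e13 : A₂ 13 (q / (2 * k)) = (reach k y (q / (2 * k))).toNat :=
        g1 _ (Nat.div_le_self _ _)
      have e14 : A₂ 14 (l.toNat * M + (q + 1)) = (sn l (q + 1)).toNat := by
        rw [g2 l (q + 1) (by omega)]; simp
      have hr : (reach k y (q / (2 * k)) && !(y (q % (2 * k) / 2) ^^ decide (q % (2 * k) % 2 = 1)))
          = reach k y (q + 1) := by rw [reach]
      refine Impl.code hW1 86 ?_ ?_
      · intro hR hA
        have q2 : ∀ a : Bool, a.toNat ≤ W := fun a => (Bool.toNat_le _).trans hW1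
        simp only [oks, Stmt.ok, Stmt.runReg, Stmt.runArr, Exp.ok_add, Exp.ok_mul, Exp.ok_reg,
          Exp.ok_sub, Exp.ok_div, Exp.ok_lit, Exp.ok_or,
          Exp.ok_not, Exp.ok_get, Exp.ok_xor, Exp.eval_reg, Exp.eval_not, Exp.eval_sub,
          Exp.eval_mul, Exp.eval_xor, Exp.eval_div, Exp.eval_lit,
          Exp.eval_add, Exp.eval_get, true_and, and_true, hW1, hW, Function.update_self, ne_eq,
          Nat.reduceEqDiff, not_false_eq_true, Function.update_of_ne, h30, e17, e65, hmod, hmod2,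
          e12, e13, bit_xor, bit_not, bit_and, q2]
        have h1 := Nat.div_mul_le_self q (2 * k)
        have h2 := Nat.mod_le q (2 * k)
        have h3 := Nat.mul_div_le (q % (2 * k)) 2
        refine ⟨?_, ?_⟩ <;> omega
      · simp only [runs, Stmt.runReg, Stmt.runArr, Exp.eval_reg, Exp.eval_not, Exp.eval_sub,
          Exp.eval_mul, Exp.eval_xor, Exp.eval_div, Exp.eval_lit, Exp.eval_or,
          Exp.eval_add, Exp.eval_get, Function.update_self, ne_eq,
          Nat.reduceEqDiff, not_false_eq_true, Function.update_of_ne, h30, e17, e65, hmod, hmod2,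
          e12, e13, e14, bit_xor, bit_not, bit_and, bit_or, hr]
        constructor
        · intro p hpq
          by_cases h : p = q + 1
          · subst h; simp
          · rw [Function.update_of_ne h]; exact g1 p (by omega)
        · intro b p hpM
          simp only [Function.update_self]
          by_cases he : b = l ∧ p = q + 1
          · obtain ⟨rfl, rfl⟩ := he
            simp
            cases sn b (q + 1) <;> cases reach k y (q + 1) <;> rfl
          · have : b.toNat * M + p ≠ l.toNat * M + (q + 1) := by
              intro h
              exact he ((table_idx hpM (by omega)).1 h)
            rw [Function.update_of_ne this, g2 b p hpM]
            congr 2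
            by_cases hb : b = l
            · have h1 : p ≠ q + 1 := fun h => he ⟨hb, h⟩
              have : (p < q + 1) = (p < q + 1 + 1) := by
                apply propext; omega
              simp only [this]
            · simp [hb]
    · rintro _ R' A' ⟨g1, g2⟩ -
      refine ⟨by rw [g1 0 (Nat.zero_le _), reach]; rfl, fun b p hpM => ?_⟩
      rw [g2 b p hpM]
      have : p < M - 1 + 1 := by omega
      simp [this]

/-- The state of the test, as stored by the program. -/
def Testing (f : (Fin n → Bool) → Bool) (K M : ℕ) (blk : Fin n → ℕ)
    (L : List (ℕ × (Fin n → Bool))) (a : Bool × List ((Fin n → Bool) × (ℕ → Bool)))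
    (R : ℕ → ℕ) (A : ℕ → ℕ → ℕ) : Prop :=
  R 15 = a.1.toNat ∧ A 13 0 = 1 ∧
    Table M (seen L.length (fun x => f (cutPt blk L (2 ^ K) x)) a.2) A

theorem Impl.testCmd {M : ℕ} {a : Bool × List ((Fin n → Bool) × (ℕ → Bool))} (m : ℕ) (hW : 2 ≤ W)
    (hfuel : W < fuel) (hB : WordBound n s N K W) (hM : 2 * M ≤ W) (hM1 : 1 ≤ M)
    (hk : L.length = 0 → M = 1) (h : Ctx s N K t blk R A) (hL : Blocks s L R A)
    (hp : Paths L.length M R A) (ha : Testing f K M blk L a R A) :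
    Impl f D fuel W (60 * (n + 1) + (L.length * ((t + 1) * (1104 * (n + 1))) + 3) + 90 * M)
      (2 + L.length * (12 * t + 2)) Tester.testCmd R A (testStep f D blk L t m a)
      fun a' R' A' => Testing f K M blk L a' R' A' := by
  have hW1 : 1 ≤ W := by omega
  obtain ⟨h15, hroot, hT⟩ := ha
  refine (Impl.seq (Impl.sample_point hW1)
    (T' := 8 + (40 * (n + 1) + ((1 + 1 * (n + 1)) +
      ((L.length * ((t + 1) * (1104 * (n + 1))) + 3) + 90 * M))))
    (q' := 0 + (0 + (1 + (L.length * (12 * t + 2) + 0))))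
    fun x R₁ A₁ hx hS => ?_).mono (by omega) (by omega) fun _ _ _ h _ => h
  replace h := h.same hS
  replace hL := hL.same hS
  replace hp := hp.same hS
  rw [← hS.1 15 rfl] at h15
  have hT : Table M (seen L.length (fun x => f (cutPt blk L (2 ^ K) x)) a.2) A₁ := by
    intro b p hpM; rw [hS.2 14 rfl]; exact hT b p hpM
  clear hS
  refine Impl.pure_seq (b := ()) (Q := fun _ R' A' => R' 44 = 2 ^ K) (Impl.code hW1 8 ?_ ?_) ?_
  · intro _ _; simp [oks, Stmt.ok]
  · simp [runs, Stmt.runReg, h.rr]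
  intro R₂ A₂ h44 hS
  replace h := h.same hS
  replace hL := hL.same hS
  replace hp := hp.same hS
  replace hx := hx.same hS
  rw [← hS.1 15 rfl] at h15
  have hT : Table M (seen L.length (fun x => f (cutPt blk L (2 ^ K) x)) a.2) A₂ := by
    intro b p hpM; rw [hS.2 14 rfl]; exact hT b p hpM
  clear hS
  refine Impl.pure_seq (b := ()) (Impl.cut hW1 hfuel h.rn h44 h.blk hL.inx hx.pt) ?_
  intro R₃ A₃ h6 hS
  replace h := h.same hS
  replace hL := hL.same hS
  replace hp := hp.same hS
  replace hx := hx.same hS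
  rw [← hS.1 15 rfl] at h15
  have hT : Table M (seen L.length (fun x => f (cutPt blk L (2 ^ K) x)) a.2) A₃ := by
    intro b p hpM; rw [hS.2 14 rfl]; exact hT b p hpM
  clear hS
  -- The label of the example is overwritten by the value of `f` at the cut point. Trees are
  -- compared with this function, which ignores the blocks that were not found.
  refine Impl.pure_seq (b := ()) (Q := fun _ R' A' =>
    R' 16 = (f (cutPt blk L (2 ^ K) x)).toNat) (Impl.code_query hW1 1 1 ?_ ?_) ?_
  · intro _ _; simp [oks, Stmt.ok]
  · simp only [runs, Stmt.runReg, Function.update_self]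
    rw [h6.read]
  intro R₄ A₄ h16 hS
  replace h := h.same hS
  replace hL := hL.same hS
  replace hp := hp.same hS
  have hx4 : Holds A₄ 4 x := hx.pt.congr (hS.2 4 rfl)
  rw [← hS.1 15 rfl] at h15
  have hT : Table M (seen L.length (fun x => f (cutPt blk L (2 ^ K) x)) a.2) A₄ := by
    intro b p hpM; rw [hS.2 14 rfl]; exact hT b p hpM
  clear hS
  refine Impl.seq_pure (g := fun b : Bool × (ℕ → Bool) => (b.1, (x, b.2) :: a.2))
    (Impl.readCmd hW hfuel hB h hL hx4 h15) ?_
  rintro ⟨g, y⟩ R₅ A₅ ⟨g15, hy⟩ hS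
  replace hp := hp.same hS
  rw [← hS.1 16 rfl] at h16
  have hT : Table M (seen L.length (fun x => f (cutPt blk L (2 ^ K) x)) a.2) A₅ := by
    intro b p hpM; rw [hS.2 14 rfl]; exact hT b p hpM
  clear hS
  refine ((Impl.markCmd hW hfuel hM hM1 hk hp h16 hy hT).mono le_rfl le_rfl
    (Q' := fun _ R' A' => Testing f K M blk L (g, (x, y) :: a.2) R' A')
    (fun _ R' A' h3 hS => ⟨by rw [hS.1 15 rfl]; exact g15, h3.1, fun b p hpM => ?_⟩)).of_Ex_le
    fun F => ⟨fun _ => F (g, (x, y) :: a.2), by rw [Ex_pure, Ex_pure],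
      fun _ _ _ h3 => ⟨_, h3, le_rfl⟩⟩
  rw [h3.2 b p hpM]
  simp only [seen, List.any_cons]
  rw [Bool.or_comm]
  congr 3
  cases b <;> cases f (cutPt blk L (2 ^ K) x) <;> rfl

end Verify
end DTTest

/-! ### Dynamic programming over the tree of paths -/

namespace DTTest

open scoped ENNReal

/-- This bound makes the truncation in `cred` harmless: if the values of two children exceed `s + 1`
in sum, then both are positive, that is, both subtrees exist. -/
theorem cred_le (k s : ℕ) (sn : Bool → ℕ → Bool) (e p : ℕ) : cred k s sn e p ≤ s := by
  induction e generalizing p with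
  | zero => exact Nat.zero_le _
  | succ e ih =>
    rw [cred]
    refine max_le ?_ (Finset.sup_le fun i _ => ?_)
    · cases sn false p <;> cases sn true p <;> simp
    · have h1 := ih (p * (2 * k) + 2 * i + 1)
      have h2 := ih (p * (2 * k) + 2 * i + 2)
      omega

theorem geo_le_geo {k k' : ℕ} (h : k ≤ k') (j : ℕ) : geo k j ≤ geo k' j := by
  induction j with
  | zero => exact le_rfl
  | succ j ih => simp only [geo]; gcongr

theorem geo_monotone (k : ℕ) : Monotone (geo k) := monotone_nat_of_le_succ (geo_mono k)

/-- Nodes are numbered level by level: level `i` occupies the interval from `geo k i` to `geo k (i +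
1) - 1`. -/
theorem exists_level {k : ℕ} (j p : ℕ) (h : p < geo k j) :
    ∃ i < j, geo k i ≤ p ∧ p < geo k (i + 1) := by
  induction j with
  | zero => simp [geo] at h
  | succ j ih =>
    by_cases hp : p < geo k j
    · obtain ⟨i, hi, h'⟩ := ih hp
      exact ⟨i, by omega, h'⟩
    · exact ⟨j, by omega, by omega, h⟩

section Verify
variable {n : ℕ} {f : (Fin n → Bool) → Bool} {D : PMF (Fin n → Bool)} {fuel W : ℕ}
  {R : ℕ → ℕ} {A : ℕ → ℕ → ℕ} {s N K t : ℕ} {blk : Fin n → ℕ} {L : List (ℕ × (Fin n → Bool))}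

open Tester

theorem Impl.sizeCmd {k dd : ℕ} (hW : 2 ≤ W) (hfuel : W < fuel) (hM : geo k (dd + 1) ≤ W)
    (hk : 2 * k ≤ W) (h13 : R 13 = k) (h11 : R 11 = dd) :
    Impl f D fuel W (60 * (dd + 1)) 0 Tester.sizeCmd R A (PMF.pure ()) fun _ R' A' =>
      Paths k (geo k (dd + 1)) R' A' ∧ R' 15 = 1 := by
  have hW1 : 1 ≤ W := by omega
  refine (Impl.pure_seq (T := 10) (q := 0) (T' := (dd * (10 + 4) + 3) + 20)
    (q' := dd * 0 + 0) (b := ()) (Q := fun _ R' A' => R' 17 = 2 * k ∧ R' 18 = 1)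
    (Impl.code hW1 10 ?_ ?_) ?_).mono (by omega) (by omega) fun _ _ _ h _ => h
  · intro _ _; simp [oks, Stmt.ok, h13, hk, hW, hW1]
  · simp [runs, Stmt.runReg, h13]
  rintro R₁ A₁ ⟨h17, h18⟩ hS
  rw [← hS.1 11 rfl] at h11
  clear hS
  refine Impl.pure_seq (b := ()) (Impl.for_pure hW1 hfuel (T := 10) (q := 0) (fun m R' _ =>
      R' 18 = geo k (m + 1)) (N := dd) h11 rfl (by simp [h18, geo])
      (fun j R' A' v w h => h) ?_) ?_
  · intro j R₂ A₂ hj hj' hS h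
    have e17 : R₂ 17 = 2 * k := by rw [hS.1 17 rfl, h17]
    have h1 : geo k (j + 2) ≤ W := (geo_monotone k (by omega)).trans hM
    rw [geo] at h1
    refine Impl.code hW1 10 ?_ ?_
    · intro _ _
      simp [oks, Stmt.ok, h, e17, hW1, h1]
      omega
    · simp [runs, Stmt.runReg, h, e17, geo]
  · intro R₂ A₂ h hS
    have e17 : R₂ 17 = 2 * k := by rw [hS.1 17 rfl, h17]
    refine Impl.code hW1 20 ?_ ?_
    · intro _ _
      simp [oks, Stmt.ok, h, hW1]
    · simp only [runs, Stmt.runReg, Stmt.runArr]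
      exact ⟨⟨by simp [e17], by simp [h], by simp [h], by simp⟩, by simp⟩

theorem Impl.credCmd {k dd : ℕ} {sn : Bool → ℕ → Bool} (hW : 2 ≤ W)
    (hfuel : W < fuel) (hks : k ≤ s) (hM : (geo k (dd + 1) + 1) * (2 * s + 2) ≤ W) (h1 : R 1 = s)
    (h13 : R 13 = k) (hp : Paths k (geo k (dd + 1)) R A) (hT : Table (geo k (dd + 1)) sn A)
    (h15 : ∀ p, A 15 p = 0) :
    Impl f D fuel W (geo k (dd + 1) * (100 * (k + 1)) + 3) 0 Tester.credCmd R A (PMF.pure ())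
      fun _ _ A' => A' 15 0 = cred k s sn (dd + 1) 0 := by
  have hW1 : 1 ≤ W := by omega
  have hM1 : 1 ≤ geo k (dd + 1) := one_le_geo k dd
  obtain ⟨M, hMdef⟩ : ∃ M, M = geo k (dd + 1) := ⟨_, rfl⟩
  rw [← hMdef] at hM hp hT hM1 ⊢
  -- After `j` rounds the nodes from `M - j` on are done. Level `dd + 1` is included: its cells lie
  -- beyond the table and are never written, and their initial value `0` is the correct value at
  -- remaining depth `0`.
  refine (Impl.for_pure hW1 hfuel (T := 14 + ((k * (60 + 4) + 3) + 40)) (q := 0 + (k * 0 + 0))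
    (fun j _ A' => ∀ lev ≤ dd + 1, ∀ p, M - j ≤ p → geo k lev ≤ p → p < geo k (lev + 1) →
      A' 15 p = cred k s sn (dd + 1 - lev) p) (N := M) hp.r18 rfl ?_
      (fun j R' A' v w h => h) ?_).mono ?_ (by omega) ?_
  · intro lev hlev p hp1 hp2 hp3
    rcases Nat.lt_or_ge lev (dd + 1) with h | h
    · have := geo_monotone k (show lev + 1 ≤ dd + 1 by omega)
      omega
    · rw [h15, show dd + 1 - lev = 0 by omega, cred]
  · intro j R₁ A₁ hj hj' hS hI
    replace hp := hp.same hS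
    rw [← hS.1 1 rfl] at h1
    rw [← hS.1 13 rfl] at h13
    have hT : Table M sn A₁ := by
      intro b p hpM; rw [hS.2 14 rfl]; exact hT b p hpM
    clear hS
    obtain ⟨p, hpdef⟩ : ∃ p, p = M - 1 - j := ⟨_, rfl⟩
    have hpM : p < M := by omega
    have hpk : (p + 2) * (2 * k + 2) ≤ W := le_trans (Nat.mul_le_mul (by omega) (by omega)) hM
    have hpk' : p * (2 * k) + 4 * k + 2 * p + 4 ≤ W := by
      refine le_trans (le_of_eq ?_) hpk; ring
    have hsW : 2 * s + 2 ≤ W := le_trans (Nat.le_mul_of_pos_left _ (by omega)) hM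
    obtain ⟨lev, hlev, hl1, hl2⟩ := exists_level (k := k) (dd + 1) p (by omega)
    -- Children lie on the next level and have larger numbers than `p`, so the invariant already
    -- covers them.
    have hch : ∀ c, c < 2 * k → A₁ 15 (p * (2 * k) + c + 1) =
        cred k s sn (dd - lev) (p * (2 * k) + c + 1) := by
      intro c hc
      have := hI (lev + 1) (by omega) (p * (2 * k) + c + 1) ?_ ?_ ?_
      · rwa [show dd + 1 - (lev + 1) = dd - lev by omega] at this
      · have : p ≤ p * (2 * k) := Nat.le_mul_of_pos_right _ (by omega)
        omega
      · rw [geo]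
        have := Nat.mul_le_mul_right (2 * k) hl1
        omega
      · rw [geo]
        have := Nat.mul_le_mul_right (2 * k) (show p + 1 ≤ geo k (lev + 1) by omega)
        rw [add_mul] at this
        omega
    refine Impl.pure_seq (b := ()) (Q := fun _ R' A' => R' 56 = p ∧ R' 55 = 0)
      (Impl.code hW1 14 ?_ ?_) ?_
    · intro _ _; simp [oks, Stmt.ok]
    · simp [runs, Stmt.runReg, hj', hp.r19, hpdef]
    rintro R₂ A₂ ⟨h56, h55⟩ hS
    replace hp := hp.same hS
    rw [← hS.1 1 rfl] at h1
    rw [← hS.1 13 rfl] at h13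
    rw [← hS.2 15 rfl] at hI hch
    have hT : Table M sn A₂ := by
      intro b p hpM; rw [hS.2 14 rfl]; exact hT b p hpM
    clear hS
    refine Impl.pure_seq (b := ()) (Impl.for_pure hW1 hfuel (T := 60) (q := 0) (fun m R' _ =>
      R' 55 = (Finset.range m).sup fun i => cred k s sn (dd - lev) (p * (2 * k) + 2 * i + 1) +
          cred k s sn (dd - lev) (p * (2 * k) + 2 * i + 2) - (s + 1)) (N := k) h13 rfl
      (by simp [h55]) (fun j R' A' v w h => h) ?_) ?_
    · intro i R₃ A₃ hi hi' hS h
      replace hp := hp.same hS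
      rw [← hS.1 1 rfl] at h1
      rw [← hS.1 56 rfl] at h56
      rw [← hS.2 15 rfl] at hI hch
      clear hS
      have c1 := hch (2 * i) (by omega)
      have c2 := hch (2 * i + 1) (by omega)
      have b1 := cred_le k s sn (dd - lev) (p * (2 * k) + 2 * i + 1)
      have b2 := cred_le k s sn (dd - lev) (p * (2 * k) + 2 * i + 2)
      have b3 : ((Finset.range i).sup fun i => cred k s sn (dd - lev) (p * (2 * k) + 2 * i + 1) +
          cred k s sn (dd - lev) (p * (2 * k) + 2 * i + 2) - (s + 1)) ≤ s :=
        Finset.sup_le fun i _ => by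
          have h1 := cred_le k s sn (dd - lev) (p * (2 * k) + 2 * i + 1)
          have h2 := cred_le k s sn (dd - lev) (p * (2 * k) + 2 * i + 2)
          omega
      have c2 : A₃ 15 (p * (2 * k) + 2 * i + 2) =
        cred k s sn (dd - lev) (p * (2 * k) + 2 * i + 2) := c2
      refine Impl.code hW1 60 ?_ ?_
      · intro _ _
        simp only [oks, Stmt.ok, Stmt.runReg, Stmt.runArr, Exp.ok_add, Exp.ok_mul, Exp.ok_reg,
          Exp.ok_sub, Exp.ok_lit, Exp.ok_get, Exp.eval_reg, Exp.eval_sub, Exp.eval_mul,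
          Exp.eval_lit, Exp.eval_add, Exp.eval_get, true_and, and_true, hW1, hW,
          Function.update_self, ne_eq, Nat.reduceEqDiff, not_false_eq_true,
          Function.update_of_ne, h56, hp.r17, hi', c1, c2, h1, h]
        refine ⟨?_, ?_, ?_⟩ <;> omega
      · simp only [runs, Stmt.runReg, Stmt.runArr, Exp.eval_reg, Exp.eval_sub, Exp.eval_mul,
          Exp.eval_lit, Exp.eval_add, Exp.eval_get, Function.update_self, ne_eq, Nat.reduceEqDiff,
          not_false_eq_true, Function.update_of_ne, h56, hp.r17, hi', c1, c2, h1, h,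
          Finset.range_add_one, Finset.sup_insert]
        omega
    · intro R₃ A₃ h hS
      replace hp := hp.same hS
      rw [← hS.1 1 rfl] at h1
      rw [← hS.1 56 rfl] at h56
      rw [← hS.2 15 rfl] at hI
      have hT : Table M sn A₃ := by
        intro b p hpM; rw [hS.2 14 rfl]; exact hT b p hpM
      clear hS
      have b3 : ((Finset.range k).sup fun i => cred k s sn (dd - lev) (p * (2 * k) + 2 * i + 1) +
          cred k s sn (dd - lev) (p * (2 * k) + 2 * i + 2) - (s + 1)) ≤ s :=
        Finset.sup_le fun i _ => by
          have h1 := cred_le k s sn (dd - lev) (p * (2 * k) + 2 * i + 1)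
          have h2 := cred_le k s sn (dd - lev) (p * (2 * k) + 2 * i + 2)
          omega
      have t1 : A₃ 14 p = (sn false p).toNat := by simpa using hT false p hpM
      have t2 : A₃ 14 (M + p) = (sn true p).toNat := by simpa using hT true p hpM
      have hmono : (!(sn false p && sn true p)).toNat * s ≤ s := by
        cases sn false p <;> cases sn true p <;> simp
      have hMs : 2 * M ≤ W := le_trans (by nlinarith) hM
      have q2 : ∀ a : Bool, a.toNat ≤ W := fun a => (Bool.toNat_le _).trans hW1
      refine Impl.code hW1 40 ?_ ?_
      · intro _ _
        simp only [oks, Stmt.ok, Stmt.runReg, Stmt.runArr, Exp.ok_add, Exp.ok_mul, Exp.ok_reg,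
          Exp.ok_sub, Exp.ok_lit, Exp.ok_get, Exp.ok_not, Exp.eval_not, Exp.eval_reg, Exp.eval_sub,
          Exp.eval_mul, Exp.eval_lit, Exp.eval_add, Exp.eval_get, true_and, and_true, hW1, hW,
          Function.update_self, ne_eq, Nat.reduceEqDiff, not_false_eq_true,
          Function.update_of_ne, h56, hp.r18, t1, t2, h1, h, bit_and, bit_not, q2]
        refine ⟨⟨?_, ?_⟩, ?_⟩ <;> omega
      · simp only [runs, Stmt.runReg, Stmt.runArr, Exp.eval_reg, Exp.eval_sub, Exp.eval_mul,
          Exp.eval_lit, Exp.eval_add, Exp.eval_get, Exp.eval_not, Function.update_self, ne_eq,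
          Nat.reduceEqDiff, not_false_eq_true, Function.update_of_ne, h56, hp.r18, t1, t2, h1, h,
          bit_and, bit_not]
        intro lev' hlev' p' hp1 hp2 hp3
        by_cases hpp : p' = p
        · subst hpp
          -- The levels are disjoint intervals of node numbers, so `p` determines its level.
          have : lev' = lev := by
            rcases lt_trichotomy lev' lev with h | h | h
            · have := geo_monotone k (show lev' + 1 ≤ lev by omega); omega
            · exact h
            · have := geo_monotone k (show lev + 1 ≤ lev' by omega); omega
          subst this
          rw [Function.update_self, show dd + 1 - lev' = dd - lev' + 1 by omega, cred]
          omega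
        · rw [Function.update_of_ne hpp]
          exact hI lev' hlev' p' (by omega) hp2 hp3
  · have : M * (14 + ((k * (60 + 4) + 3) + 40) + 4) ≤ M * (100 * (k + 1)) := by gcongr; omega
    omega
  · intro _ R' A' h _
    exact h 0 (by omega) 0 (by omega) le_rfl (by simp [geo])

end Verify
end DTTest

namespace DTTest

open scoped ENNReal

/-! ### Computation of the parameters, and the whole program -/

section Verify
variable {n : ℕ} {f : (Fin n → Bool) → Bool} {D : PMF (Fin n → Bool)} {fuel W : ℕ}
  {R : ℕ → ℕ} {A : ℕ → ℕ → ℕ} {s d : ℕ}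

open Tester

/-- One conditional doubling. The exponent grows until `2 ^ a` exceeds `E` and then stays; since `2
^ a ≤ 2 * E` throughout, the final exponent is the binary length of `E`. -/
theorem log_step {E i a w : ℕ} (hE : 1 ≤ E) (hw : w = 2 ^ a) (hle : 2 ^ a ≤ 2 * E)
    (hi : a = i ∨ E < 2 ^ a) (c : ℕ) (hc : c = (decide (w ≤ E)).toNat) :
    w * (1 + c) = 2 ^ (a + c) ∧ 2 ^ (a + c) ≤ 2 * E ∧ (a + c = i + 1 ∨ E < 2 ^ (a + c)) ∧
      w * (1 + c) ≤ 2 * E := by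
  subst hc hw
  by_cases h : 2 ^ a ≤ E
  · have h2 : (2 : ℕ) ^ (a + 1) = 2 ^ a * 2 := pow_succ 2 a
    simp only [h, decide_true, Bool.toNat_true]
    exact ⟨by omega, by omega, by omega, by omega⟩
  · simp only [h, decide_false, Bool.toNat_false, add_zero, mul_one]
    exact ⟨trivial, hle, Or.inr (by omega), hle⟩

theorem Impl.params {E l : ℕ} (hW : 2 ≤ W) (hfuel : W < fuel) (hE : 1 ≤ E)
    (hl : l = Nat.log 2 E + 1) (hR : R 1 * R 3 = E)
    (hr : 2 * 2 ^ (2 * l + 4) ≤ W) (hsN : R 1 * (16 * l * E) ≤ W) (ht : 100 * l + 16 * l ≤ W)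
    (hN : 16 * l * E ≤ W) :
    Impl f D fuel W (E * 50 + 100) 0 Tester.params R A (PMF.pure ()) fun _ R' _ =>
      R' 7 = 2 * l + 4 ∧ R' 8 = 2 ^ (2 * l + 4) ∧ R' 9 = 100 * l ∧ R' 10 = 16 * l * E ∧
        R' 11 = R 2 - (R 2 - R 1) ∧ R' 12 = R 1 * (16 * l * E) := by
  have hW1 : 1 ≤ W := by omega
  have hl1 : 1 ≤ l := by omega
  have hEW : 16 * E ≤ W := le_trans (by nlinarith) hN
  refine (Impl.pure_seq (T := 20) (q := 0) (T' := (E * (46 + 4) + 3) + 77)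
    (q' := E * 0 + 0) (b := ()) (Q := fun _ R' A' => R' 4 = E ∧ R' 5 = 1 ∧ R' 6 = 0)
    (Impl.code hW1 20 ?_ ?_) ?_).mono (by omega) (by omega) fun _ _ _ h _ => h
  · intro _ _; simp [oks, Stmt.ok, hR, hW1]; omega
  · simp [runs, Stmt.runReg, hR]
  rintro R₁ A₁ ⟨h4, h5, h6⟩ hS
  have e1 : R₁ 1 = R 1 := hS.1 1 rfl
  have e2 : R₁ 2 = R 2 := hS.1 2 rfl
  clear hS
  refine Impl.pure_seq (b := ()) (Impl.for_pure hW1 hfuel (T := 46) (q := 0) (fun m R' _ =>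
      R' 5 = 2 ^ R' 6 ∧ 2 ^ R' 6 ≤ 2 * E ∧ (R' 6 = m ∨ E < 2 ^ R' 6)) (N := E) h4 rfl
      ⟨by rw [h5, h6]; rfl, by rw [h6]; omega, by simp [h6]⟩
      (fun j R' A' v w h => h) ?_) ?_
  · rintro j R₂ A₂ hj hj' hS ⟨g5, gle, gi⟩
    have e4 : R₂ 4 = E := by rw [hS.1 4 rfl, h4]
    have hs := log_step hE g5 gle gi _ rfl
    have hlt := Nat.lt_two_pow_self (n := R₂ 6)
    refine Impl.code hW1 46 ?_ ?_
    · intro _ _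
      have q2 : ∀ a : Bool, a.toNat ≤ 1 := fun a => Bool.toNat_le _
      have := q2 (decide (R₂ 5 ≤ E))
      simp only [oks, Stmt.ok, Stmt.runReg, Stmt.runArr, Exp.ok_add, Exp.ok_mul, Exp.ok_reg,
          Exp.ok_le, Exp.ok_lit, Exp.eval_le, Exp.eval_reg, Exp.eval_mul,
          Exp.eval_lit, Exp.eval_add, true_and, and_true, hW1,
          Function.update_self, ne_eq, Nat.reduceEqDiff, not_false_eq_true,
          Function.update_of_ne, e4, bit_le (R₂ 5)]
      refine ⟨?_, ?_, ?_⟩ <;> omega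
    · simp only [runs, Stmt.runReg, Stmt.runArr, Exp.eval_le, Exp.eval_reg, Exp.eval_mul,
          Exp.eval_lit, Exp.eval_add,
          Function.update_self, ne_eq, Nat.reduceEqDiff, not_false_eq_true,
          Function.update_of_ne, e4, bit_le (R₂ 5)]
      exact ⟨hs.1, hs.2.1, hs.2.2.1⟩
  · rintro R₂ A₂ ⟨g5, gle, gi⟩ hS
    have e4 : R₂ 4 = E := by rw [hS.1 4 rfl, h4]
    rw [← hS.1 1 rfl] at e1
    rw [← hS.1 2 rfl] at e2
    -- If every one of the `E` rounds has doubled, then `E < 2 ^ E` shows that there were enough of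
    -- them.
    have hlt : E < 2 ^ R₂ 6 := by
      rcases gi with h | h
      · rw [h]; exact Nat.lt_two_pow_self
      · exact h
    have h6 : R₂ 6 = l := by
      have hpos : R₂ 6 ≠ 0 := by intro h; rw [h] at hlt; omega
      obtain ⟨m, hm⟩ := Nat.exists_eq_succ_of_ne_zero hpos
      rw [hm, Nat.succ_eq_add_one, pow_succ] at gle
      rw [hm] at hlt
      rw [hl, hm, Nat.log_eq_of_pow_le_of_lt_pow (by omega) hlt]
    have hpow : 16 * (2 ^ l * 2 ^ l) = 2 ^ (2 * l + 4) := by rw [pow_add, two_mul, pow_add]; ring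
    rw [h6] at g5
    have hpp : 2 ^ l * 2 ^ l ≤ 2 ^ (2 * l + 4) := by omega
    refine Impl.code hW1 77 ?_ ?_
    · intro hRW _
      simp only [oks, Stmt.ok, Stmt.runReg, Stmt.runArr, Exp.ok_add, Exp.ok_mul, Exp.ok_reg,
          Exp.ok_sub, Exp.ok_lit, Exp.eval_sub, Exp.eval_reg, Exp.eval_mul,
          Exp.eval_lit, Exp.eval_add, true_and, and_true,
          Function.update_self, ne_eq, Nat.reduceEqDiff, not_false_eq_true,
          Function.update_of_ne, e4, e1, e2, g5, h6, hpow]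
      refine ⟨?_, ?_, ?_, ?_, ?_⟩ <;> omega
    · simp only [runs, Stmt.runReg, Stmt.runArr, Exp.eval_sub, Exp.eval_reg, Exp.eval_mul,
          Exp.eval_lit, Exp.eval_add,
          Function.update_self, ne_eq, Nat.reduceEqDiff, not_false_eq_true,
          Function.update_of_ne, e4, e1, e2, g5, h6, hpow, and_self]

-- The number of found blocks is random; the time and query bounds are monotone in it, so they are
-- stated with its upper bound `s`, which uses `geo_le_geo`.
set_option maxHeartbeats 1000000 in
theorem Impl.prog {Nv E l N K t dd T q : ℕ} (hW : 2 ≤ W) (hfuel : W < fuel) (hE : 1 ≤ E)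
    (hs : 1 ≤ s) (hl : l = Nat.log 2 E + 1) (hEd : E = s * Nv) (hN : N = 16 * l * E)
    (hK : K = 2 * l + 4) (ht : t = 100 * l) (hdd : dd = d - (d - s)) (hB : WordBound n s N K W)
    (hsN : s * N ≤ W) (htW : 100 * l + 16 * l ≤ W) (hM : (geo s (dd + 1) + 1) * (2 * s + 2) ≤ W)
    (r0 : R 0 = n) (r1 : R 1 = s) (r2 : R 2 = d) (r3 : R 3 = Nv)
    (r13 : R 13 = 0) (r14 : R 14 = 0) (hA : ∀ a j, A a j = 0)
    (hT : (E * 50 + 100) + ((K * (40 * (n + 1)) + 3) +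
      ((s * N * ((K + 4) * (100 * (n + 1)) + 4) + 3) + (60 * (dd + 1) +
      ((N * (60 * (n + 1) + (s * ((t + 1) * (1104 * (n + 1))) + 3) + 90 * geo s (dd + 1) + 4) + 3) +
      ((geo s (dd + 1) * (100 * (s + 1)) + 3) + 30))))) ≤ T)
    (hq : s * N * (K + 2) + N * (2 + s * (12 * t + 2)) ≤ q) :
    Impl f D fuel W T q Tester.prog R A (alg f D s N K t dd) fun b R' _ => (R' 0 ≠ 0 ↔ b) := by
  have hW1 : 1 ≤ W := by omega
  refine (Impl.pure_seq (b := ()) (Impl.params hW hfuel hE hl (by rw [r1, r3, hEd])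
    (by rw [← hK]; exact hB.r) (by rw [r1, ← hN]; exact hsN) htW
    (by rw [← hN]; have := hB.N; omega)) (T' := (K * (40 * (n + 1)) + 3) +
      ((s * N * ((K + 4) * (100 * (n + 1)) + 4) + 3) + (60 * (dd + 1) +
      ((N * (60 * (n + 1) + (s * ((t + 1) * (1104 * (n + 1))) + 3) + 90 * geo s (dd + 1) + 4) + 3) +
      ((geo s (dd + 1) * (100 * (s + 1)) + 3) + 30)))))
      (q' := 0 + (s * N * (K + 2) + (0 + (N * (2 + s * (12 * t + 2)) + (0 + 0))))) ?_).mono hT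
      (by omega) fun _ _ _ h _ => h
  rintro R₁ A₁ ⟨h7, h8, h9, h10, h11, h12⟩ hS
  have hA1 : ∀ a j, A₁ a j = 0 := fun a j => by rw [hS.2 a rfl, hA]
  rw [← hS.1 0 rfl] at r0
  rw [r1, r2, ← hdd] at h11
  rw [r1, ← hN] at h12
  rw [← hN] at h10
  rw [← ht] at h9
  rw [← hK] at h7 h8
  rw [← hS.1 1 rfl] at r1
  rw [← hS.1 13 rfl] at r13
  rw [← hS.1 14 rfl] at r14
  clear hS
  refine Impl.seq (Impl.split hW hfuel hB.r r0 h7 fun j => hA1 0 j) ?_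
  intro blk R₂ A₂ hblk hS
  have hC : Ctx s N K t blk R₂ A₂ :=
    ⟨by rw [hS.1 0 rfl, r0], by rw [hS.1 1 rfl, r1], by rw [hS.1 7 rfl, h7],
      by rw [hS.1 8 rfl, h8], by rw [hS.1 9 rfl, h9], by rw [hS.1 10 rfl, h10], hblk⟩
  have hG : Growing s N (([], 0) : List (ℕ × (Fin n → Bool)) × ℕ) R₂ A₂ := by
    refine ⟨⟨by rw [hS.1 13 rfl, r13]; rfl, fun b => by rw [hS.2 1 rfl, hA1]; simp,
      fun i hi => absurd hi (Nat.not_lt_zero _), fun i hi => absurd hi (Nat.not_lt_zero _),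
      Nat.zero_le _⟩, by rw [hS.1 14 rfl, r14], Nat.zero_le _⟩
  rw [← hS.1 11 rfl] at h11
  rw [← hS.1 12 rfl] at h12
  rw [← hS.1 1 rfl] at r1
  have a14 : ∀ j, A₂ 14 j = 0 := fun j => by rw [hS.2 14 rfl, hA1]
  have a15 : ∀ j, A₂ 15 j = 0 := fun j => by rw [hS.2 15 rfl, hA1]
  clear hS
  refine Impl.seq (Impl.for_ hW1 hfuel _ (fun _ a R A => Growing s N a R A) h12 rfl hG
    (fun j a R' A' v w h => ⟨⟨h.1.cnt, h.1.inx, h.1.num, h.1.wit, h.1.le⟩, h.2⟩)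
    (fun j a R' A' _ _ hS h => Impl.growCmd hW hfuel hB (hC.same hS) h)) ?_
  rintro ⟨L, run⟩ R₃ A₃ ⟨hL, h14, hrun⟩ hS
  have hL : Blocks s L R₃ A₃ := hL
  have h14 : R₃ 14 = run := h14
  replace hC := hC.same hS
  rw [← hS.1 11 rfl] at h11
  rw [← hS.1 1 rfl] at r1
  rw [← hS.2 14 rfl] at a14
  rw [← hS.2 15 rfl] at a15
  clear hS h12
  have hk := hL.le
  have hgeo := geo_le_geo hk (dd + 1)
  have hkM : (geo L.length (dd + 1) + 1) * (2 * s + 2) ≤ W :=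
    le_trans (Nat.mul_le_mul_right _ (by omega)) hM
  have h1g := one_le_geo L.length dd
  have hg1 : 2 * geo L.length (dd + 1) ≤ W := le_trans (by nlinarith) hkM
  have hg2 : 2 * L.length ≤ W := le_trans (by nlinarith) hkM
  refine Impl.pure_seq (b := ()) (Impl.sizeCmd hW hfuel (by omega) hg2 hL.cnt h11) ?_
  rintro R₄ A₄ ⟨hP, h15⟩ hS
  replace hC := hC.same hS
  replace hL := hL.same hS
  rw [← hS.1 14 rfl] at h14
  rw [← hS.1 1 rfl] at r1
  rw [← hS.2 14 rfl] at a14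
  rw [← hS.2 15 rfl] at a15
  clear hS h11
  have h0 : Testing f K (geo L.length (dd + 1)) blk L
      ((true, []) : Bool × List ((Fin n → Bool) × (ℕ → Bool))) R₄ A₄ :=
    ⟨h15, hP.root, fun b p _ => by rw [a14]; rfl⟩
  refine Impl.seq_pure (Impl.for_ hW1 hfuel (testStep f D blk L t) (T := 60 * (n + 1) +
    (s * ((t + 1) * (1104 * (n + 1))) + 3) + 90 * geo s (dd + 1)) (q := 2 + s * (12 * t + 2))
    (fun _ a R A => Testing f K (geo L.length (dd + 1)) blk L a R A) hC.rN rfl h0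
    (fun j a R' A' v w h => h)
    (fun j a R' A' _ _ hS h => (Impl.testCmd j hW hfuel hB hg1 h1g
      (fun h => by rw [h]; simp [geo]) (hC.same hS) (hL.same hS)
      (Paths.mk (by rw [hS.1 17 rfl, hP.r17]) (by rw [hS.1 18 rfl, hP.r18])
        (by rw [hS.1 19 rfl, hP.r19]) h.2.1) h).mono
        (by gcongr) (by gcongr) fun _ _ _ h _ => h)) ?_
  rintro ⟨g, S⟩ R₅ A₅ ⟨g15, hroot, hTab⟩ hS
  replace hC := hC.same hS
  replace hL := hL.same hS
  rw [← hS.1 14 rfl] at h14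
  rw [← hS.2 15 rfl] at a15
  have hP' : Paths L.length (geo L.length (dd + 1)) R₅ A₅ := Paths.mk
    (by rw [hS.1 17 rfl, hP.r17]) (by rw [hS.1 18 rfl, hP.r18])
        (by rw [hS.1 19 rfl, hP.r19]) hroot
  clear hS hP h15 r1 a14
  refine Impl.pure_seq (b := ()) ((Impl.credCmd hW hfuel hk hkM hC.rs hL.cnt hP' hTab a15).mono
    (by gcongr) le_rfl fun _ _ _ h _ => h) ?_
  intro R₆ A₆ hc hS
  rw [← hS.1 14 rfl] at h14
  rw [← hS.1 15 rfl] at g15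
  replace hC := hC.same hS
  have hb : ∀ a : Bool, a.toNat ≤ 1 := Bool.toNat_le
  have hcs := cred_le L.length s
    (seen L.length (fun x => f (cutPt blk L (2 ^ K) x)) S) (dd + 1) 0
  have hsW : s ≤ W := le_trans (by nlinarith) hM
  refine Impl.code hW1 30 ?_ ?_
  · intro _ _
    simp only [oks, Stmt.ok, Exp.ok_mul, Exp.ok_reg, Exp.ok_le, Exp.ok_lit, Exp.ok_get,
      Exp.eval_mul, Exp.eval_reg, Exp.eval_le, Exp.eval_lit, Exp.eval_get, g15, h14, hC.rN, hc,
      bit_le N, bit_and, true_and, and_true, hW1, Nat.zero_le]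
    exact ⟨(hb _).trans hW1, (Nat.mul_le_mul_right _ (hb _)).trans (by rw [one_mul]; exact hcs.trans hsW)⟩
  · simp only [runs, Stmt.runReg, Exp.eval_mul, Exp.eval_reg, Exp.eval_le, Exp.eval_lit,
      Exp.eval_get, g15, h14, hC.rN, hc, bit_le N, bit_and, Function.update_self, verdict]
    rw [mul_ne_zero_iff, ← Nat.pos_iff_ne_zero (n := cred _ _ _ _ _), ← and_assoc]
    refine and_congr_left fun _ => ?_
    cases g <;> simp

end Verify
end DTTest

namespace DTTest

open scoped ENNReal

/-! ### Random processes -/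

section Iter
variable {α : Type*} {step : ℕ → α → PMF α}

/-- An invariant of a random process. -/
theorem iter_support {I : ℕ → α → Prop}
    (h : ∀ i a, I i a → ∀ b ∈ (step i a).support, I (i + 1) b) (k : ℕ) :
    ∀ i a, I i a → ∀ b ∈ (iter step i k a).support, I (i + k) b := by
  induction k with
  | zero =>
    intro i a ha b hb
    rw [iter, PMF.mem_support_pure_iff] at hb
    rwa [hb]
  | succ k ih =>
    intro i a ha b hb
    rw [iter, PMF.mem_support_bind_iff] at hb
    obtain ⟨c, hc, hb⟩ := hb
    have := ih (i + 1) c (h i a ha c hc) b hb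
    rwa [show i + (k + 1) = i + 1 + k by omega]

/-- A potential that does not increase in expectation. -/
theorem Ex_iter_le {Ψ : ℕ → α → ℝ≥0∞} (h : ∀ i a, Ex (step i a) (Ψ (i + 1)) ≤ Ψ i a) (k : ℕ) :
    ∀ i a, Ex (iter step i k a) (Ψ (i + k)) ≤ Ψ i a := by
  induction k with
  | zero => intro i a; rw [iter, Ex_pure]; rfl
  | succ k ih =>
    intro i a
    rw [iter, Ex_bind]
    refine le_trans (Ex_mono fun b => ?_) (h i a)
    rw [show i + (k + 1) = i + 1 + k by omega]
    exact ih (i + 1) b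

/-- A quantity that does not increase in expectation, and that is small after one of the steps, is
small in the end. -/
theorem Ex_iter_le_of_step {G : α → ℝ≥0∞} {c : ℝ≥0∞} (h : ∀ i a, Ex (step i a) G ≤ G a) {k i₀ : ℕ}
    (hi : i₀ < k) (hc : ∀ a, Ex (step i₀ a) G ≤ c) (a : α) : Ex (iter step 0 k a) G ≤ c := by
  -- The potential is the constant `c` up to time `i₀` and `G` afterwards; step `i₀` is where one
  -- passes into the other.
  have := Ex_iter_le (step := step) (Ψ := fun i a => if i ≤ i₀ then c else G a) ?_ k 0 a
  · simpa [not_le.2 hi] using this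
  · intro i a
    by_cases h1 : i + 1 ≤ i₀
    · simp [h1, show i ≤ i₀ by omega, Ex_const]
    · by_cases h2 : i ≤ i₀
      · obtain rfl : i = i₀ := by omega
        simpa using hc a
      · simpa [h1, h2] using h i a

/-- A quantity that increases by at most `c` per step. -/
theorem Ex_iter_le_add {G : ℕ → α → ℝ≥0∞} {c : ℝ≥0∞}
    (h : ∀ i a, Ex (step i a) (G (i + 1)) ≤ G i a + c)
    (k : ℕ) : ∀ i a, Ex (iter step i k a) (G (i + k)) ≤ G i a + k * c := by
  induction k with
  | zero => intro i a; rw [iter, Ex_pure]; simp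
  | succ k ih =>
    intro i a
    rw [iter, Ex_bind]
    refine le_trans (Ex_mono (G := fun b => G (i + 1) b + k * c) fun b => ?_) ?_
    · rw [show i + (k + 1) = i + 1 + k by omega]
      exact ih (i + 1) b
    · rw [Ex_add, Ex_const]
      refine le_trans (add_le_add_left (h i a) _) (le_of_eq ?_)
      push_cast; ring

/-- A quantity that is multiplied by at most `ρ` in each step. -/
theorem Ex_iter_le_pow {G : α → ℝ≥0∞} {ρ : ℝ≥0∞} (h : ∀ i a, Ex (step i a) G ≤ ρ * G a)
    (k : ℕ) : ∀ i a, Ex (iter step i k a) G ≤ ρ ^ k * G a := by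
  induction k with
  | zero => intro i a; rw [iter, Ex_pure]; simp
  | succ k ih =>
    intro i a
    rw [iter, Ex_bind]
    refine le_trans (Ex_mono fun b => ih (i + 1) b) ?_
    rw [Ex_mul_left, pow_succ, mul_assoc]
    gcongr
    exact h i a

end Iter

theorem Ex_ind_not_le {α : Type*} {p : PMF α} {P : α → Prop} {η : ℝ≥0∞}
    (h : η ≤ Ex p fun a => ind (P a)) : (Ex p fun a => ind (¬ P a)) ≤ 1 - η := by
  have h1 := Ex_ind_add_not p P
  have hη : η ≠ ⊤ := ne_top_of_le_ne_top (Ex_ne_top_of_le_one fun a => ind_le_one _) h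
  refine ENNReal.le_sub_of_add_le_right hη ?_
  rw [← h1, add_comm]
  gcongr

theorem exists_lt_of_Ex_lt {α : Type*} {p : PMF α} {F : α → ℝ≥0∞} {c : ℝ≥0∞} (h : Ex p F < c) :
    ∃ a, F a < c := by
  by_contra hn
  push Not at hn
  have := Ex_mono (p := p) (F := fun _ => c) hn
  rw [Ex_const] at this
  exact absurd h (not_lt.2 this)

theorem exists_le_of_Ex_le {α : Type*} {p : PMF α} {F : α → ℝ≥0∞} {c : ℝ≥0∞} [Finite α] (h : Ex p F ≤ c) : ∃ a, F a ≤ c := by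
  by_contra hn
  push Not at hn
  have : Nonempty α := ⟨p.support_nonempty.some⟩
  obtain ⟨a, ha⟩ := Finite.exists_min F
  have := Ex_mono (p := p) (F := fun _ => F a) ha
  rw [Ex_const] at this
  exact absurd (hn a) (not_lt.2 (this.trans h))

/-- By Bernoulli's inequality `(1 + 1/m) ^ m ≥ 2`, while `(1 - 1/m) (1 + 1/m) ≤ 1`. -/
theorem half_pow {m : ℕ} (hm : 1 ≤ m) : (1 - (m : ℝ≥0∞)⁻¹) ^ m ≤ 2⁻¹ := by
  have hm0 : (m : ℝ≥0∞) ≠ 0 := by simp; omega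
  have hmt : (m : ℝ≥0∞) ≠ ⊤ := ENNReal.natCast_ne_top m
  set η := (m : ℝ≥0∞)⁻¹ with hη
  have h1 : (1 - η) * (1 + η) ≤ 1 := by
    rcases le_total 1 η with h | h
    · rw [tsub_eq_zero_of_le h]; simp
    · calc (1 - η) * (1 + η) = (1 - η) + (1 - η) * η := by ring
        _ ≤ (1 - η) + 1 * η := by gcongr; exact tsub_le_self
        _ = 1 := by rw [one_mul, tsub_add_cancel_of_le h]
  have h2 : 2 ≤ (1 + η) ^ m := by
    have : ∀ k : ℕ, 1 + k * η ≤ (1 + η) ^ k := by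
      intro k
      induction k with
      | zero => simp
      | succ k ih =>
        rw [pow_succ]
        calc 1 + ((k + 1 : ℕ) : ℝ≥0∞) * η = (1 + k * η) + 1 * η := by push_cast; ring
          _ ≤ (1 + η) ^ k + (1 + η) ^ k * η := by
            gcongr
            exact one_le_pow₀ (by simp)
          _ = _ := by ring
    have := this m
    rw [hη, ENNReal.mul_inv_cancel hm0 hmt] at this
    rw [hη]
    refine le_trans (le_of_eq ?_) this
    norm_num
  rw [ENNReal.le_inv_iff_mul_le]
  calc (1 - η) ^ m * 2 ≤ (1 - η) ^ m * (1 + η) ^ m := by gcongr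
    _ = ((1 - η) * (1 + η)) ^ m := by rw [mul_pow]
    _ ≤ 1 := pow_le_one₀ (by simp) h1

/-! ### The search for blocks: soundness -/

section Grow
variable {n : ℕ} {f : (Fin n → Bool) → Bool} {D : PMF (Fin n → Bool)} {s N K : ℕ}
  {blk : Fin n → ℕ}

theorem grow_length_le (a : List (ℕ × (Fin n → Bool)) × ℕ) (x : Fin n → Bool)
    (h : a.1.length ≤ s) : (grow f s N K blk a x).1.length ≤ s := by
  unfold grow
  split_ifs with h1 h2
  · simp; omega
  · exact h
  · exact h

/-- A supermartingale with `q = 1 - η`. Its first term bounds the chance that the current list, if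
bad, survives the rest of its run of `N` agreements; the second reserves `q ^ N` for each block that
may still be found and start a new run. -/
theorem Ex_grow_bad_le {η : ℝ≥0∞} (a₀ : List (ℕ × (Fin n → Bool)) × ℕ) (k : ℕ) :
    (Ex (iter (fun _ a => D.bind fun x => PMF.pure (grow f s N K blk a x)) 0 k a₀) fun a =>
      ind (N ≤ a.2 ∧ η < Ex D fun x => ind (f (cutPt blk a.1 (2 ^ K) x) ≠ f x))) ≤
    (1 - η) ^ (N - a₀.2) + ((s - a₀.1.length : ℕ) : ℝ≥0∞) * (1 - η) ^ N := by
  set bad : List (ℕ × (Fin n → Bool)) → Prop := fun L =>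
    η < Ex D fun x => ind (f (cutPt blk L (2 ^ K) x) ≠ f x) with hbad
  set q : ℝ≥0∞ := 1 - η with hq
  have hq1 : q ≤ 1 := tsub_le_self
  have key := Ex_iter_le (step := fun _ a => D.bind fun x => PMF.pure (grow f s N K blk a x))
    (Ψ := fun _ a => q ^ (N - a.2) * ind (bad a.1) + ((s - a.1.length : ℕ) : ℝ≥0∞) * q ^ N) ?_ k 0 a₀
  · refine le_trans (Ex_mono fun a => ?_) (key.trans ?_)
    · refine ind_le fun h => ?_
      rw [ind_of (show bad a.1 from h.2), Nat.sub_eq_zero_of_le h.1, pow_zero, one_mul]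
      exact le_self_add
    · gcongr
      exact mul_le_of_le_one_right' (ind_le_one _)
  · rintro - ⟨L, run⟩
    rw [Ex_bind]
    simp only [Ex_pure]
    by_cases hact : run < N ∧ L.length < s
    · have hs : s - L.length = (s - (L.length + 1)) + 1 := by omega
      refine le_trans (Ex_mono (G := fun x => ind (¬ f (cutPt blk L (2 ^ K) x) ≠ f x) *
        (q ^ (N - run - 1) * ind (bad L)) + ((s - L.length : ℕ) : ℝ≥0∞) * q ^ N) fun x => ?_) ?_
      · unfold grow
        rw [if_pos hact]
        split_ifs with h
        -- A new block resets the run; the fresh term `q ^ N` is paid by the share that was reserved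
        -- for this block.
        · rw [ind_not (not_not_intro h), zero_mul, zero_add, hs]
          simp only [List.length_append, List.length_singleton, Nat.sub_zero]
          push_cast
          rw [add_mul, one_mul, add_comm]
          gcongr
          exact mul_le_of_le_one_right' (ind_le_one _)
        · rw [ind_of h, one_mul, Nat.sub_sub]
      · rw [Ex_add, Ex_const, Ex_mul_right]
        refine add_le_add ?_ le_rfl
        by_cases hb : bad L
        · rw [ind_of hb, mul_one, mul_one]
          refine le_trans (mul_le_mul_left ?_ _)
            (le_of_eq (by rw [← pow_succ', show N - run - 1 + 1 = N - run by omega]))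
          exact Ex_ind_not_le (le_of_lt hb)
        · rw [ind_not hb]; simp
    · refine le_trans (Ex_mono (G := fun _ => q ^ (N - run) * ind (bad L) +
        ((s - L.length : ℕ) : ℝ≥0∞) * q ^ N) fun x => ?_) (by rw [Ex_const])
      unfold grow
      rw [if_neg hact]

end Grow
end DTTest

namespace DTTest

open scoped ENNReal

/-! ### The test of literals -/

section Literal
variable {n : ℕ}

/-- The sum of two points of the cube. -/
def addv (b z : Fin n → Bool) : Fin n → Bool := fun j => xor (b j) (z j)

/-- The estimate at `z` of the linear part of `h`, with the random point `b`. -/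
def lit (h : (Fin n → Bool) → Bool) (z b : Fin n → Bool) : Bool := xor (h b) (h (addv b z))

/-- A unit vector. -/
def unitv (i : Fin n) : Fin n → Bool := fun j => decide (j = i)

theorem addv_comm (b z : Fin n → Bool) : addv b z = addv z b := by
  funext j; exact Bool.xor_comm _ _

theorem addv_assoc (a b c : Fin n → Bool) : addv (addv a b) c = addv a (addv b c) := by
  funext j; exact Bool.xor_assoc _ _ _

theorem addv_self (a : Fin n → Bool) : addv a a = fun _ => false := by
  funext j; exact Bool.xor_self _

theorem Ex_cube_addv (z : Fin n → Bool) (F : (Fin n → Bool) → ℝ≥0∞) :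
    Ex (cube n) (fun b => F (addv b z)) = Ex (cube n) F := Ex_cube_xor z F

section Additive
variable {y : (Fin n → Bool) → Bool} (hadd : ∀ u v, y (addv u v) = xor (y u) (y v))
include hadd

theorem additive_zero : y (fun _ => false) = false := by
  have := hadd (fun _ => false) (fun _ => false)
  rw [addv_self] at this
  rw [this, Bool.xor_self]

theorem additive_eq_false (S : Finset (Fin n)) (hS : ∀ j ∈ S, y (unitv j) = false)
    (z : Fin n → Bool) : y (fun j => z j && decide (j ∈ S)) = false := by
  classical
  induction S using Finset.induction_on with
  | empty => simpa using additive_zero hadd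
  | insert a S ha ih =>
    have e : (fun j => z j && decide (j ∈ insert a S)) =
        addv (fun j => z j && decide (j ∈ S)) (fun j => z a && unitv a j) := by
      funext j
      by_cases hj : j = a
      · subst hj; simp [addv, unitv, ha]
      · simp [addv, unitv, hj]
    rw [e, hadd, ih fun j hj => hS j (Finset.mem_insert_of_mem hj), Bool.false_xor]
    cases z a
    · simpa using additive_zero hadd
    · simpa using hS a (Finset.mem_insert_self a S)

/-- An additive function that is approximately multiplicative is a coordinate. -/
theorem exists_coordinate {c : ℝ≥0∞} (h1 : y (fun _ => true) = true) (hc : 4 * c < 1)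
    (hm : (Ex (cube n) fun u => Ex (cube n) fun v =>
      ind (y (fun j => u j && v j) ≠ (y u && y v))) ≤ c) :
    ∃ τ : Fin n, ∀ z, y z = z τ := by
  classical
  have hex : ∃ i, y (unitv i) = true := by
    by_contra hn
    push Not at hn
    have := additive_eq_false hadd Finset.univ (fun j _ => by simpa using hn j) fun _ => true
    simp [h1] at this
  obtain ⟨i, hi⟩ := hex
  -- Suppose that `y` is `1` at two unit vectors `e_i`, `e_j`. Over the four pairs from `u`, `u +
  -- e_i` and `v`, `v + e_j`, the values of `y` at the meets add up to `y (e_i ∧ e_j) = 0`, but the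
  -- products of the values add up to `1`. So one of four uniformly distributed pairs violates
  -- multiplicativity, whose failure probability would be at least `1/4`.
  have huniq : ∀ j, j ≠ i → y (unitv j) = false := by
    intro j hji
    by_contra hj
    rw [Bool.not_eq_false] at hj
    have e0 : ∀ u : Fin n → Bool, y (addv u (unitv i)) = !y u := fun u => by
      rw [hadd, hi, Bool.xor_true]
    have e1 : ∀ u : Fin n → Bool, y (addv u (unitv j)) = !y u := fun u => by
      rw [hadd, hj, Bool.xor_true]
    have e2 : ∀ u v : Fin n → Bool, y (fun k => addv u (unitv i) k && v k) =
        xor (y fun k => u k && v k) (y fun k => unitv i k && v k) := fun u v => by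
      rw [← hadd]; congr 1; funext k
      exact Bool.and_xor_distrib_right _ _ _
    have e3 : ∀ u v : Fin n → Bool, y (fun k => u k && addv v (unitv j) k) =
        xor (y fun k => u k && v k) (y fun k => u k && unitv j k) := fun u v => by
      rw [← hadd]; congr 1; funext k
      exact Bool.and_xor_distrib_left _ _ _
    have e4 : y (fun k => unitv i k && unitv j k) = false := by
      have : (fun k => unitv i k && unitv j k) = fun _ => false := by
        funext k
        by_cases hk : k = i
        · subst hk; simp [unitv, Ne.symm hji]
        · simp [unitv, hk]
      rw [this, additive_zero hadd]
    set P : (Fin n → Bool) → (Fin n → Bool) → ℝ≥0∞ := fun u v =>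
      ind (y (fun j => u j && v j) ≠ (y u && y v)) with hP
    have hle : ∀ u v, 1 ≤ (P u v + P (addv u (unitv i)) v) +
        (P u (addv v (unitv j)) + P (addv u (unitv i)) (addv v (unitv j))) := by
      intro u v
      by_contra hlt
      rw [not_le] at hlt
      have hn : ∀ {Q : Prop}, ind Q < 1 → ¬ Q := fun hQ hq => by
        rw [ind_of hq] at hQ; exact lt_irrefl _ hQ
      have a1 := hn (((le_self_add.trans le_self_add).trans_lt hlt) : P u v < 1)
      have a2 := hn (((le_add_self.trans le_self_add).trans_lt hlt) :
        P (addv u (unitv i)) v < 1)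
      have a3 := hn (((le_self_add.trans le_add_self).trans_lt hlt) :
        P u (addv v (unitv j)) < 1)
      have a4 := hn (((le_add_self.trans le_add_self).trans_lt hlt) :
        P (addv u (unitv i)) (addv v (unitv j)) < 1)
      simp only [e0, e1, e2, e3, e4] at a1 a2 a3 a4
      generalize y u = b1 at *
      generalize y v = b2 at *
      generalize y (fun j => u j && v j) = b3 at *
      generalize y (fun k => unitv i k && v k) = b4 at *
      generalize y (fun k => u k && unitv j k) = b5 at *
      revert a1 a2 a3 a4
      cases b1 <;> cases b2 <;> cases b3 <;> cases b4 <;> cases b5 <;> simp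
    have h4 : (1 : ℝ≥0∞) ≤ Ex (cube n) fun u => Ex (cube n) fun v =>
        (P u v + P (addv u (unitv i)) v) +
        (P u (addv v (unitv j)) + P (addv u (unitv i)) (addv v (unitv j))) := by
      refine le_trans (by rw [Ex_const]) (Ex_mono (F := fun _ => 1) fun u => ?_)
      refine le_trans (by rw [Ex_const]) (Ex_mono (F := fun _ => 1) fun v => hle u v)
    simp only [Ex_add] at h4
    rw [Ex_cube_addv (unitv i) (fun u => Ex (cube n) fun v => P u v),
      Ex_cube_addv (unitv i) (fun u => Ex (cube n) fun v => P u (addv v (unitv j)))] at h4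
    have h5 : ∀ u, (Ex (cube n) fun v => P u (addv v (unitv j))) = Ex (cube n) fun v => P u v :=
      fun u => Ex_cube_addv (unitv j) fun v => P u v
    simp only [h5] at h4
    refine absurd (h4.trans (add_le_add (add_le_add hm hm) (add_le_add hm hm))) (not_le.2 ?_)
    rwa [show c + c + (c + c) = 4 * c by ring]
  refine ⟨i, fun z => ?_⟩
  have e : z = addv (fun j => z j && decide (j ∈ Finset.univ.erase i))
      (fun j => z i && unitv i j) := by
    funext j
    by_cases hj : j = i
    · subst hj; simp [addv, unitv]
    · simp [addv, unitv, hj]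
  conv_lhs => rw [e]
  rw [hadd, additive_eq_false hadd _ (fun j hj => huniq j (Finset.ne_of_mem_erase hj)),
    Bool.false_xor]
  cases z i
  · simpa using additive_zero hadd
  · simpa using hi

end Additive

theorem of_ind_lt {Q : Prop} (h : ind Q < 1) : ¬ Q := fun hq => by
  rw [ind_of hq] at h; exact lt_irrefl _ h

/-- Both sides are the sum of `h` over the corners `b`, `b + z`, `b + u`, `b + u + z`, which is
symmetric in `z` and `u`. -/
theorem lit_swap (h : (Fin n → Bool) → Bool) (z u b : Fin n → Bool) :
    xor (lit h z b) (lit h z (addv u b)) = xor (lit h u b) (lit h u (addv b z)) := by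
  unfold lit
  rw [addv_comm u b, addv_assoc, addv_assoc, addv_comm u z]
  cases h b <;> cases h (addv b z) <;> cases h (addv b u) <;> simp

/-- A telescoping sum along `b`, `b + u`, `b + u + v`; it holds for every `h`. -/
theorem lit_add (h : (Fin n → Bool) → Bool) (u v b : Fin n → Bool) :
    lit h (addv u v) b = xor (lit h u b) (lit h v (addv b u)) := by
  unfold lit
  rw [addv_assoc]
  cases h b <;> cases h (addv b u) <;> simp

/-- If the tests of literals pass with high probability, then the estimates are those of a
coordinate. -/
theorem exists_literal {h : (Fin n → Bool) → Bool} {δ : ℝ≥0∞} (hδ : 28 * δ < 1)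
    (h1 : (Ex (cube n) fun b => ind (lit h (fun _ => true) b ≠ true)) ≤ δ)
    (h2 : (Ex (cube n) fun u => Ex (cube n) fun b₁ => Ex (cube n) fun b₂ =>
      ind (lit h u b₁ ≠ lit h u b₂)) ≤ δ)
    (h3 : (Ex (cube n) fun u => Ex (cube n) fun v => Ex (cube n) fun b₁ => Ex (cube n) fun b₃ =>
      Ex (cube n) fun b₄ => ind (lit h (fun j => u j && v j) b₄ ≠ (lit h u b₁ && lit h v b₃))) ≤
        δ) :
    ∃ τ : Fin n, ∀ z, (Ex (cube n) fun b => ind (lit h z b ≠ z τ)) ≤ 2 * δ := by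
  have hlt : ∀ {k : ℝ≥0∞}, k ≤ 28 → k * δ < 1 := fun hk =>
    lt_of_le_of_lt (by gcongr) hδ
  -- Averaging fixes one good reference point `b'` in the consistency test.
  have s1 : ∃ b', (Ex (cube n) fun u => Ex (cube n) fun b₁ => ind (lit h u b₁ ≠ lit h u b')) ≤
      δ := by
    refine exists_le_of_Ex_le (p := cube n) (le_trans (le_of_eq ?_) h2)
    rw [Ex_comm]
    congr 1; funext u
    rw [Ex_comm]
  obtain ⟨b', hb'⟩ := s1
  -- Passage from random to arbitrary `z`. By `lit_swap`, the estimates at `z` with `b₁` and `u +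
  -- b₁` can differ only if an estimate at the random point `u`, with `b₁` or `b₁ + z`, differs from
  -- the one with `b'`. Both events have probability at most `δ`.
  have s2 : ∀ z, (Ex (cube n) fun b₂ => Ex (cube n) fun b₁ => ind (lit h z b₁ ≠ lit h z b₂)) ≤
      2 * δ := by
    intro z
    rw [Ex_comm]
    have : ∀ b₁, (Ex (cube n) fun b₂ => ind (lit h z b₁ ≠ lit h z b₂)) ≤
        Ex (cube n) fun u => ind (lit h u b₁ ≠ lit h u b') +
          ind (lit h u (addv b₁ z) ≠ lit h u b') := by
      intro b₁
      rw [← Ex_cube_addv b₁]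
      refine Ex_mono fun u => ?_
      refine ind_le fun hne => ?_
      have hs := lit_swap h z u b₁
      by_cases ha : lit h u b₁ ≠ lit h u b'
      · rw [ind_of ha]; exact le_self_add
      · rw [not_not] at ha
        have : lit h u (addv b₁ z) ≠ lit h u b' := by
          rw [← ha]
          intro hx
          rw [hx, Bool.xor_self] at hs
          exact hne (by simpa using hs)
        rw [ind_of this]; exact le_add_self
    refine le_trans (Ex_mono this) ?_
    simp only [Ex_add]
    rw [two_mul, Ex_comm, Ex_comm (cube n) (cube n) fun a b => ind (lit h b (addv a z) ≠ lit h b b')]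
    refine add_le_add hb' (le_trans (le_of_eq ?_) hb')
    congr 1; funext u
    exact Ex_cube_addv z fun b => ind (lit h u b ≠ lit h u b')
  have s3 : ∀ z, ∃ c : Bool, (Ex (cube n) fun b => ind (lit h z b ≠ c)) ≤ 2 * δ := fun z =>
    (exists_le_of_Ex_le (s2 z)).imp' _ fun b hb => hb
  choose y hy using s3
  -- Each of three estimates misses `y` with probability at most `2 * δ`. As `6 * δ < 1`, some `b`
  -- is good for all three, and `lit_add` makes additivity exact.
  have hadd : ∀ u v, y (addv u v) = xor (y u) (y v) := by
    intro u v
    have : (Ex (cube n) fun b => ind (lit h (addv u v) b ≠ y (addv u v)) +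
        (ind (lit h u b ≠ y u) + ind (lit h v (addv b u) ≠ y v))) < 1 := by
      simp only [Ex_add]
      rw [Ex_cube_addv u fun b => ind (lit h v b ≠ y v)]
      refine lt_of_le_of_lt (add_le_add (hy _) (add_le_add (hy u) (hy v))) ?_
      rw [show 2 * δ + (2 * δ + 2 * δ) = 6 * δ by ring]
      exact hlt (by norm_num)
    obtain ⟨b, hb⟩ := exists_lt_of_Ex_lt this
    have a1 := of_ind_lt (le_self_add.trans_lt hb)
    have a2 := of_ind_lt ((le_self_add.trans le_add_self).trans_lt hb)
    have a3 := of_ind_lt ((le_add_self.trans le_add_self).trans_lt hb)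
    rw [not_not] at a1 a2 a3
    rw [← a1, ← a2, ← a3, lit_add]
  have hone : y (fun _ => true) = true := by
    have : (Ex (cube n) fun b => ind (lit h (fun _ => true) b ≠ y (fun _ => true)) +
        ind (lit h (fun _ => true) b ≠ true)) < 1 := by
      rw [Ex_add]
      refine lt_of_le_of_lt (add_le_add (hy _) h1) ?_
      rw [show 2 * δ + δ = 3 * δ by ring]
      exact hlt (by norm_num)
    obtain ⟨b, hb⟩ := exists_lt_of_Ex_lt this
    have a1 := of_ind_lt (le_self_add.trans_lt hb)
    have a2 := of_ind_lt (le_add_self.trans_lt hb)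
    rw [not_not] at a1 a2
    rw [← a1, a2]
  -- The test itself contributes `δ` and each of its three estimates `2 * δ`. Since
  -- `exists_coordinate` needs `4 * (7 * δ) < 1`, this is the origin of the constant `28`.
  have hmul : (Ex (cube n) fun u => Ex (cube n) fun v =>
      ind (y (fun j => u j && v j) ≠ (y u && y v))) ≤ 7 * δ := by
    have : ∀ u v, ind (y (fun j => u j && v j) ≠ (y u && y v)) ≤
        (Ex (cube n) fun b₁ => Ex (cube n) fun b₃ => Ex (cube n) fun b₄ =>
          ind (lit h (fun j => u j && v j) b₄ ≠ (lit h u b₁ && lit h v b₃))) + 6 * δ := by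
      intro u v
      have e : ind (y (fun j => u j && v j) ≠ (y u && y v)) ≤
        Ex (cube n) fun b₁ => Ex (cube n) fun b₃ => Ex (cube n) fun b₄ =>
          (ind (lit h (fun j => u j && v j) b₄ ≠ (lit h u b₁ && lit h v b₃)) +
          (ind (lit h (fun j => u j && v j) b₄ ≠ y (fun j => u j && v j)) +
          (ind (lit h u b₁ ≠ y u) + ind (lit h v b₃ ≠ y v)))) := by
        conv_lhs => rw [← Ex_const (cube n) (ind _)]
        refine Ex_mono fun b₁ => ?_
        conv_lhs => rw [← Ex_const (cube n) (ind _)]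
        refine Ex_mono fun b₃ => ?_
        conv_lhs => rw [← Ex_const (cube n) (ind _)]
        refine Ex_mono fun b₄ => ?_
        refine ind_le fun hne => ?_
        by_contra hlt
        rw [not_le] at hlt
        have a1 := of_ind_lt (le_self_add.trans_lt hlt)
        have a2 := of_ind_lt ((le_self_add.trans le_add_self).trans_lt hlt)
        have a3 := of_ind_lt (((le_self_add.trans le_add_self).trans le_add_self).trans_lt hlt)
        have a4 := of_ind_lt (((le_add_self.trans le_add_self).trans le_add_self).trans_lt hlt)
        rw [not_not] at a1 a2 a3 a4
        rw [← a2, ← a3, ← a4] at hne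
        exact hne a1
      refine e.trans ?_
      simp only [Ex_add, Ex_const]
      refine add_le_add le_rfl (le_trans (add_le_add (hy _) (add_le_add (hy u) (hy v))) ?_)
      exact le_of_eq (by ring)
    refine le_trans (Ex_mono fun u => Ex_mono fun v => this u v) ?_
    simp only [Ex_add, Ex_const]
    refine le_trans (add_le_add h3 le_rfl) (le_of_eq (by ring))
  obtain ⟨τ, hτ⟩ := exists_coordinate hadd hone (c := 7 * δ)
    (by rw [← mul_assoc]; exact hlt (by norm_num)) hmul
  exact ⟨τ, fun z => by rw [← hτ z]; exact hy z⟩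

end Literal
end DTTest

namespace DTTest

open scoped ENNReal

/-! ### The test of the blocks: soundness -/

section Test
variable {n : ℕ} {f : (Fin n → Bool) → Bool} {D : PMF (Fin n → Bool)} {blk : Fin n → ℕ}
  {L : List (ℕ × (Fin n → Bool))} {t : ℕ}

theorem Ex_est (B : ℕ × (Fin n → Bool)) (z : Fin n → Bool) (F : Bool → ℝ≥0∞) :
    Ex (est f blk B z) F = Ex (cube n) fun b => F (lit (fun b => f (blend blk B.1 B.2 b)) z b) := by
  rw [est, Ex_bind]
  simp only [Ex_pure]
  rfl

/-- The flag is only ever conjoined with test results, so it cannot be raised again. -/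
theorem Ex_round_le (B : ℕ × (Fin n → Bool)) (x : Fin n → Bool) (y : Bool) (i : ℕ) (g : Bool) :
    Ex (round f blk B x y i g) (fun g => ind (g = true)) ≤ ind (g = true) := by
  simp only [round, Ex_bind, Ex_pure]
  repeat' refine Ex_le_of_le fun _ => ?_
  refine ind_mono ?_
  cases g <;> simp

theorem ind_add_ind_not (P : Prop) : ind P + ind (¬ P) = 1 := by
  by_cases h : P
  · rw [ind_of h, ind_not (not_not.2 h), add_zero]
  · rw [ind_of h, ind_not h, zero_add]

/-- Either every round of tests for a block fails with some probability, or there is a coordinate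
such that a round fails with high probability unless the value of the coordinate was read. -/
theorem round_dichotomy (B : ℕ × (Fin n → Bool)) :
    (∀ x y i g, Ex (round f blk B x y i g) (fun g => ind (g = true)) ≤
      (1 - ((32 : ℕ) : ℝ≥0∞)⁻¹) * ind (g = true)) ∨
    ∃ τ : Fin n, ∀ x y i g, y ≠ x τ → Ex (round f blk B x y i g) (fun g => ind (g = true)) ≤
      (2 * ((32 : ℕ) : ℝ≥0∞)⁻¹) * ind (g = true) := by
  -- The value `1/32` satisfies `28 * δ < 1` and makes `2 * δ = 1/16` a power of two.
  set δ := ((32 : ℕ) : ℝ≥0∞)⁻¹ with hδ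
  set h : (Fin n → Bool) → Bool := fun b => f (blend blk B.1 B.2 b) with hh
  have hδ28 : 28 * δ < 1 := by
    rw [hδ, ← ENNReal.div_eq_inv_mul.trans (mul_comm _ _), ENNReal.div_lt_iff (by simp) (by simp)]
    norm_num
  have hδt : δ ≠ ⊤ := by simp [hδ]
  have hfalse : ∀ {x y i} {c : ℝ≥0∞}, Ex (round f blk B x y i false) (fun g => ind (g = true)) ≤
      c * ind (false = true) := fun {x y i c} =>
    (Ex_round_le B x y i false).trans (by rw [ind_not (by simp)]; exact zero_le)
  have hsub : ∀ {X Y : ℝ≥0∞}, X + Y = 1 → ¬ X ≤ δ → Y ≤ 1 - δ := fun {X Y} he hn => by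
    refine ENNReal.le_sub_of_add_le_right hδt ?_
    rw [← he, add_comm]
    exact add_le_add (le_of_lt (not_le.1 hn)) le_rfl
  by_cases h1 : (Ex (cube n) fun b => ind (lit h (fun _ => true) b ≠ true)) ≤ δ
  swap
  · left
    rintro x y i (_ | _)
    · exact hfalse
    rw [ind_of rfl, mul_one]
    refine le_trans ?_ (hsub (Ex_ind_add_not _ _) h1)
    simp only [round, Ex_bind, Ex_pure, Ex_est]
    refine Ex_le_of_le fun b₀ => Ex_le_of_le fun u => Ex_le_of_le fun v => Ex_mono fun o =>
      Ex_le_of_le fun e₁ => Ex_le_of_le fun e₂ => Ex_le_of_le fun e₃ => Ex_le_of_le fun e₄ =>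
      ind_mono fun hp => ?_
    simp only [Bool.and_eq_true] at hp
    simpa using hp.1.1.2
  by_cases h2 : (Ex (cube n) fun u => Ex (cube n) fun b₁ => Ex (cube n) fun b₂ =>
      ind (lit h u b₁ ≠ lit h u b₂)) ≤ δ
  swap
  · left
    rintro x y i (_ | _)
    · exact hfalse
    rw [ind_of rfl, mul_one]
    refine le_trans ?_ (hsub (Y := Ex (cube n) fun u => Ex (cube n) fun b₁ => Ex (cube n) fun b₂ =>
      ind (¬ lit h u b₁ ≠ lit h u b₂)) ?_ h2)
    · simp only [round, Ex_bind, Ex_pure, Ex_est]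
      refine Ex_le_of_le fun b₀ => Ex_mono fun u => Ex_le_of_le fun v => Ex_le_of_le fun o =>
        Ex_mono fun e₁ => Ex_mono fun e₂ => Ex_le_of_le fun e₃ => Ex_le_of_le fun e₄ =>
        ind_mono fun hp => ?_
      simp only [Bool.and_eq_true] at hp
      simpa using hp.1.2
    · simp only [← Ex_add, ind_add_ind_not, Ex_const]
  by_cases h3 : (Ex (cube n) fun u => Ex (cube n) fun v => Ex (cube n) fun b₁ =>
      Ex (cube n) fun b₃ => Ex (cube n) fun b₄ =>
      ind (lit h (fun j => u j && v j) b₄ ≠ (lit h u b₁ && lit h v b₃))) ≤ δ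
  swap
  · left
    rintro x y i (_ | _)
    · exact hfalse
    rw [ind_of rfl, mul_one]
    refine le_trans ?_ (hsub (Y := Ex (cube n) fun u => Ex (cube n) fun v => Ex (cube n) fun b₁ =>
      Ex (cube n) fun b₃ => Ex (cube n) fun b₄ =>
      ind (¬ lit h (fun j => u j && v j) b₄ ≠ (lit h u b₁ && lit h v b₃))) ?_ h3)
    · simp only [round, Ex_bind, Ex_pure, Ex_est]
      refine Ex_le_of_le fun b₀ => Ex_mono fun u => Ex_mono fun v => Ex_le_of_le fun o =>
        Ex_mono fun e₁ => Ex_le_of_le fun e₂ => Ex_mono fun e₃ => Ex_mono fun e₄ =>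
        ind_mono fun hp => ?_
      simp only [Bool.and_eq_true] at hp
      simpa using hp.2
    · simp only [← Ex_add, ind_add_ind_not, Ex_const]
  -- A wrong value `y` survives a round only if the fresh estimate at `x` is wrong too, which has
  -- probability at most `2 * δ`.
  obtain ⟨τ, hτ⟩ := exists_literal hδ28 h1 h2 h3
  right
  refine ⟨τ, ?_⟩
  rintro x y i (_ | _) hy
  · exact hfalse
  rw [ind_of rfl, mul_one]
  refine le_trans ?_ (hτ x)
  simp only [round, Ex_bind, Ex_pure, Ex_est]
  refine Ex_mono fun e => Ex_le_of_le fun u => Ex_le_of_le fun v => Ex_le_of_le fun o =>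
    Ex_le_of_le fun e₁ => Ex_le_of_le fun e₂ => Ex_le_of_le fun e₃ => Ex_le_of_le fun e₄ =>
    ind_mono fun hp => ?_
  simp only [Bool.and_eq_true] at hp
  have : lit h x e = y := by simpa using hp.1.1.1.2
  rw [this]; exact hy

theorem Ex_iter_round_le (B : ℕ × (Fin n → Bool)) (x : Fin n → Bool) (y : Bool) (g : Bool) :
    Ex (iter (round f blk B x y) 0 t g) (fun g => ind (g = true)) ≤ ind (g = true) := by
  have := Ex_iter_le_pow (step := round f blk B x y) (G := fun g => ind (g = true)) (ρ := 1)
    (fun i a => by rw [one_mul]; exact Ex_round_le B x y i a) t 0 g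
  simpa using this

theorem Ex_reader (x : Fin n → Bool) (i : ℕ) (a : Bool × (ℕ → Bool))
    (F : Bool × (ℕ → Bool) → ℝ≥0∞) :
    Ex (reader f blk L t x i a) F = Ex (est f blk (L.getD i (0, fun _ => false)) x) fun y =>
      Ex (iter (round f blk (L.getD i (0, fun _ => false)) x y) 0 t a.1) fun g =>
        F (g, Function.update a.2 i y) := by
  simp only [reader, Ex_bind, Ex_pure]

theorem Ex_reader_le (x : Fin n → Bool) (i : ℕ) (a : Bool × (ℕ → Bool)) :
    Ex (reader f blk L t x i a) (fun a => ind (a.1 = true)) ≤ ind (a.1 = true) := by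
  rw [Ex_reader]
  exact Ex_le_of_le fun y => Ex_iter_round_le _ x y a.1

theorem Ex_testStep (i : ℕ) (a : Bool × List ((Fin n → Bool) × (ℕ → Bool)))
    (F : Bool × List ((Fin n → Bool) × (ℕ → Bool)) → ℝ≥0∞) :
    Ex (testStep f D blk L t i a) F = Ex D fun x =>
      Ex (iter (reader f blk L t x) 0 L.length (a.1, fun _ => false)) fun b =>
        F (b.1, (x, b.2) :: a.2) := by
  simp only [testStep, Ex_bind, Ex_pure]

/-- If the rounds of tests for some block fail with some probability, then the test fails with high
probability. -/
theorem Ex_test_le_of_block {N i₀ : ℕ} {ρ : ℝ≥0∞} (hN : 1 ≤ N) (hi : i₀ < L.length)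
    (hρ : ∀ x y i g, Ex (round f blk (L.getD i₀ (0, fun _ => false)) x y i g)
      (fun g => ind (g = true)) ≤ ρ * ind (g = true))
    (a : Bool × List ((Fin n → Bool) × (ℕ → Bool))) :
    Ex (iter (testStep f D blk L t) 0 N a) (fun b => ind (b.1 = true)) ≤ ρ ^ t := by
  -- The `t` rounds for block `i₀` at the very first example already give the bound; nothing else
  -- can raise the flag.
  refine Ex_iter_le_of_step (i₀ := 0) (fun i a => ?_) hN (fun a => ?_) a
  · rw [Ex_testStep]
    refine Ex_le_of_le fun x => ?_
    have := Ex_iter_le_pow (step := reader f blk L t x)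
      (G := fun a => ind (a.1 = true)) (ρ := 1)
      (fun i a => by rw [one_mul]; exact Ex_reader_le x i a) L.length 0 (a.1, fun _ => false)
    simpa using this
  · rw [Ex_testStep]
    refine Ex_le_of_le fun x => ?_
    refine Ex_iter_le_of_step (step := reader f blk L t x) (G := fun a => ind (a.1 = true))
      (fun i a => Ex_reader_le x i a) hi (fun a => ?_) (a.1, fun _ => false)
    rw [Ex_reader]
    refine Ex_le_of_le fun y => ?_
    refine (Ex_iter_le_pow (fun i g => hρ x y i g) t 0 a.1).trans ?_
    exact mul_le_of_le_one_right' (ind_le_one _)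

/-- Some literal has been read incorrectly. -/
def Misread {k : ℕ} (τ : Fin k → Fin n) (S : List ((Fin n → Bool) × (ℕ → Bool))) : Prop :=
  ∃ z ∈ S, ∃ i : Fin k, z.2 i ≠ z.1 (τ i)

/-- A union bound over all readings. A misreading alone may well be likely; the event in question
also requires that it survives its `t` rounds, whence the flag is part of it. -/
theorem Ex_test_misread_le {N : ℕ} {ρ : ℝ≥0∞} (τ : Fin L.length → Fin n)
    (hρ : ∀ (i₀ : Fin L.length) x y i g, y ≠ x (τ i₀) →
      Ex (round f blk (L.getD i₀ (0, fun _ => false)) x y i g)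
      (fun g => ind (g = true)) ≤ ρ * ind (g = true)) :
    Ex (iter (testStep f D blk L t) 0 N (true, [])) (fun b => ind (b.1 = true ∧ Misread τ b.2)) ≤
      N * (L.length * ρ ^ t) := by
  have key := Ex_iter_le_add (step := testStep f D blk L t)
    (G := fun _ b => ind (b.1 = true ∧ Misread τ b.2)) (c := L.length * ρ ^ t) ?_ N 0 (true, [])
  · refine key.trans ?_
    rw [ind_not (by simp [Misread]), zero_add]
  · rintro - ⟨g, S⟩
    rw [Ex_testStep]
    refine Ex_le_of_le fun x => ?_
    have key2 := Ex_iter_le_add (step := reader f blk L t x)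
      (G := fun j b => ind (b.1 = true ∧ (Misread τ S ∨
        ∃ i : Fin L.length, i.val < j ∧ b.2 i ≠ x (τ i)))) (c := ρ ^ t) ?_ L.length 0
      (g, fun _ => false)
    · refine le_trans (Ex_mono fun b => ?_) (key2.trans ?_)
      · refine ind_mono ?_
        rintro ⟨h1, z, hz, i, hi⟩
        refine ⟨h1, ?_⟩
        rcases List.mem_cons.1 hz with rfl | hz
        · exact Or.inr ⟨i, by omega, hi⟩
        · exact Or.inl ⟨z, hz, i, hi⟩
      · refine add_le_add (ind_mono ?_) le_rfl
        rintro ⟨h1, h2 | ⟨i, hi, -⟩⟩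
        · exact ⟨h1, h2⟩
        · exact absurd hi (Nat.not_lt_zero _)
    · rintro j ⟨g', y⟩
      rw [Ex_reader]
      refine Ex_le_of_le fun e => ?_
      by_cases he : ∃ i : Fin L.length, i.val = j ∧ e ≠ x (τ i)
      · obtain ⟨i, rfl, hne⟩ := he
        refine le_trans (Ex_mono (G := fun g => ind (g = true)) fun g => ind_mono And.left) ?_
        refine (Ex_iter_le_pow (fun k g => hρ i x e k g hne) t 0 g').trans ?_
        exact (mul_le_of_le_one_right' (ind_le_one _)).trans le_add_self
      · refine le_trans ?_ le_self_add
        have himp : (Misread τ S ∨ ∃ i : Fin L.length, i.val < j + 1 ∧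
            Function.update y j e i ≠ x (τ i)) →
            (Misread τ S ∨ ∃ i : Fin L.length, i.val < j ∧ y i ≠ x (τ i)) := by
          rintro (h | ⟨i, hi, hne⟩)
          · exact Or.inl h
          · by_cases hij : i.val = j
            · rw [hij, Function.update_self] at hne
              exact absurd ⟨i, hij, hne⟩ he
            · rw [Function.update_of_ne hij] at hne
              exact Or.inr ⟨i, by omega, hne⟩
        by_cases hV : Misread τ S ∨ ∃ i : Fin L.length, i.val < j ∧ y i ≠ x (τ i)
        · refine le_trans (Ex_mono (G := fun g => ind (g = true)) fun g => ind_mono And.left) ?_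
          refine (Ex_iter_round_le _ x e g').trans (ind_mono fun h => ⟨h, hV⟩)
        · refine le_trans (Ex_le_of_le fun g => ?_) zero_le
          rw [ind_not]
          exact fun h => hV (himp h.2)

/-- A function that differs from the labels is refuted by the examples. -/
theorem Ex_test_consistent_le {N : ℕ} {η : ℝ≥0∞} {lab g : (Fin n → Bool) → Bool}
    (hg : η ≤ Ex D fun x => ind (lab x ≠ g x)) :
    Ex (iter (testStep f D blk L t) 0 N (true, [])) (fun b => ind (∀ z ∈ b.2, lab z.1 = g z.1)) ≤
      (1 - η) ^ N := by
  refine (Ex_iter_le_pow (ρ := 1 - η) (fun i a => ?_) N 0 _).trans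
    (mul_le_of_le_one_right' (ind_le_one _))
  rw [Ex_testStep]
  refine le_trans (Ex_mono (G := fun x => ind (¬ lab x ≠ g x) * ind (∀ z ∈ a.2, lab z.1 = g z.1))
    fun x => Ex_le_of_le fun b => ?_) ?_
  · refine ind_le fun h => ?_
    rw [ind_of (not_not.2 (h _ List.mem_cons_self)),
      ind_of fun z hz => h z (List.mem_cons_of_mem _ hz), one_mul]
  · rw [Ex_mul_right]
    exact mul_le_mul_left (Ex_ind_not_le hg) _

end Test
end DTTest

namespace DTTest

open scoped ENNReal

/-! ### Decision trees -/

namespace DecTree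
variable {k n : ℕ}

/-- Rename the variables of a decision tree. -/
def map (τ : Fin k → Fin n) : DecTree k → DecTree n
  | leaf b => leaf b
  | node i l r => node (τ i) (map τ l) (map τ r)

theorem map_eval (τ : Fin k → Fin n) (T : DecTree k) (x : Fin n → Bool) :
    (T.map τ).eval x = T.eval fun i => x (τ i) := by
  induction T with
  | leaf b => rfl
  | node i l r hl hr => simp only [map, eval, hl, hr]

theorem map_size (τ : Fin k → Fin n) (T : DecTree k) : (T.map τ).size = T.size := by
  induction T with
  | leaf b => rfl
  | node i l r hl hr => simp only [map, size, hl, hr]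

theorem map_depth (τ : Fin k → Fin n) (T : DecTree k) : (T.map τ).depth = T.depth := by
  induction T with
  | leaf b => rfl
  | node i l r hl hr => simp only [map, depth, hl, hr]

theorem one_le_size (T : DecTree n) : 1 ≤ T.size := by
  induction T with
  | leaf b => exact le_rfl
  | node i l r hl hr => simp only [size]; omega

/-- This permits replacing the depth bound `d` by `min d s`. -/
theorem depth_lt_size (T : DecTree n) : T.depth < T.size := by
  induction T with
  | leaf b => simp [depth, size]
  | node i l r hl hr =>
    simp only [depth, size]
    have := l.one_le_size
    have := r.one_le_size
    omega

/-- A prefix-free encoding of decision trees. -/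
def enc : DecTree k → List (Fin (k + 2))
  | leaf b => [if b then 1 else 0]
  | node i l r => ⟨i.val + 2, by omega⟩ :: (enc l ++ enc r)

/-- There is one letter per node, and a binary tree has one internal node less than leaves. -/
theorem length_enc (T : DecTree k) : T.enc.length + 1 = 2 * T.size := by
  induction T with
  | leaf b => rfl
  | node i l r hl hr => simp only [enc, size, List.length_cons, List.length_append]; omega

/-- Preorder is uniquely decodable because a letter tells a leaf from a node. The arbitrary
continuations drive the induction and make the padding in `code` harmless. -/
theorem enc_append_inj (T : DecTree k) : ∀ (T' : DecTree k) (u u' : List (Fin (k + 2))),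
    T.enc ++ u = T'.enc ++ u' → T = T' ∧ u = u' := by
  induction T with
  | leaf b =>
    rintro (b' | ⟨i, l, r⟩) u u' h
    · simp only [enc, List.singleton_append, List.cons.injEq] at h
      refine ⟨?_, h.2⟩
      have := h.1
      cases b <;> cases b' <;> simp at this ⊢
    · simp only [enc, List.singleton_append, List.cons_append, List.cons.injEq] at h
      have := congrArg Fin.val h.1
      cases b <;> simp at this
  | node i l r hl hr =>
    rintro (b' | ⟨i', l', r'⟩) u u' h
    · simp only [enc, List.singleton_append, List.cons_append, List.cons.injEq] at h
      have := congrArg Fin.val h.1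
      cases b' <;> simp at this
    · simp only [enc, List.cons_append, List.cons.injEq, List.append_assoc, Fin.mk.injEq] at h
      obtain ⟨rfl, h2⟩ := hl _ _ _ h.2
      obtain ⟨rfl, h3⟩ := hr _ _ _ h2
      refine ⟨?_, h3⟩
      congr 1
      exact Fin.ext (by omega)

/-- The encoding of a decision tree, padded to a fixed length. -/
def code (s : ℕ) (T : {T : DecTree k // T.size ≤ s}) : List.Vector (Fin (k + 2)) (2 * s) :=
  ⟨T.1.enc ++ List.replicate (2 * s - T.1.enc.length) 0, by
    have := T.1.length_enc
    have := T.2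
    simp only [List.length_append, List.length_replicate]; omega⟩

theorem code_injective (k s : ℕ) : Function.Injective (code (k := k) s) := by
  intro T T' h
  exact Subtype.ext (enc_append_inj _ _ _ _ (congrArg Subtype.val h)).1

instance finite_size_le (k s : ℕ) : Finite {T : DecTree k // T.size ≤ s} :=
  Finite.of_injective _ (code_injective k s)

theorem card_size_le (k s : ℕ) : Nat.card {T : DecTree k // T.size ≤ s} ≤ (k + 2) ^ (2 * s) := by
  refine (Nat.card_le_card_of_injective _ (code_injective k s)).trans (le_of_eq ?_)
  rw [Nat.card_eq_fintype_card, card_vector, Fintype.card_fin]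

end DecTree

/-! ### The search for a consistent tree -/

section Cred
variable {n k s : ℕ}

theorem reach_left {i : ℕ} (hi : i < k) (y : ℕ → Bool) (p : ℕ) :
    reach k y (p * (2 * k) + 2 * i + 1) = (reach k y p && !y i) := by
  have h1 : (p * (2 * k) + 2 * i) / (2 * k) = p := by
    rw [add_comm, Nat.add_mul_div_right _ _ (by omega), Nat.div_eq_of_lt (by omega), zero_add]
  have h2 : (p * (2 * k) + 2 * i) % (2 * k) = 2 * i := by
    rw [add_comm, Nat.add_mul_mod_self_right, Nat.mod_eq_of_lt (by omega)]
  rw [reach, h1, h2]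
  simp

theorem reach_right {i : ℕ} (hi : i < k) (y : ℕ → Bool) (p : ℕ) :
    reach k y (p * (2 * k) + 2 * i + 2) = (reach k y p && y i) := by
  have h1 : (p * (2 * k) + 2 * i + 1) / (2 * k) = p := by
    rw [add_assoc, add_comm, Nat.add_mul_div_right _ _ (by omega), Nat.div_eq_of_lt (by omega),
      zero_add]
  have h2 : (p * (2 * k) + 2 * i + 1) % (2 * k) = 2 * i + 1 := by
    rw [add_assoc, add_comm, Nat.add_mul_mod_self_right, Nat.mod_eq_of_lt (by omega)]
  rw [show p * (2 * k) + 2 * i + 2 = p * (2 * k) + 2 * i + 1 + 1 by ring, reach, h1, h2]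
  have h3 : (2 * i + 1) / 2 = i := by omega
  have h4 : (2 * i + 1) % 2 = 1 := by omega
  simp [h3, h4]

variable {lab : (Fin n → Bool) → Bool} {S : List ((Fin n → Bool) × (ℕ → Bool))}

theorem seen_eq_false {b : Bool} {p : ℕ} :
    seen k lab S b p = false ↔ ∀ z ∈ S, reach k z.2 p = true → lab z.1 = !b := by
  simp only [seen, List.any_eq_false, Bool.and_eq_true, not_and]
  refine forall₂_congr fun z _ => ?_
  cases lab z.1 <;> cases b <;> cases reach k z.2 p <;> simp

/-- A tree that is found below a node. -/
theorem exists_tree_of_cred (e : ℕ) : ∀ p, 0 < cred k s (seen k lab S) e p →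
    ∃ T : DecTree k, T.depth + 1 ≤ e ∧ T.size + cred k s (seen k lab S) e p ≤ s + 1 ∧
      ∀ z ∈ S, reach k z.2 p = true → lab z.1 = T.eval fun i => z.2 i := by
  induction e with
  | zero => intro p h; simp [cred] at h
  | succ e ih =>
    intro p h
    rcases le_total ((!(seen k lab S false p && seen k lab S true p)).toNat * s)
      ((Finset.range k).sup fun i => cred k s (seen k lab S) e (p * (2 * k) + 2 * i + 1) +
          cred k s (seen k lab S) e (p * (2 * k) + 2 * i + 2) - (s + 1)) with hc | hc
    · rw [cred, max_eq_right hc] at h ⊢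
      have hne : (Finset.range k).Nonempty := by
        by_contra hn
        rw [Finset.not_nonempty_iff_eq_empty.1 hn] at h
        simp at h
      obtain ⟨i, hi, hsup⟩ := Finset.exists_mem_eq_sup _ hne fun i =>
        cred k s (seen k lab S) e (p * (2 * k) + 2 * i + 1) +
          cred k s (seen k lab S) e (p * (2 * k) + 2 * i + 2) - (s + 1)
      rw [hsup] at h ⊢
      rw [Finset.mem_range] at hi
      have b1 := cred_le k s (seen k lab S) e (p * (2 * k) + 2 * i + 1)
      have b2 := cred_le k s (seen k lab S) e (p * (2 * k) + 2 * i + 2)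
      obtain ⟨l, hl1, hl2, hl3⟩ := ih (p * (2 * k) + 2 * i + 1) (by omega)
      obtain ⟨r, hr1, hr2, hr3⟩ := ih (p * (2 * k) + 2 * i + 2) (by omega)
      refine ⟨.node ⟨i, hi⟩ l r, by simp only [DecTree.depth]; omega,
        by simp only [DecTree.size]; omega, fun z hz hp => ?_⟩
      cases hy : z.2 i
      · have := hl3 z hz (by rw [reach_left hi, hp, hy]; rfl)
        rw [this, DecTree.eval, if_neg (by simp [hy])]
      · have := hr3 z hz (by rw [reach_right hi, hp, hy]; rfl)
        rw [this, DecTree.eval, if_pos (by simp [hy])]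
    · rw [cred, max_eq_left hc] at h ⊢
      have hb : ∃ b, seen k lab S (!b) p = false := by
        by_contra hn
        push Not at hn
        have h1 := hn true
        have h2 := hn false
        simp only [Bool.not_true, Bool.not_false, ne_eq, Bool.not_eq_false] at h1 h2
        rw [h1, h2] at h
        simp at h
      obtain ⟨b, hb⟩ := hb
      refine ⟨.leaf b, by simp only [DecTree.depth]; omega, ?_, fun z hz hp => ?_⟩
      · simp only [DecTree.size]
        have := Bool.toNat_le (!(seen k lab S false p && seen k lab S true p))
        nlinarith
      · rw [seen_eq_false.1 hb z hz hp, Bool.not_not]; rfl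

/-- A consistent tree is found. -/
theorem le_cred_of_tree (T : DecTree k) : ∀ e p, T.depth + 1 ≤ e →
    (∀ z ∈ S, reach k z.2 p = true → lab z.1 = T.eval fun i => z.2 i) →
    s + 1 ≤ T.size + cred k s (seen k lab S) e p := by
  induction T with
  | leaf b =>
    intro e p he h
    obtain ⟨e, rfl⟩ := Nat.exists_eq_succ_of_ne_zero (by omega : e ≠ 0)
    have hb : seen k lab S (!b) p = false := by
      rw [seen_eq_false]
      intro z hz hp
      rw [h z hz hp, Bool.not_not]; rfl
    have hm : (!(seen k lab S false p && seen k lab S true p)) = true := by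
      cases b <;> simp only [Bool.not_true, Bool.not_false] at hb <;> simp [hb]
    rw [Nat.succ_eq_add_one, cred, hm]
    have := le_max_left ((true.toNat * s)) ((Finset.range k).sup fun i =>
      cred k s (seen k lab S) e (p * (2 * k) + 2 * i + 1) +
          cred k s (seen k lab S) e (p * (2 * k) + 2 * i + 2) - (s + 1))
    simp only [Bool.toNat_true, one_mul] at this
    simp only [DecTree.size, Bool.toNat_true, one_mul]
    omega
  | node i l r hl hr =>
    intro e p he h
    obtain ⟨e, rfl⟩ := Nat.exists_eq_succ_of_ne_zero (by omega : e ≠ 0)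
    simp only [DecTree.depth] at he
    have h1 := hl e (p * (2 * k) + 2 * i + 1) (by omega) fun z hz hp => by
      rw [reach_left i.2, Bool.and_eq_true] at hp
      rw [h z hz hp.1, DecTree.eval, if_neg (by simpa using hp.2)]
    have h2 := hr e (p * (2 * k) + 2 * i + 2) (by omega) fun z hz hp => by
      rw [reach_right i.2, Bool.and_eq_true] at hp
      rw [h z hz hp.1, DecTree.eval, if_pos (by simpa using hp.2)]
    rw [Nat.succ_eq_add_one, cred]
    have h3 := Finset.le_sup (f := fun i : ℕ =>
      cred k s (seen k lab S) e (p * (2 * k) + 2 * i + 1) +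
          cred k s (seen k lab S) e (p * (2 * k) + 2 * i + 2) - (s + 1))
      (Finset.mem_range.2 i.2)
    have h4 := h3.trans (le_max_right
      ((!(seen k lab S false p && seen k lab S true p)).toNat * s) _)
    simp only [DecTree.size]
    omega

end Cred
end DTTest

namespace DTTest

open scoped ENNReal

/-! ### Soundness -/

/-- The form of all union bounds below: `A` events of probability `2^(-c)` each. -/
theorem mul_half_pow_le {A a b c : ℕ} (hA : A ≤ 2 ^ a) (h : a + b ≤ c) :
    (A : ℝ≥0∞) * 2⁻¹ ^ c ≤ 2⁻¹ ^ b := by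
  have h1 : (A : ℝ≥0∞) ≤ 2 ^ a := by exact_mod_cast hA
  obtain ⟨m, rfl⟩ := Nat.exists_eq_add_of_le h
  calc (A : ℝ≥0∞) * 2⁻¹ ^ (a + b + m) ≤ 2 ^ a * 2⁻¹ ^ (a + b + m) := by gcongr
    _ = (2 * 2⁻¹) ^ a * (2⁻¹ ^ b * 2⁻¹ ^ m) := by rw [mul_pow, pow_add, pow_add]; ring
    _ = 2⁻¹ ^ b * 2⁻¹ ^ m := by
      rw [ENNReal.mul_inv_cancel (by norm_num) (by norm_num), one_pow, one_mul]
    _ ≤ 2⁻¹ ^ b := mul_le_of_le_one_right' (pow_le_one₀ (by simp) (by simp))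

theorem half_pow_anti {a b : ℕ} (h : b ≤ a) : (2⁻¹ : ℝ≥0∞) ^ a ≤ 2⁻¹ ^ b :=
  pow_le_pow_of_le_one (by simp) (by simp) h

theorem half_pow_add (a : ℕ) : (2⁻¹ : ℝ≥0∞) ^ (a + 1) + 2⁻¹ ^ (a + 1) = 2⁻¹ ^ a := by
  rw [← two_mul, pow_succ, mul_comm _ (2⁻¹ : ℝ≥0∞), ← mul_assoc,
    ENNReal.mul_inv_cancel (by norm_num) (by norm_num), one_mul]

theorem half_sq_le : (2⁻¹ : ℝ≥0∞) ^ 2 ≤ 3⁻¹ := by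
  rw [← ENNReal.inv_pow, ENNReal.inv_le_inv]; norm_num

section Sound
variable {n : ℕ} {f : (Fin n → Bool) → Bool} {D : PMF (Fin n → Bool)} {s d Nv E l N K t dd : ℕ}
  {ε : ℝ}

/-- The outcome of the search is fixed. If `f` and its cut version are `η`-close, acceptance is
unlikely: either some block fails each round with probability at least `1/32`, and then the tests
detect it, or every block follows a coordinate, and then acceptance needs a misreading or a fitting
tree, with probability at most `1/16` each. -/
theorem Ex_test_verdict_le (hs : 1 ≤ s) (hNv : 1 ≤ Nv) (hE : E = s * Nv)
    (hl : l = Nat.log 2 E + 1) (hN : N = 16 * l * E) (ht : t = 100 * l) (hdd : dd ≤ d)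
    (hε : 2 * ((2 * Nv : ℕ) : ℝ≥0∞)⁻¹ ≤ ENNReal.ofReal ε) (hfar : Far D ε f (DT n d s))
    (blk : Fin n → ℕ) (a : List (ℕ × (Fin n → Bool)) × ℕ) (ha : a.1.length ≤ s) :
    (Ex (iter (testStep f D blk a.1 t) 0 N (true, [])) fun b =>
      ind (verdict f s N K dd blk a b)) ≤
    ind (N ≤ a.2 ∧ ((2 * Nv : ℕ) : ℝ≥0∞)⁻¹ <
      Ex D fun x => ind (f (cutPt blk a.1 (2 ^ K) x) ≠ f x)) + 2⁻¹ ^ 3 := by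
  obtain ⟨L, run⟩ := a
  replace ha : L.length ≤ s := ha
  set η := ((2 * Nv : ℕ) : ℝ≥0∞)⁻¹ with hη
  have hE1 : 1 ≤ E := by rw [hE]; exact Nat.mul_pos hs hNv
  have hl1 : 1 ≤ l := by omega
  have hN1 : 1 ≤ N := by rw [hN]; exact Nat.mul_pos (by omega) hE1
  have hEl : E < 2 ^ l := by rw [hl]; exact Nat.lt_pow_succ_log_self (by norm_num) E
  have hsE : s ≤ E := by rw [hE]; exact Nat.le_mul_of_pos_right _ hNv
  by_cases hb : N ≤ run ∧ η < Ex D fun x => ind (f (cutPt blk L (2 ^ K) x) ≠ f x)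
  · rw [ind_of hb]
    exact (Ex_le_of_le fun _ => ind_le_one _).trans le_self_add
  refine le_trans ?_ le_add_self
  by_cases hrun : N ≤ run
  swap
  · refine le_trans (Ex_le_of_le fun b => ?_) zero_le
    rw [ind_not]; exact fun h => hrun h.2.1
  have hgood : (Ex D fun x => ind (f (cutPt blk L (2 ^ K) x) ≠ f x)) ≤ η := by
    by_contra h; exact hb ⟨hrun, not_le.1 h⟩
  by_cases hA : ∃ i₀ < L.length, ∀ x y i g,
      Ex (round f blk (L.getD i₀ (0, fun _ => false)) x y i g) (fun g => ind (g = true)) ≤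
      (1 - ((32 : ℕ) : ℝ≥0∞)⁻¹) * ind (g = true)
  · obtain ⟨i₀, hi₀, hρ⟩ := hA
    refine le_trans (Ex_mono fun b => ind_mono And.left)
      ((Ex_test_le_of_block hN1 hi₀ hρ (true, [])).trans ?_)
    calc (1 - ((32 : ℕ) : ℝ≥0∞)⁻¹) ^ t ≤ (1 - ((32 : ℕ) : ℝ≥0∞)⁻¹) ^ (32 * 3) :=
          pow_le_pow_of_le_one (by simp) tsub_le_self (by omega)
      _ = ((1 - ((32 : ℕ) : ℝ≥0∞)⁻¹) ^ 32) ^ 3 := by rw [pow_mul]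
      _ ≤ 2⁻¹ ^ 3 := by gcongr; exact half_pow (by norm_num)
  have hB : ∀ i₀ : Fin L.length, ∃ τ : Fin n, ∀ x y i g, y ≠ x τ →
      Ex (round f blk (L.getD i₀ (0, fun _ => false)) x y i g) (fun g => ind (g = true)) ≤
      (2 * ((32 : ℕ) : ℝ≥0∞)⁻¹) * ind (g = true) := fun i₀ =>
    (round_dichotomy (L.getD i₀ (0, fun _ => false))).resolve_left fun h => hA ⟨i₀, i₀.2, h⟩
  choose τ hτ using hB
  have hρ : 2 * ((32 : ℕ) : ℝ≥0∞)⁻¹ = 2⁻¹ ^ 4 := by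
    rw [← ENNReal.inv_pow, show ((32 : ℕ) : ℝ≥0∞) = 2 * 2 ^ 4 by norm_num,
      ENNReal.mul_inv (by simp) (by simp), ← mul_assoc,
      ENNReal.mul_inv_cancel (by norm_num) (by norm_num), one_mul]
  rw [hρ] at hτ
  have hmis := Ex_test_misread_le (f := f) (D := D) (blk := blk) (t := t) (N := N) τ hτ
  have hmis' : ((N : ℝ≥0∞) * (L.length * (2⁻¹ ^ 4) ^ t)) ≤ 2⁻¹ ^ 4 := by
    rw [← pow_mul, ← mul_assoc, ← Nat.cast_mul]
    -- Since `l`, `E` and the number of blocks are all at most `2 ^ l`, there are at most `2 ^ (4 +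
    -- 3 * l)` readings, against a survival probability of `2^(-400l)` each.
    refine mul_half_pow_le (a := 4 + 3 * l) ?_ (by omega)
    have h1 : l < 2 ^ l := Nat.lt_two_pow_self
    calc N * L.length ≤ 16 * 2 ^ l * 2 ^ l * 2 ^ l := by
          rw [hN]; gcongr; omega
      _ = 2 ^ (4 + 3 * l) := by rw [pow_add, mul_comm 3 l, pow_mul]; ring
  -- Trees that are too deep get weight `0`, so that the union bound can range over the finite type
  -- of trees of bounded size.
  have hcons : ∀ T : {T : DecTree L.length // T.size ≤ s},
      (if T.1.depth ≤ dd then Ex (iter (testStep f D blk L t) 0 N (true, [])) (fun b =>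
        ind (∀ z ∈ b.2, f (cutPt blk L (2 ^ K) z.1) = (T.1.map τ).eval z.1)) else 0) ≤
        2⁻¹ ^ (8 * l * s) := by
    intro T
    split_ifs with hT
    swap
    · exact zero_le
    have hmem : (T.1.map τ).eval ∈ DT n d s :=
      ⟨T.1.map τ, by rw [DecTree.map_depth]; omega, by rw [DecTree.map_size]; exact T.2, rfl⟩
    -- By the triangle inequality, since `f` is `η`-close to its cut version and `2 * η ≤ ε`. The
    -- renaming `τ` need not be injective.
    have hX : η ≤ Ex D fun x => ind (f (cutPt blk L (2 ^ K) x) ≠ (T.1.map τ).eval x) := by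
      by_contra hlt
      refine hfar _ hmem ?_
      rw [Close, prob_eq_Ex]
      refine le_trans (Ex_mono (G := fun x => ind (f (cutPt blk L (2 ^ K) x) ≠ f x) +
        ind (f (cutPt blk L (2 ^ K) x) ≠ (T.1.map τ).eval x)) fun x => ?_) ?_
      · refine ind_le fun hne => ?_
        by_cases h1 : f (cutPt blk L (2 ^ K) x) ≠ f x
        · rw [ind_of h1]; exact le_self_add
        · rw [not_not] at h1
          rw [ind_of (show f (cutPt blk L (2 ^ K) x) ≠ (T.1.map τ).eval x by rw [h1]; exact hne)]
          exact le_add_self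
      · rw [Ex_add]
        refine (add_le_add hgood (le_of_lt (not_le.1 hlt))).trans ?_
        rw [← two_mul]; exact hε
    refine (Ex_test_consistent_le hX).trans ?_
    rw [show N = 2 * Nv * (8 * l * s) by rw [hN, hE]; ring, pow_mul]
    gcongr
    exact half_pow (by omega)
  have := Fintype.ofFinite {T : DecTree L.length // T.size ≤ s}
  refine le_trans (Ex_mono (G := fun b => ind (b.1 = true ∧ Misread τ b.2) +
    ∑ T : {T : DecTree L.length // T.size ≤ s}, if T.1.depth ≤ dd then
      ind (∀ z ∈ b.2, f (cutPt blk L (2 ^ K) z.1) = (T.1.map τ).eval z.1) else 0) fun b => ?_) ?_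
  · refine ind_le ?_
    rintro ⟨h1, -, h3⟩
    by_cases hM : Misread τ b.2
    · rw [ind_of ⟨h1, hM⟩]; exact le_self_add
    · refine le_trans ?_ le_add_self
      obtain ⟨T, hT1, hT2, hT3⟩ := exists_tree_of_cred _ _ h3
      refine le_trans ?_ (Finset.single_le_sum (fun _ _ => zero_le)
        (Finset.mem_univ (⟨T, by omega⟩ : {T : DecTree L.length // T.size ≤ s})))
      rw [if_pos (by simp only; omega), ind_of]
      intro z hz
      rw [hT3 z hz (by rw [reach]), DecTree.map_eval]
      congr 1; funext i
      by_contra hne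
      exact hM ⟨z, hz, i, hne⟩
  · rw [Ex_add, Ex_finset_sum]
    refine le_trans (add_le_add (hmis.trans hmis') (d := 2⁻¹ ^ 4) ?_) (half_pow_add 3).le
    refine le_trans (Finset.sum_le_card_nsmul _ _ (2⁻¹ ^ (8 * l * s)) fun T _ => ?_) ?_
    · refine le_trans (le_of_eq ?_) (hcons T)
      split_ifs
      · rfl
      · rw [Ex_const]
    · rw [nsmul_eq_mul, Finset.card_univ, ← Nat.card_eq_fintype_card]
      -- At most `(s + 2) ^ (2s)` trees compete, and `s + 2 ≤ 2 ^ (l + 1)`. The factor `16` in `N`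
      -- yields the exponent `8ls`, which exceeds `2s(l + 1)` by at least `4`.
      refine mul_half_pow_le (a := (l + 1) * (2 * s)) ?_ (by nlinarith)
      refine (DecTree.card_size_le _ _).trans ?_
      rw [pow_mul 2 (l + 1)]
      refine Nat.pow_le_pow_left ?_ _
      rw [pow_succ]
      omega

/-- The randomness of the partition plays no role here: the bound holds for each `blk`. The search
and the test contribute `1/8` each. -/
theorem Ex_alg_le_of_far (hs : 1 ≤ s) (hNv : 1 ≤ Nv) (hE : E = s * Nv)
    (hl : l = Nat.log 2 E + 1) (hN : N = 16 * l * E) (ht : t = 100 * l) (hdd : dd ≤ d)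
    (hε : 2 * ((2 * Nv : ℕ) : ℝ≥0∞)⁻¹ ≤ ENNReal.ofReal ε) (hfar : Far D ε f (DT n d s)) :
    (Ex (alg f D s N K t dd) fun b => ind b) ≤ 3⁻¹ := by
  rw [alg, Ex_bind]
  refine Ex_le_of_le fun blk => ?_
  rw [Ex_bind]
  set η := ((2 * Nv : ℕ) : ℝ≥0∞)⁻¹ with hη
  refine le_trans (Ex_mono_support (G := fun a => ind (N ≤ a.2 ∧ η <
      Ex D fun x => ind (f (cutPt blk a.1 (2 ^ K) x) ≠ f x)) + 2⁻¹ ^ 3) fun a ha => ?_) ?_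
  · rw [Ex_bind]
    simp only [Ex_pure]
    refine Ex_test_verdict_le hs hNv hE hl hN ht hdd hε hfar blk a ?_
    refine iter_support (I := fun _ a => a.1.length ≤ s) ?_ (s * N) 0 ([], 0) (Nat.zero_le _) a ha
    intro i a h b hb
    rw [PMF.mem_support_bind_iff] at hb
    obtain ⟨x, -, hb⟩ := hb
    rw [PMF.mem_support_pure_iff] at hb
    rw [hb]
    exact grow_length_le a x h
  · rw [Ex_add, Ex_const]
    refine le_trans (add_le_add (b := 2⁻¹ ^ 3) ((Ex_grow_bad_le _ _).trans ?_) le_rfl)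
      ((half_pow_add 2).le.trans half_sq_le)
    have hq : (1 - η) ^ N ≤ 2⁻¹ ^ (8 * l * s) := by
      rw [show N = 2 * Nv * (8 * l * s) by rw [hN, hE]; ring, pow_mul]
      gcongr
      exact half_pow (by omega)
    simp only [List.length_nil, Nat.sub_zero]
    calc (1 - η) ^ N + (s : ℝ≥0∞) * (1 - η) ^ N = ((s + 1 : ℕ) : ℝ≥0∞) * (1 - η) ^ N := by
          push_cast; ring
      _ ≤ ((s + 1 : ℕ) : ℝ≥0∞) * 2⁻¹ ^ (8 * l * s) := by gcongr
      _ ≤ 2⁻¹ ^ 3 := mul_half_pow_le (a := s) Nat.lt_two_pow_self (by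
          have : 1 ≤ l := by omega
          nlinarith)

end Sound
end DTTest

namespace DTTest

open scoped ENNReal

/-! ### Completeness -/

namespace DecTree
variable {n k : ℕ}

/-- The variables of a decision tree. -/
def vars : DecTree n → Finset (Fin n)
  | leaf _ => ∅
  | node i l r => insert i (l.vars ∪ r.vars)

theorem card_vars_lt_size (T : DecTree n) : T.vars.card < T.size := by
  induction T with
  | leaf b => simp [vars, size]
  | node i l r hl hr =>
    simp only [vars, size]
    have h1 := Finset.card_insert_le i (l.vars ∪ r.vars)
    have h2 := Finset.card_union_le l.vars r.vars
    omega

theorem eval_congr (T : DecTree n) {x y : Fin n → Bool} (h : ∀ i ∈ T.vars, x i = y i) :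
    T.eval x = T.eval y := by
  induction T with
  | leaf b => rfl
  | node i l r hl hr =>
    simp only [vars, Finset.mem_insert, Finset.mem_union] at h
    simp only [eval, h i (Or.inl rfl), hl fun j hj => h j (Or.inr (Or.inl hj)),
      hr fun j hj => h j (Or.inr (Or.inr hj))]

/-- Rename some variables, and replace the other ones by `0`. -/
def restrict (g : Fin n → Option (Fin k)) : DecTree n → DecTree k
  | leaf b => leaf b
  | node i l r => match g i with
    | none => restrict g l
    | some m => node m (restrict g l) (restrict g r)

theorem restrict_size_le (g : Fin n → Option (Fin k)) (T : DecTree n) :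
    (T.restrict g).size ≤ T.size := by
  induction T with
  | leaf b => exact le_rfl
  | node i l r hl hr =>
    rw [restrict]
    split
    · simp only [size]; omega
    · simp only [size]; omega

theorem restrict_depth_le (g : Fin n → Option (Fin k)) (T : DecTree n) :
    (T.restrict g).depth ≤ T.depth := by
  induction T with
  | leaf b => exact le_rfl
  | node i l r hl hr =>
    rw [restrict]
    split
    · simp only [depth]; omega
    · simp only [depth]; omega

theorem restrict_eval (g : Fin n → Option (Fin k)) {x : Fin n → Bool} {y : Fin k → Bool}
    (T : DecTree n) (h0 : ∀ i ∈ T.vars, g i = none → x i = false)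
    (h1 : ∀ i ∈ T.vars, ∀ m, g i = some m → x i = y m) :
    (T.restrict g).eval y = T.eval x := by
  induction T with
  | leaf b => rfl
  | node i l r hl hr =>
    simp only [vars, Finset.mem_insert, Finset.mem_union] at h0 h1
    have el := hl (fun j hj => h0 j (Or.inr (Or.inl hj))) fun j hj => h1 j (Or.inr (Or.inl hj))
    have er := hr (fun j hj => h0 j (Or.inr (Or.inr hj))) fun j hj => h1 j (Or.inr (Or.inr hj))
    rw [restrict]
    split
    · next hg => rw [el, eval, h0 i (Or.inl rfl) hg]; simp
    · next m hg => simp only [eval, el, er, h1 i (Or.inl rfl) m hg]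

end DecTree

/-! ### The random partition separates the relevant variables -/

section Split
variable {n : ℕ}

theorem Ex_bit_eq {i j : Fin n} (hij : i ≠ j) :
    (Ex (cube n) fun b => ind (b i = b j)) = 2⁻¹ := by
  have h1 := Ex_ind_add_not (cube n) fun b => b i = b j
  have h2 : (Ex (cube n) fun b => ind (¬ b i = b j)) = Ex (cube n) fun b => ind (b i = b j) := by
    rw [← Ex_cube_addv (unitv i)]
    congr 1; funext b
    congr 1
    simp only [addv, unitv, decide_true, Bool.xor_true, Ne.symm hij, decide_false, Bool.xor_false,
      eq_iff_iff]
    cases b i <;> cases b j <;> simp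
  rw [h2, ← two_mul] at h1
  rw [mul_comm] at h1
  exact ENNReal.eq_inv_of_mul_eq_one_left h1

/-- After appending bits, two block numbers agree only if they agreed before and the new bits agree;
every round halves the probability. -/
theorem Ex_split_collision {i j : Fin n} (hij : i ≠ j) (K : ℕ) :
    (Ex (iter splitStep 0 K fun _ => 0) fun blk => ind (blk i = blk j)) ≤ 2⁻¹ ^ K := by
  refine (Ex_iter_le_pow (G := fun blk : Fin n → ℕ => ind (blk i = blk j)) (ρ := 2⁻¹)
    (fun _ blk => ?_) K 0 _).trans (mul_le_of_le_one_right' (ind_le_one _))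
  rw [splitStep, Ex_bind, ← Ex_bit_eq hij, ← Ex_mul_right]
  simp only [Ex_pure]
  refine Ex_mono fun b => ind_le fun h => ?_
  have h1 : blk i = blk j := by
    cases hi : b i <;> cases hj : b j <;> simp [hi, hj] at h <;> omega
  have h2 : b i = b j := by
    cases hi : b i <;> cases hj : b j <;> simp [hi, hj] at h ⊢ <;> omega
  rw [ind_of h1, ind_of h2, one_mul]

theorem split_lt {K : ℕ} {blk : Fin n → ℕ} (h : blk ∈ (iter splitStep 0 K fun _ => 0).support)
    (j : Fin n) : blk j < 2 ^ K := by
  have := iter_support (step := splitStep (n := n)) (I := fun i blk => ∀ j, blk j < 2 ^ i) ?_ K 0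
    (fun _ => 0) (by simp) blk h j
  · simpa using this
  · intro i a ha b hb j
    rw [splitStep, PMF.mem_support_bind_iff] at hb
    obtain ⟨c, -, hb⟩ := hb
    rw [PMF.mem_support_pure_iff] at hb
    subst hb
    have h1 := ha j
    have h2 := Bool.toNat_le (c j)
    simp only [pow_succ]; omega

/-- At most `2 ^ (2l)` pairs collide with probability `2^(-2l-4)` each; this dictates the value of
`K`. -/
theorem Ex_split_not_injOn {s l : ℕ} (V : Finset (Fin n)) (hV : V.card ≤ s) (hs : s < 2 ^ l) :
    (Ex (iter (splitStep (n := n)) 0 (2 * l + 4) fun _ => 0) fun blk => ind (¬ Set.InjOn blk V)) ≤ 2⁻¹ ^ 4 := by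
  refine le_trans (Ex_mono (G := fun blk => ∑ p ∈ V.offDiag, ind (blk p.1 = blk p.2))
    fun blk => ?_) ?_
  · refine ind_le fun h => ?_
    simp only [Set.InjOn, not_forall] at h
    obtain ⟨i, hi, j, hj, hb, hij⟩ := h
    refine le_trans ?_ (Finset.single_le_sum (fun _ _ => zero_le)
      (Finset.mem_offDiag.2 ⟨hi, hj, hij⟩ : (i, j) ∈ V.offDiag))
    rw [ind_of hb]
  · rw [Ex_finset_sum]
    refine le_trans (Finset.sum_le_card_nsmul _ _ (2⁻¹ ^ (2 * l + 4)) fun p hp =>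
      Ex_split_collision (Finset.mem_offDiag.1 hp).2.2 _) ?_
    rw [nsmul_eq_mul]
    refine mul_half_pow_le (a := 2 * l) ?_ le_rfl
    rw [Finset.offDiag_card, two_mul, pow_add]
    exact (Nat.sub_le _ _).trans (Nat.mul_le_mul (by omega) (by omega))

end Split

section Complete
variable {n : ℕ} {T : DecTree n} {D : PMF (Fin n → Bool)} {blk : Fin n → ℕ}
  {L : List (ℕ × (Fin n → Bool))} {s N K t : ℕ}

/-- The two hypotheses are the invariant of the search: cutting at `lo` keeps the value, cutting at
`lo + 2 ^ k` changes it. -/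
theorem bsearch_spec {f : (Fin n → Bool) → Bool} {x : Fin n → Bool} (k : ℕ) : ∀ lo,
    f (cutPt blk L lo x) = f x → f (cutPt blk L (lo + 2 ^ k) x) ≠ f x →
    f (cutPt blk L (bsearch f blk L x k lo) x) = f x ∧
      f (cutPt blk L (bsearch f blk L x k lo + 1) x) ≠ f x := by
  induction k with
  | zero => intro lo h1 h2; exact ⟨h1, h2⟩
  | succ k ih =>
    intro lo h1 h2
    rw [bsearch]
    split_ifs with h
    · exact ih lo h1 h
    · rw [not_not] at h
      refine ih _ h ?_
      rwa [add_assoc, ← two_mul, ← pow_succ']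

/-- The witness `w` shows that the block `β` contains a relevant variable of `T`. -/
def Relevant (T : DecTree n) (blk : Fin n → ℕ) (B : ℕ × (Fin n → Bool)) (τ : Fin n) : Prop :=
  τ ∈ T.vars ∧ blk τ = B.1 ∧
    T.eval (Function.update B.2 τ true) ≠ T.eval (Function.update B.2 τ false)

theorem cutPt_zero (x : Fin n → Bool) : cutPt blk L 0 x = x := by
  funext j; simp [cutPt]

/-- The two points differ only inside block `c`, and not at all if `c` is listed. By injectivity a
single variable of `T` lies in this block, and it is `1` at the first point and `0` at the second.
-/
theorem exists_relevant (hinj : Set.InjOn blk T.vars) {c : ℕ} {x : Fin n → Bool}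
    (h : T.eval (cutPt blk L c x) ≠ T.eval (cutPt blk L (c + 1) x)) :
    c ∉ L.map Prod.fst ∧ ∃ τ, Relevant T blk (c, cutPt blk L c x) τ := by
  have hex : ∃ j ∈ T.vars, cutPt blk L c x j ≠ cutPt blk L (c + 1) x j := by
    by_contra hn
    push Not at hn
    exact h (T.eval_congr hn)
  obtain ⟨j, hj, hne⟩ := hex
  have hcut : ∀ i, blk i ≠ c → cutPt blk L c x i = cutPt blk L (c + 1) x i := by
    intro i hi
    simp only [cutPt]
    congr 2
    rw [decide_eq_decide]; omega
  have hjc : blk j = c := by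
    by_contra hjc; exact hne (hcut j hjc)
  have hc : c ∉ L.map Prod.fst := by
    intro hc
    refine hne ?_
    simp only [cutPt, hjc, hc, decide_true, Bool.true_or]
  refine ⟨hc, j, hj, hjc, ?_⟩
  have hfalse : cutPt blk L (c + 1) x j = false := by
    simp [cutPt, hjc, hc]
  have htrue : cutPt blk L c x j = true := by
    rw [hfalse] at hne; simpa using hne
  have e1 : Function.update (cutPt blk L c x) j true = cutPt blk L c x := by
    rw [← htrue, Function.update_eq_self]
  have e2 : T.eval (Function.update (cutPt blk L c x) j false) =
      T.eval (cutPt blk L (c + 1) x) := by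
    refine T.eval_congr fun i hi => ?_
    by_cases hij : i = j
    · subst hij; rw [Function.update_self, hfalse]
    · rw [Function.update_of_ne hij]
      refine hcut i fun hic => hij (hinj hi hj (by rw [hic, hjc]))
  simp only
  rw [e1, e2]
  exact h

/-- All blocks in `L` are different, and they contain relevant variables. -/
structure Found (T : DecTree n) (blk : Fin n → ℕ) (L : List (ℕ × (Fin n → Bool))) : Prop where
  nodup : (L.map Prod.fst).Nodup
  rel : ∀ B ∈ L, ∃ τ, Relevant T blk B τ

/-- Different blocks contain different variables of `T`. Being strict, the bound shows that the cap
of `s` blocks in `grow` never interferes. -/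
theorem Found.length_lt (h : Found T blk L) : L.length < T.size := by
  refine lt_of_le_of_lt ?_ T.card_vars_lt_size
  rw [← List.length_map Prod.fst, ← List.toFinset_card_of_nodup h.nodup]
  refine (Finset.card_le_card (t := T.vars.image blk) fun b hb => ?_).trans Finset.card_image_le
  rw [List.mem_toFinset, List.mem_map] at hb
  obtain ⟨B, hB, rfl⟩ := hb
  obtain ⟨τ, h1, h2, -⟩ := h.rel B hB
  exact Finset.mem_image.2 ⟨τ, h1, h2⟩

/-- Each found block accounts for at most `N` examples: a run of fewer than `N` agreements and the
example that ended it. Hence `s * N` examples suffice for a full run. -/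
theorem Found.grow (hinj : Set.InjOn blk T.vars) (hs : T.size ≤ s) {i run : ℕ}
    (h : Found T blk L) (hi : i ≤ L.length * N + run ∨ N ≤ run) (x : Fin n → Bool) :
    Found T blk (DTTest.grow T.eval s N K blk (L, run) x).1 ∧
      (i + 1 ≤ (DTTest.grow T.eval s N K blk (L, run) x).1.length * N +
        (DTTest.grow T.eval s N K blk (L, run) x).2 ∨
        N ≤ (DTTest.grow T.eval s N K blk (L, run) x).2) := by
  have hlen := h.length_lt
  unfold DTTest.grow
  split_ifs with h1 h2
  · have hb := bsearch_spec (f := T.eval) (L := L) (blk := blk) (x := x) K 0 (by rw [cutPt_zero])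
      (by rw [zero_add]; exact h2)
    obtain ⟨hn, hτ⟩ := exists_relevant hinj (by rw [hb.1]; exact hb.2.symm)
    refine ⟨⟨?_, ?_⟩, Or.inl ?_⟩
    · simp only [List.map_append, List.map_cons, List.map_nil]
      rw [List.nodup_append]
      refine ⟨h.nodup, by simp, ?_⟩
      intro a ha b hb' hab
      rw [List.mem_singleton] at hb'
      rw [hab, hb'] at ha
      exact hn ha
    · intro B hB
      rcases List.mem_append.1 hB with hB | hB
      · exact h.rel B hB
      · rw [List.mem_singleton] at hB
        rw [hB]; exact hτ
    · simp only [List.length_append, List.length_singleton, add_mul, one_mul]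
      have := h1.1
      simp only at this
      omega
  · refine ⟨h, ?_⟩
    simp only
    omega
  · refine ⟨h, ?_⟩
    simp only at h1 ⊢
    omega

/-- As `τ` is the only variable of `T` in the block, the blended function is `b τ` or its negation,
and the negation cancels in the xor of two values. -/
theorem est_support (hinj : Set.InjOn blk T.vars) {B : ℕ × (Fin n → Bool)} {τ : Fin n}
    (hτ : Relevant T blk B τ) {z : Fin n → Bool} {e : Bool}
    (he : e ∈ (est T.eval blk B z).support) : e = z τ := by
  rw [est, PMF.mem_support_bind_iff] at he
  obtain ⟨b, -, he⟩ := he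
  rw [PMF.mem_support_pure_iff] at he
  have hval : ∀ b : Fin n → Bool, T.eval (blend blk B.1 B.2 b) =
      T.eval (Function.update B.2 τ (b τ)) := by
    intro b
    refine T.eval_congr fun i hi => ?_
    by_cases hiτ : i = τ
    · subst hiτ; simp [blend, hτ.2.1]
    · rw [Function.update_of_ne hiτ, blend, if_neg]
      intro hb
      exact hiτ (hinj hi hτ.1 (by rw [hb, hτ.2.1]))
  have hne := hτ.2.2
  rw [he, hval, hval]
  revert hne
  cases b τ <;> cases z τ <;> simp <;> cases T.eval (Function.update B.2 τ true) <;>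
    cases T.eval (Function.update B.2 τ false) <;> simp

theorem round_support (hinj : Set.InjOn blk T.vars) {B : ℕ × (Fin n → Bool)} {τ : Fin n}
    (hτ : Relevant T blk B τ) {x : Fin n → Bool} {i : ℕ} {g : Bool}
    (hg : g ∈ (round T.eval blk B x (x τ) i true).support) : g = true := by
  simp only [round, PMF.mem_support_bind_iff, PMF.mem_support_pure_iff] at hg
  obtain ⟨e, he, u, -, v, -, o, ho, e₁, h1, e₂, h2, e₃, h3, e₄, h4, hg⟩ := hg
  have he := est_support hinj hτ he
  have ho := est_support hinj hτ ho
  have h1 := est_support hinj hτ h1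
  have h2 := est_support hinj hτ h2
  have h3 := est_support hinj hτ h3
  have h4 := est_support hinj hτ h4
  rw [hg, he, ho, h1, h2, h3, h4]
  simp

/-- All literals have been read correctly, and all tests have been passed. -/
def AllRead {k : ℕ} (τ : Fin k → Fin n) (a : Bool × List ((Fin n → Bool) × (ℕ → Bool))) : Prop :=
  a.1 = true ∧ ∀ z ∈ a.2, ∀ i : Fin k, z.2 i = z.1 (τ i)

theorem test_support (hinj : Set.InjOn blk T.vars) {τ : Fin L.length → Fin n}
    (hτ : ∀ i : Fin L.length, Relevant T blk (L.getD i (0, fun _ => false)) (τ i))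
    {b : Bool × List ((Fin n → Bool) × (ℕ → Bool))}
    (hb : b ∈ (iter (testStep T.eval D blk L t) 0 N (true, [])).support) : AllRead τ b := by
  refine iter_support (step := testStep T.eval D blk L t) (I := fun _ a => AllRead τ a) ?_ N 0 (true, []) ⟨rfl, by simp⟩ b hb
  rintro i ⟨g, S⟩ ⟨hg, hS⟩ b hb
  simp only [testStep] at hb
  rw [PMF.mem_support_bind_iff] at hb
  obtain ⟨x, -, hb⟩ := hb
  rw [PMF.mem_support_bind_iff] at hb
  obtain ⟨c, hc, hb⟩ := hb
  rw [PMF.mem_support_pure_iff] at hb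
  have := iter_support (step := reader T.eval blk L t x) (I := fun j a =>
    j ≤ L.length → a.1 = true ∧ ∀ i : Fin L.length, i.val < j → a.2 i = x (τ i)) ?_ L.length 0
    (g, fun _ => false) (fun _ => ⟨hg, fun i hi => absurd hi (Nat.not_lt_zero _)⟩) c hc (by omega)
  · subst hb
    refine ⟨this.1, fun z hz i => ?_⟩
    rcases List.mem_cons.1 hz with rfl | hz
    · exact this.2 i (by omega)
    · exact hS z hz i
  · rintro j ⟨g', y⟩ ha b hb hj
    obtain ⟨hg', hy⟩ := ha (by omega)
    simp only [reader] at hb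
    rw [PMF.mem_support_bind_iff] at hb
    obtain ⟨e, he, hb⟩ := hb
    rw [PMF.mem_support_bind_iff] at hb
    obtain ⟨g₁, hg₁, hb⟩ := hb
    rw [PMF.mem_support_pure_iff] at hb
    have hrel := hτ ⟨j, hj⟩
    have he := est_support hinj hrel he
    rw [he] at hg₁ hb
    have hg2 := iter_support (I := fun _ g => g = true) (fun i a ha b hb => by
      subst ha; exact round_support hinj hrel hb) t 0 g' hg' g₁ hg₁
    subst hb
    refine ⟨hg2, fun i hi => ?_⟩
    by_cases hij : i.val = j
    · have : i = ⟨j, hj⟩ := Fin.ext hij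
      subst this
      simp
    · simp only
      rw [Function.update_of_ne hij]
      exact hy i (by omega)

theorem verdict_of_injOn {d dd : ℕ} (hinj : Set.InjOn blk T.vars) (hblk : ∀ j, blk j < 2 ^ K)
    (hs : T.size ≤ s) (hd : T.depth ≤ d) (hdd : dd = d - (d - s))
    {a : List (ℕ × (Fin n → Bool)) × ℕ}
    (ha : a ∈ (iter (fun _ a => D.bind fun x => PMF.pure (grow T.eval s N K blk a x)) 0 (s * N)
      ([], 0)).support)
    {b : Bool × List ((Fin n → Bool) × (ℕ → Bool))}
    (hb : b ∈ (iter (testStep T.eval D blk a.1 t) 0 N (true, [])).support) :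
    verdict T.eval s N K dd blk a b := by
  obtain ⟨hF, hrun⟩ := iter_support (I := fun i a => Found T blk a.1 ∧
    (i ≤ a.1.length * N + a.2 ∨ N ≤ a.2)) (fun i a h b hb => by
      rw [PMF.mem_support_bind_iff] at hb
      obtain ⟨x, -, hb⟩ := hb
      rw [PMF.mem_support_pure_iff] at hb
      rw [hb]
      exact h.1.grow hinj hs h.2 x) (s * N) 0 ([], 0)
      ⟨⟨by simp, by simp⟩, Or.inl (by simp)⟩ a ha
  obtain ⟨L, run⟩ := a
  replace hF : Found T blk L := hF
  have hlen := hF.length_lt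
  have hrel : ∀ i : Fin L.length, ∃ τ, Relevant T blk (L.getD i (0, fun _ => false)) τ := by
    intro i
    rw [List.getD_eq_getElem _ _ i.2]
    exact hF.rel _ (List.getElem_mem _)
  choose τ hτ using hrel
  obtain ⟨hgood, hread⟩ := test_support hinj hτ hb
  refine ⟨hgood, ?_, ?_⟩
  · rcases hrun with h | h
    · have h1 : (L.length + 1) * N ≤ s * N := Nat.mul_le_mul_right _ (by omega)
      rw [add_mul] at h1
      simp only at h ⊢
      omega
    · exact h
  · classical
    -- A variable of `T` is renamed to the index of its block if this block was found. Otherwise it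
    -- is `0` at every cut point, so `restrict` may replace it by `0`.
    set g : Fin n → Option (Fin L.length) := fun i =>
      if h : ∃ m, blk (τ m) = blk i then some h.choose else none with hg
    have htree := le_cred_of_tree (s := s) (S := b.2)
      (lab := fun x => T.eval (cutPt blk L (2 ^ K) x)) (T.restrict g) (dd + 1) 0 ?_ ?_
    · have := T.restrict_size_le g
      simp only at htree ⊢
      omega
    · have h1 := T.restrict_depth_le g
      have h2 := T.depth_lt_size
      omega
    · intro z hz _
      symm
      have hcut : ∀ i, cutPt blk L (2 ^ K) z.1 i =
          (z.1 i && decide (blk i ∈ L.map Prod.fst)) := by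
        intro i
        have : ¬ 2 ^ K ≤ blk i := not_le.2 (hblk i)
        simp [cutPt, this]
      have hmem : ∀ m : Fin L.length, blk (τ m) ∈ L.map Prod.fst := by
        intro m
        rw [(hτ m).2.1, List.getD_eq_getElem _ _ m.2]
        exact List.mem_map_of_mem (List.getElem_mem _)
      refine T.restrict_eval g (fun i hi hgi => ?_) (fun i hi m hgi => ?_)
      · rw [hcut]
        have : blk i ∉ L.map Prod.fst := by
          intro hmem
          obtain ⟨B, hB, hBi⟩ := List.mem_map.1 hmem
          obtain ⟨m, hm, rfl⟩ := List.getElem_of_mem hB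
          have hex : ∃ m, blk (τ m) = blk i := ⟨⟨m, hm⟩, by
            rw [(hτ _).2.1, List.getD_eq_getElem _ _ hm, hBi]⟩
          rw [hg] at hgi
          simp [hex] at hgi
        simp [this]
      · have hbm : blk (τ m) = blk i := by
          by_cases hex : ∃ m, blk (τ m) = blk i
          · have : g i = some hex.choose := by simp only [hg, dif_pos hex]
            rw [this, Option.some.injEq] at hgi
            rw [← hgi]; exact hex.choose_spec
          · have : g i = none := by simp only [hg, dif_neg hex]
            rw [this] at hgi; cases hgi
        have hτi : τ m = i := hinj (hτ m).1 hi hbm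
        have := hmem m
        rw [hbm] at this
        rw [hcut, hread z hz m, hτi]
        simp only [this, decide_true, Bool.and_true]

theorem Ex_alg_not_le_of_mem {f : (Fin n → Bool) → Bool} {d dd E Nv l : ℕ} (hf : f ∈ DT n d s)
    (hNv : 1 ≤ Nv) (hE : E = s * Nv) (hl : l = Nat.log 2 E + 1) (hK : K = 2 * l + 4)
    (hdd : dd = d - (d - s)) :
    (Ex (alg f D s N K t dd) fun b => ind (¬ b)) ≤ 3⁻¹ := by
  obtain ⟨T, hTd, hTs, rfl⟩ := hf
  have hEl : E < 2 ^ l := by rw [hl]; exact Nat.lt_pow_succ_log_self (by norm_num) E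
  have hsE : s ≤ E := by rw [hE]; exact Nat.le_mul_of_pos_right _ hNv
  rw [alg, Ex_bind]
  refine le_trans (Ex_mono_support (G := fun blk => ind (¬ Set.InjOn blk T.vars)) fun blk hblk => ?_)
    ?_
  · by_cases hinj : Set.InjOn blk T.vars
    · rw [ind_not (not_not.2 hinj), Ex_bind]
      refine le_trans (Ex_mono_support (G := fun _ => 0) fun a ha => ?_) (by rw [Ex_const])
      rw [Ex_bind]
      refine le_trans (Ex_mono_support (G := fun _ => 0) fun b hb => ?_) (by rw [Ex_const])
      rw [Ex_pure, ind_not]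
      exact not_not.2 (verdict_of_injOn hinj (split_lt hblk) hTs hTd hdd ha hb)
    · rw [ind_of hinj]
      exact Ex_le_of_le fun _ => ind_le_one _
  · rw [hK]
    refine (Ex_split_not_injOn T.vars (s := s) ?_ (by omega)).trans
      ((half_pow_anti (by norm_num)).trans half_sq_le)
    have := T.card_vars_lt_size
    omega

end Complete
end DTTest

namespace DTTest

open scoped ENNReal

/-! ### Bounds on the resources -/

theorem geo_le_pow (s j : ℕ) : geo s (j + 1) ≤ (2 * s + 1) ^ j := by
  induction j with
  | zero => simp [geo]
  | succ j ih =>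
    rw [geo, pow_succ]
    have : 1 ≤ (2 * s + 1) ^ j := Nat.one_le_pow _ _ (by omega)
    have := Nat.mul_le_mul_right (2 * s) ih
    rw [mul_add, mul_one]
    omega

/-- The truncation of the depth at `s` matters for `s = 1`: the tree of paths of depth `d` could
have more than `3 ^ (d - 1)` nodes, while `s ^ (C * d) = 1`. For `s ≥ 2` the base is absorbed by `2s
+ 1 ≤ s ^ 3`. -/
theorem geo_bound {s d dd : ℕ} (hs : 1 ≤ s) (hdd : dd = d - (d - s)) :
    geo s (dd + 1) ≤ 3 ∨ (1 ≤ d ∧ 2 ≤ s ∧ geo s (dd + 1) ≤ s ^ (3 * d)) := by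
  by_cases hd : d = 0
  · left
    have : dd = 0 := by omega
    subst this
    simp [geo]
  by_cases hs1 : s = 1
  · left
    have : dd = 1 := by omega
    subst this hs1
    simp [geo]
  right
  refine ⟨by omega, by omega, (geo_le_pow s dd).trans ?_⟩
  have h2 : 2 ≤ s := by omega
  have h3 : 2 * s + 1 ≤ s ^ 3 := by nlinarith [sq_nonneg s, Nat.mul_le_mul h2 h2]
  calc (2 * s + 1) ^ dd ≤ (s ^ 3) ^ dd := Nat.pow_le_pow_left h3 _
    _ = s ^ (3 * dd) := by rw [pow_mul]
    _ ≤ s ^ (3 * d) := Nat.pow_le_pow_right hs (by omega)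

/-- Only the handling of the tree of paths depends on its number `G` of nodes. Each of the `N`
examples marks all nodes, and the final dynamic program costs less because `s ≤ N`. -/
theorem time_bound {n s E l N K t dd G : ℕ} (hn : 1 ≤ n) (hs : 1 ≤ s) (hl : 1 ≤ l) (hsE : s ≤ E)
    (hN : N = 16 * l * E) (hK : K = 2 * l + 4) (ht : t = 100 * l) (hdd : dd ≤ s) :
    (E * 50 + 100) + ((K * (40 * (n + 1)) + 3) +
      ((s * N * ((K + 4) * (100 * (n + 1)) + 4) + 3) + (60 * (dd + 1) +
      ((N * (60 * (n + 1) + (s * ((t + 1) * (1104 * (n + 1))) + 3) + 90 * G + 4) + 3) +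
      ((G * (100 * (s + 1)) + 3) + 30))))) ≤ 226000 * (s * N * l * n) + 290 * (N * G) := by
  have hEN : E ≤ N := by rw [hN]; exact Nat.le_mul_of_pos_left _ (by omega)
  have hln : 1 ≤ l * n := Nat.mul_pos hl hn
  have hsln : 1 ≤ s * (l * n) := Nat.mul_pos hs hln
  have hsN : 1 ≤ s * N := Nat.mul_pos hs (by omega)
  obtain ⟨Z, hZ⟩ : ∃ Z, Z = s * N * l * n := ⟨_, rfl⟩
  rw [← hZ]
  have z1 : N ≤ Z := by
    rw [hZ, show s * N * l * n = N * (s * (l * n)) by ring]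
    exact Nat.le_mul_of_pos_right _ hsln
  have z2 : l * n ≤ Z := by
    rw [hZ, mul_assoc]
    exact Nat.le_mul_of_pos_left _ hsN
  have t2 : K * (40 * (n + 1)) ≤ 480 * Z :=
    calc K * (40 * (n + 1)) ≤ (6 * l) * (40 * (2 * n)) :=
          Nat.mul_le_mul (by omega) (by omega)
      _ = 480 * (l * n) := by ring
      _ ≤ 480 * Z := by omega
  have t3 : s * N * ((K + 4) * (100 * (n + 1)) + 4) ≤ 2004 * Z :=
    calc s * N * ((K + 4) * (100 * (n + 1)) + 4)
        ≤ s * N * ((10 * l) * (100 * (2 * n)) + 4 * (l * n)) := by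
          gcongr <;> omega
      _ = 2004 * Z := by rw [hZ]; ring
  have t5 : N * (60 * (n + 1) + (s * ((t + 1) * (1104 * (n + 1))) + 3) + 90 * G + 4) ≤
      223135 * Z + 90 * (N * G) :=
    calc N * (60 * (n + 1) + (s * ((t + 1) * (1104 * (n + 1))) + 3) + 90 * G + 4)
        ≤ N * (120 * (s * (l * n)) + (s * ((101 * l) * (1104 * (2 * n))) + 3 * (s * (l * n))) +
            90 * G + 4 * (s * (l * n))) := by
          have : n ≤ s * (l * n) := by
            rw [← mul_assoc]; exact Nat.le_mul_of_pos_left _ (Nat.mul_pos hs hl)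
          have h2 : (t + 1) * (1104 * (n + 1)) ≤ (101 * l) * (1104 * (2 * n)) :=
            Nat.mul_le_mul (by omega) (by omega)
          have h3 := Nat.mul_le_mul_left s h2
          exact Nat.mul_le_mul_left N (by omega)
      _ = 223135 * Z + 90 * (N * G) := by rw [hZ]; ring
  have t6 : G * (100 * (s + 1)) ≤ 200 * (N * G) :=
    calc G * (100 * (s + 1)) ≤ G * (100 * (2 * N)) := by gcongr; omega
      _ = 200 * (N * G) := by ring
  omega

theorem query_bound {s l N K t : ℕ} (hs : 1 ≤ s) (hl : 1 ≤ l) (hK : K = 2 * l + 4)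
    (ht : t = 100 * l) :
    s * N * (K + 2) + N * (2 + s * (12 * t + 2)) ≤ 1212 * (s * N * l) := by
  have hsl : 1 ≤ s * l := Nat.mul_pos hs hl
  calc s * N * (K + 2) + N * (2 + s * (12 * t + 2))
      ≤ s * N * (8 * l) + N * (2 * (s * l) + s * (1202 * l)) := by
        gcongr <;> omega
    _ = 1212 * (s * N * l) := by ring

section Real
variable {s Nv E l N : ℕ} {ε : ℝ}

theorem ceil_bounds (h0 : 0 < ε) (h1 : ε ≤ 1) (hNv : Nv = ⌈1 / ε⌉₊) :
    1 ≤ Nv ∧ 1 / ε ≤ Nv ∧ (Nv : ℝ) ≤ 2 * (1 / ε) ∧ 1 ≤ 1 / ε := by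
  have hx : 1 ≤ 1 / ε := by rw [le_div_iff₀ h0]; linarith
  have h2 : 1 / ε ≤ Nv := by rw [hNv]; exact Nat.le_ceil _
  have h3 : (Nv : ℝ) < 1 / ε + 1 := by rw [hNv]; exact Nat.ceil_lt_add_one (by linarith)
  refine ⟨?_, h2, by linarith, hx⟩
  have : (1 : ℝ) ≤ Nv := hx.trans h2
  exact_mod_cast this

/-- The change from base `2` to the natural logarithm costs the factor `1 / log 2 < 2`. -/
theorem log_bound {m : ℝ} (hE1 : 1 ≤ E) (hm : 1 ≤ m) (hEm : (E : ℝ) ≤ 2 * m)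
    (hl : l = Nat.log 2 E + 1) : (l : ℝ) ≤ 2 * (1 + Real.log m) := by
  have h1 : (2 : ℝ) ^ Nat.log 2 E ≤ 2 * m := by
    refine le_trans ?_ hEm
    exact_mod_cast Nat.pow_log_le_self 2 (by omega)
  have h2 := Real.log_le_log (by positivity) h1
  rw [Real.log_pow, Real.log_mul (by norm_num) (by linarith)] at h2
  have h3 := Real.log_two_gt_d9
  have h4 := Real.log_two_lt_d9
  have h5 : 0 ≤ Real.log m := Real.log_nonneg hm
  have h6 : (0 : ℝ) ≤ Nat.log 2 E := Nat.cast_nonneg _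
  rw [hl]
  push_cast
  nlinarith

theorem sNl_bound (hs : 1 ≤ s) (h0 : 0 < ε) (h1 : ε ≤ 1) (hNv : Nv = ⌈1 / ε⌉₊) (hE : E = s * Nv)
    (hl : l = Nat.log 2 E + 1) (hN : N = 16 * l * E) :
    (N : ℝ) ≤ 64 * (1 + Real.log ((s : ℝ) ^ 2 / ε)) * (s / ε) ∧
    ((s * N * l : ℕ) : ℝ) ≤ 128 * ((s : ℝ) ^ 2 / ε) * (1 + Real.log ((s : ℝ) ^ 2 / ε)) ^ 2 ∧
    1 ≤ (s : ℝ) ^ 2 / ε := by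
  obtain ⟨hNv1, -, hNv2, hx⟩ := ceil_bounds h0 h1 hNv
  have hs' : (1 : ℝ) ≤ s := by exact_mod_cast hs
  have hm : (s : ℝ) ^ 2 / ε = s * (s / ε) := by ring
  have hsx : 1 ≤ (s : ℝ) / ε := by rw [le_div_iff₀ h0]; linarith
  have hm1 : (1 : ℝ) ≤ (s : ℝ) ^ 2 / ε := by rw [hm]; nlinarith
  have hE2 : (E : ℝ) ≤ 2 * (s / ε) := by
    rw [hE]; push_cast
    calc (s : ℝ) * Nv ≤ s * (2 * (1 / ε)) := by gcongr
      _ = 2 * (s / ε) := by ring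
  have hl2 := log_bound (by rw [hE]; exact Nat.mul_pos hs hNv1) hm1
    (hE2.trans (by rw [hm]; nlinarith)) hl
  set lam := 1 + Real.log ((s : ℝ) ^ 2 / ε) with hlam
  have hlam0 : 0 ≤ lam := by
    have := Real.log_nonneg hm1
    rw [hlam]; linarith
  have hN2 : (N : ℝ) ≤ 64 * lam * (s / ε) := by
    rw [hN]; push_cast
    calc (16 : ℝ) * l * E ≤ 16 * (2 * lam) * (2 * (s / ε)) := by gcongr
      _ = 64 * lam * (s / ε) := by ring
  refine ⟨hN2, ?_, hm1⟩
  push_cast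
  calc (s : ℝ) * N * l ≤ s * (64 * lam * (s / ε)) * (2 * lam) := by gcongr
    _ = 128 * ((s : ℝ) ^ 2 / ε) * lam ^ 2 := by ring

theorem softO_ge {C : ℕ} {m c : ℝ} (hm : 1 ≤ m) (hc : c ≤ C) (hC : 2 ≤ C) :
    c * m * (1 + Real.log m) ^ 2 ≤ softO C m := by
  have h1 : 1 ≤ 1 + Real.log m := by linarith [Real.log_nonneg hm]
  unfold softO
  have h2 : (1 + Real.log m) ^ 2 ≤ (1 + Real.log m) ^ C := pow_le_pow_right₀ h1 hC
  have h3 : 0 ≤ (1 + Real.log m) ^ 2 := by positivity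
  calc c * m * (1 + Real.log m) ^ 2 ≤ C * m * (1 + Real.log m) ^ 2 := by gcongr
    _ ≤ C * m * (1 + Real.log m) ^ C := by gcongr

/-- The product `N * G` mixes `lam = 1 + log m` with a power of `s`, whereas the claimed bound is a
sum. The inequality `lam * a ≤ a ^ 2 + lam ^ 2` separates them. A bounded `G` is charged to the
query term alone. -/
theorem path_time_bound {n d G C : ℕ} (hn : 1 ≤ n) (hs : 1 ≤ s) (h0 : 0 < ε) (h1 : ε ≤ 1)
    (hNv : Nv = ⌈1 / ε⌉₊) (hE : E = s * Nv) (hl : l = Nat.log 2 E + 1) (hN : N = 16 * l * E)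
    (hG : G ≤ 3 ∨ (1 ≤ d ∧ 2 ≤ s ∧ G ≤ s ^ (3 * d))) (hC : 23 ≤ C) :
    ((290 * (N * G) : ℕ) : ℝ) ≤ (s : ℝ) ^ (C * d) / ε +
      n * (200000 * ((s : ℝ) ^ 2 / ε) * (1 + Real.log ((s : ℝ) ^ 2 / ε)) ^ 2) := by
  obtain ⟨hN1, -, hm⟩ := sNl_bound hs h0 h1 hNv hE hl hN
  have hs' : (1 : ℝ) ≤ s := by exact_mod_cast hs
  have hn' : (1 : ℝ) ≤ n := by exact_mod_cast hn
  obtain ⟨lam, hlam⟩ : ∃ lam, lam = 1 + Real.log ((s : ℝ) ^ 2 / ε) := ⟨_, rfl⟩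
  have hlam1 : 1 ≤ lam := by rw [hlam]; linarith [Real.log_nonneg hm]
  rw [← hlam] at hN1 ⊢
  have hsm : (s : ℝ) / ε ≤ (s : ℝ) ^ 2 / ε := by gcongr; nlinarith
  have hx : 1 / ε ≤ (s : ℝ) ^ 2 / ε := by gcongr; nlinarith
  have hx0 : 0 < 1 / ε := by positivity
  have hpow : 0 ≤ (s : ℝ) ^ (C * d) / ε := by positivity
  push_cast
  rcases hG with hG | ⟨hd, hs2, hG⟩
  · have hG' : (G : ℝ) ≤ 3 := by exact_mod_cast hG
    calc (290 : ℝ) * (N * G) ≤ 290 * ((64 * lam * (s / ε)) * 3) := by gcongr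
      _ ≤ 1 * (200000 * ((s : ℝ) ^ 2 / ε) * (lam * lam)) := by
          have : lam * (s / ε) ≤ (lam * lam) * ((s : ℝ) ^ 2 / ε) := by
            gcongr; nlinarith
          have : 0 ≤ (lam * lam) * ((s : ℝ) ^ 2 / ε) := by positivity
          nlinarith
      _ ≤ n * (200000 * ((s : ℝ) ^ 2 / ε) * lam ^ 2) := by
          rw [← pow_two]; gcongr
      _ ≤ _ := le_add_of_nonneg_left hpow
  · have hG' : (G : ℝ) ≤ (s : ℝ) ^ (3 * d) := by exact_mod_cast hG
    have hs2' : (2 : ℝ) ≤ s := by exact_mod_cast hs2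
    obtain ⟨a, ha⟩ : ∃ a, a = (s : ℝ) ^ (3 * d + 1) := ⟨_, rfl⟩
    have ha0 : 0 ≤ a := by rw [ha]; positivity
    -- The constant `18560 = 290 * 64` is at most `2 ^ 15 ≤ s ^ 15`; and `15 + 2 * (3d + 1) ≤ 23d`
    -- for `d ≥ 1`, whence `23 ≤ C`.
    have h15 : (32768 : ℝ) ≤ (s : ℝ) ^ 15 := by
      calc (32768 : ℝ) = 2 ^ 15 := by norm_num
        _ ≤ (s : ℝ) ^ 15 := by gcongr
    have ha2 : 32768 * a ^ 2 ≤ (s : ℝ) ^ (C * d) := by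
      calc 32768 * a ^ 2 ≤ (s : ℝ) ^ 15 * a ^ 2 := by gcongr
        _ = (s : ℝ) ^ (15 + (3 * d + 1) * 2) := by rw [ha, ← pow_mul, ← pow_add]
        _ ≤ (s : ℝ) ^ (C * d) := by
          refine pow_le_pow_right₀ hs' ?_
          nlinarith
    have hal : lam * a ≤ a ^ 2 + lam ^ 2 := by nlinarith [sq_nonneg (lam - a), sq_nonneg (lam + a)]
    calc (290 : ℝ) * (N * G) ≤ 290 * ((64 * lam * (s / ε)) * (s : ℝ) ^ (3 * d)) := by gcongr
      _ = 18560 * (lam * a) * (1 / ε) := by rw [ha, pow_succ]; ring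
      _ ≤ 18560 * (a ^ 2 + lam ^ 2) * (1 / ε) := by gcongr
      _ = (18560 * a ^ 2) * (1 / ε) + 18560 * lam ^ 2 * (1 / ε) := by ring
      _ ≤ (s : ℝ) ^ (C * d) * (1 / ε) + 200000 * lam ^ 2 * ((s : ℝ) ^ 2 / ε) := by
          gcongr
          · refine le_trans ?_ ha2
            gcongr; norm_num
          · norm_num
      _ = (s : ℝ) ^ (C * d) / ε + 1 * (200000 * ((s : ℝ) ^ 2 / ε) * lam ^ 2) := by ring
      _ ≤ _ := by gcongr

theorem word_bound {n d G K C : ℕ} (hn : 1 ≤ n) (hs : 1 ≤ s) (h0 : 0 < ε) (h1 : ε ≤ 1)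
    (hNv : Nv = ⌈1 / ε⌉₊) (hE : E = s * Nv) (hl : l = Nat.log 2 E + 1) (hN : N = 16 * l * E)
    (hK : K = 2 * l + 4) (hG : G ≤ 3 ∨ (1 ≤ d ∧ 2 ≤ s ∧ G ≤ s ^ (3 * d))) (hC : 10 ≤ C) :
    ((2 + 2 * 2 ^ K + (N + 2) + (s + 1) * (n + 1) + s * N + 116 * l + (G + 1) * (2 * s + 2) + n +
      s + d + Nv : ℕ) : ℝ) ≤ ((n : ℝ) + s + d + 1 / ε + (s : ℝ) ^ d) ^ C := by
  obtain ⟨hNv1, -, hNv2, hx⟩ := ceil_bounds h0 h1 hNv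
  have hs' : (1 : ℝ) ≤ s := by exact_mod_cast hs
  have hn' : (1 : ℝ) ≤ n := by exact_mod_cast hn
  have hd' : (0 : ℝ) ≤ d := Nat.cast_nonneg d
  have hsd : (1 : ℝ) ≤ (s : ℝ) ^ d := one_le_pow₀ hs'
  obtain ⟨B, hB⟩ : ∃ B, B = (n : ℝ) + s + d + 1 / ε + (s : ℝ) ^ d := ⟨_, rfl⟩
  rw [← hB]
  have hB4 : 4 ≤ B := by rw [hB]; linarith
  have bs : (s : ℝ) + 1 ≤ B := by rw [hB]; linarith
  have bn : (n : ℝ) + 1 ≤ B := by rw [hB]; linarith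
  have bd : (d : ℝ) ≤ B := by rw [hB]; linarith
  have bp : (s : ℝ) ^ d ≤ B := by rw [hB]; linarith
  have bNv : (Nv : ℝ) ≤ 2 * B := by rw [hB]; linarith
  have bE : (E : ℝ) ≤ 2 * B ^ 2 := by
    rw [hE]; push_cast
    calc (s : ℝ) * Nv ≤ B * (2 * B) := by gcongr; linarith
      _ = 2 * B ^ 2 := by ring
  have hE1 : 1 ≤ E := by rw [hE]; exact Nat.mul_pos hs hNv1
  have hlE : l ≤ E := by
    have := Nat.log_lt_self 2 (x := E) (by omega)
    omega
  have bl : (l : ℝ) ≤ 2 * B ^ 2 := le_trans (by exact_mod_cast hlE) bE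
  have bN : (N : ℝ) ≤ 64 * B ^ 4 := by
    rw [hN]; push_cast
    calc (16 : ℝ) * l * E ≤ 16 * (2 * B ^ 2) * (2 * B ^ 2) := by gcongr
      _ = 64 * B ^ 4 := by ring
  have b2l : (2 : ℝ) ^ l ≤ 4 * B ^ 2 := by
    have h2 : 2 ^ Nat.log 2 E ≤ E := Nat.pow_log_le_self 2 (by omega)
    have h3 : (2 : ℝ) ^ Nat.log 2 E ≤ E := by exact_mod_cast h2
    rw [hl, pow_succ]; linarith
  have b2K : (2 : ℝ) ^ K ≤ 256 * B ^ 4 := by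
    rw [hK, pow_add, pow_mul', pow_two]
    calc (2 : ℝ) ^ l * 2 ^ l * 2 ^ 4 ≤ (4 * B ^ 2) * (4 * B ^ 2) * 2 ^ 4 := by gcongr
      _ = 256 * B ^ 4 := by ring
  have bG : (G : ℝ) ≤ B ^ 3 := by
    rcases hG with hG | ⟨-, -, hG⟩
    · have : (G : ℝ) ≤ 3 := by exact_mod_cast hG
      have : (4 : ℝ) ^ 3 ≤ B ^ 3 := by gcongr
      linarith
    · have : (G : ℝ) ≤ (s : ℝ) ^ (3 * d) := by exact_mod_cast hG
      refine this.trans ?_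
      rw [mul_comm, pow_mul]
      gcongr
  have p0 : (1 : ℝ) ≤ B ^ 5 := one_le_pow₀ (by linarith)
  have p1 : B ≤ B ^ 5 := le_self_pow₀ (by linarith) (by norm_num)
  have p2 : B ^ 2 ≤ B ^ 5 := pow_le_pow_right₀ (by linarith) (by norm_num)
  have p4 : B ^ 4 ≤ B ^ 5 := pow_le_pow_right₀ (by linarith) (by norm_num)
  have p3 : (1 : ℝ) ≤ B ^ 3 := one_le_pow₀ (by linarith)
  have c1 : ((s : ℝ) + 1) * (n + 1) ≤ B ^ 2 := by rw [pow_two]; gcongr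
  have c2 : (s : ℝ) * N ≤ 64 * B ^ 5 := by
    calc (s : ℝ) * N ≤ B * (64 * B ^ 4) := by gcongr; linarith
      _ = 64 * B ^ 5 := by ring
  have c3 : ((G : ℝ) + 1) * (2 * s + 2) ≤ 4 * B ^ 4 := by
    calc ((G : ℝ) + 1) * (2 * s + 2) ≤ (2 * B ^ 3) * (2 * B) := by
          gcongr <;> linarith
      _ = 4 * B ^ 4 := by ring
  push_cast
  -- Four of the summands of `B` are at least `1`, so `B ≥ 4`, and the constant `1024 = 4 ^ 5` is
  -- swallowed by five more powers of `B`.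
  have htot : 1024 * B ^ 5 ≤ B ^ C := by
    calc 1024 * B ^ 5 = (4 : ℝ) ^ 5 * B ^ 5 := by norm_num
      _ ≤ B ^ 5 * B ^ 5 := by gcongr
      _ = B ^ 10 := by ring
      _ ≤ B ^ C := pow_le_pow_right₀ (by linarith) hC
  linarith

end Real
end DTTest

/-! ### Assembly -/

namespace DTTest

open scoped ENNReal

theorem two_thirds_le {X Y : ℝ≥0∞} (h : X + Y = 1) (hX : X ≤ 3⁻¹) : 2 / 3 ≤ Y := by
  by_contra hlt
  rw [not_le] at hlt
  have h1 : (3 : ℝ≥0∞)⁻¹ + 2 / 3 = 1 := by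
    rw [ENNReal.div_eq_inv_mul, ← mul_one_add, show (1 : ℝ≥0∞) + 2 = 3 by norm_num,
      ENNReal.inv_mul_cancel (by norm_num) (by norm_num)]
  have h2 : X + Y < 3⁻¹ + 2 / 3 := ENNReal.add_lt_add_of_le_of_lt
    (ne_top_of_le_ne_top (by norm_num) hX) hX hlt
  rw [h, h1] at h2
  exact lt_irrefl _ h2

theorem prob_accepts_add_rejects {μ : PMF (Option State)}
    (h : ∀ o ∈ μ.support, ∃ τ, o = some τ) : prob μ accepts + prob μ rejects = 1 := by
  rw [prob_eq_Ex, prob_eq_Ex, ← Ex_add, ← Ex_const μ 1]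
  refine Ex_congr_support fun o ho => ?_
  obtain ⟨τ, rfl⟩ := h o ho
  by_cases h0 : τ.reg 0 = 0
  · rw [ind_not, ind_of, zero_add]
    · exact ⟨τ, rfl, h0⟩
    · rintro ⟨τ', h', hne⟩
      cases h'; exact hne h0
  · rw [ind_of, ind_not, add_zero]
    · rintro ⟨τ', h', hne⟩
      cases h'; exact h0 hne
    · exact ⟨τ, rfl, h0⟩

theorem two_mul_inv_le {Nv : ℕ} {ε : ℝ} (h0 : 0 < ε) (hNv1 : 1 ≤ Nv) (h : 1 / ε ≤ Nv) :
    2 * ((2 * Nv : ℕ) : ℝ≥0∞)⁻¹ ≤ ENNReal.ofReal ε := by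
  rw [Nat.cast_mul, ENNReal.mul_inv (by simp) (by simp), ← mul_assoc, Nat.cast_ofNat,
    ENNReal.mul_inv_cancel (by norm_num) (by norm_num), one_mul, ← ENNReal.ofReal_natCast,
    ← ENNReal.ofReal_inv_of_pos (by exact_mod_cast hNv1)]
  refine ENNReal.ofReal_le_ofReal ?_
  rw [inv_le_comm₀ (by exact_mod_cast hNv1) h0, ← one_div]
  exact h

theorem tester_correct {C : ℕ} (hC : 30000000 ≤ C) (n s d : ℕ) (ε : ℝ) (hn : 1 ≤ n) (hs : 1 ≤ s)
    (h0 : 0 < ε) (h1 : ε ≤ 1) (f : (Fin n → Bool) → Bool) (D : PMF (Fin n → Bool)) :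
    ∃ fuel : ℕ,
      (∀ o ∈ (exec f D fuel Tester.prog.code (State.start n s d ⌈1 / ε⌉₊)).support,
        ∃ τ : State, o = some τ ∧
          (τ.queries : ℝ) ≤ softO C ((s : ℝ) ^ 2 / ε) ∧
          (τ.time : ℝ) ≤ (s : ℝ) ^ (C * d) / ε + n * softO C ((s : ℝ) ^ 2 / ε) ∧
          (τ.peak : ℝ) ≤ ((n : ℝ) + s + d + 1 / ε + (s : ℝ) ^ d) ^ C) ∧
      (f ∈ DT n d s →
        2 / 3 ≤ prob (exec f D fuel Tester.prog.code (State.start n s d ⌈1 / ε⌉₊)) accepts) ∧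
      (Far D ε f (DT n d s) →
        2 / 3 ≤ prob (exec f D fuel Tester.prog.code (State.start n s d ⌈1 / ε⌉₊)) rejects) := by
  obtain ⟨Nv, hNv⟩ : ∃ Nv, Nv = ⌈1 / ε⌉₊ := ⟨_, rfl⟩
  obtain ⟨E, hE⟩ : ∃ E, E = s * Nv := ⟨_, rfl⟩
  obtain ⟨l, hl⟩ : ∃ l, l = Nat.log 2 E + 1 := ⟨_, rfl⟩
  obtain ⟨N, hN⟩ : ∃ N, N = 16 * l * E := ⟨_, rfl⟩
  obtain ⟨K, hK⟩ : ∃ K, K = 2 * l + 4 := ⟨_, rfl⟩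
  obtain ⟨t, ht⟩ : ∃ t, t = 100 * l := ⟨_, rfl⟩
  obtain ⟨dd, hdd⟩ : ∃ dd, dd = d - (d - s) := ⟨_, rfl⟩
  obtain ⟨hNv1, hNvx, -, -⟩ := ceil_bounds h0 h1 hNv
  have hE1 : 1 ≤ E := by rw [hE]; exact Nat.mul_pos hs hNv1
  have hsE : s ≤ E := by rw [hE]; exact Nat.le_mul_of_pos_right _ hNv1
  have hl1 : 1 ≤ l := by omega
  have hG := geo_bound hs hdd
  have hword := word_bound hn hs h0 h1 hNv hE hl hN hK hG (show 10 ≤ C by omega)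
  obtain ⟨-, hsNl, hm⟩ := sNl_bound hs h0 h1 hNv hE hl hN
  have hpath := path_time_bound hn hs h0 h1 hNv hE hl hN hG (show 23 ≤ C by omega)
  -- One sum dominates all quantities that must fit into a word; it also fixes the fuel `W + 1`.
  obtain ⟨W, hW⟩ : ∃ W, W = 2 + 2 * 2 ^ K + (N + 2) + (s + 1) * (n + 1) + s * N + 116 * l +
      (geo s (dd + 1) + 1) * (2 * s + 2) + n + s + d + Nv := ⟨_, rfl⟩
  rw [← hW] at hword
  have himpl := Impl.prog (f := f) (D := D) (fuel := W + 1) (W := W)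
    (R := low (State.start n s d Nv).reg) (A := (State.start n s d Nv).arr) (n := n) (s := s)
    (d := d) (by omega) (Nat.lt_succ_self W) hE1 hs hl hE hN hK ht hdd
    ⟨by omega, by omega, by omega⟩ (by omega) (by omega) (by omega) rfl rfl rfl rfl rfl rfl
    (fun _ _ => rfl)
    (time_bound (G := geo s (dd + 1)) hn hs hl1 hsE hN hK ht (by omega))
    (query_bound (N := N) hs hl1 hK ht) (State.start n s d Nv) rfl rfl ?_
  swap
  · refine ⟨?_, fun x => ?_, fun a j => Nat.zero_le _⟩
    · simp only [State.start]; omega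
    · simp only [State.start]
      split_ifs <;> omega
  refine ⟨W + 1, ?_⟩
  rw [← hNv]
  have hhalt : ∀ o ∈ (exec f D (W + 1) Tester.prog.code (State.start n s d Nv)).support,
      ∃ τ, o = some τ := fun o ho => by
    obtain ⟨τ, hτ, -⟩ := himpl.exists_of_mem_support ho
    exact ⟨τ, hτ⟩
  have hadd := prob_accepts_add_rejects hhalt
  have hCr : (30000000 : ℝ) ≤ C := by exact_mod_cast hC
  have hn' : (1 : ℝ) ≤ n := by exact_mod_cast hn
  refine ⟨fun o ho => ?_, fun hf => ?_, fun hf => ?_⟩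
  · obtain ⟨τ, hτ, b, -, hOk, htime, hq, -⟩ := himpl.exists_of_mem_support ho
    refine ⟨τ, hτ, ?_, ?_, ?_⟩
    · refine le_trans (?_ : (τ.queries : ℝ) ≤ 1212 * ((s * N * l : ℕ) : ℝ)) ?_
      · have : τ.queries ≤ 1212 * (s * N * l) := by
          simpa [State.start] using hq
        exact_mod_cast this
      · refine le_trans ?_ (softO_ge (c := 1212 * 128) hm (by linarith) (by omega))
        refine (mul_le_mul_of_nonneg_left hsNl (by norm_num)).trans (le_of_eq ?_)
        ring
    · have h2 : (τ.time : ℝ) ≤ 226000 * (((s * N * l : ℕ) : ℝ) * n) +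
          ((290 * (N * geo s (dd + 1)) : ℕ) : ℝ) := by
        have : τ.time ≤ 226000 * (s * N * l * n) + 290 * (N * geo s (dd + 1)) := by
          simpa [State.start] using htime
        exact_mod_cast this
      -- This sum, `29128000`, is the largest constant that `C` has to absorb.
      have h3 := softO_ge (C := C) (c := 226000 * 128 + 200000) hm (by linarith) (by omega)
      have h4 := mul_le_mul_of_nonneg_left h3 (show (0 : ℝ) ≤ n by linarith)
      have h5 := mul_le_mul_of_nonneg_left hsNl (show (0 : ℝ) ≤ 226000 * n by linarith)
      have e : (n : ℝ) * ((226000 * 128 + 200000) * ((s : ℝ) ^ 2 / ε) *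
          (1 + Real.log ((s : ℝ) ^ 2 / ε)) ^ 2) =
          226000 * n * (128 * ((s : ℝ) ^ 2 / ε) * (1 + Real.log ((s : ℝ) ^ 2 / ε)) ^ 2) +
          n * (200000 * ((s : ℝ) ^ 2 / ε) * (1 + Real.log ((s : ℝ) ^ 2 / ε)) ^ 2) := by ring
      have e2 : 226000 * (((s * N * l : ℕ) : ℝ) * n) = 226000 * n * ((s * N * l : ℕ) : ℝ) := by ring
      linarith
    · refine le_trans ?_ hword
      exact_mod_cast hOk.1
  · refine two_thirds_le ((add_comm _ _).trans hadd) ?_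
    refine le_trans (himpl.prob_le (B := fun b => ¬ b) ?_)
      (Ex_alg_not_le_of_mem hf hNv1 hE hl hK hdd)
    rintro b τ ⟨hb, -⟩ ⟨τ', h', hne⟩ hbt
    cases h'
    exact hb.2 hbt hne
  · refine two_thirds_le hadd ?_
    refine le_trans (himpl.prob_le (B := fun b => b) ?_)
      (Ex_alg_le_of_far hs hNv1 hE hl hN ht (by omega) (two_mul_inv_le h0 hNv1 hNvx) hf)
    rintro b τ ⟨hb, -⟩ ⟨τ', h', hne⟩
    cases h'
    exact hb.1 hne

end DTTest

theorem mainTheorem10 :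
    ∃ (P : DTTest.Prog) (C : ℕ),
      ∀ (n s d : ℕ) (ε : ℝ), 1 ≤ n → 1 ≤ s → 0 < ε → ε ≤ 1 →
      ∀ (f : (Fin n → Bool) → Bool) (D : PMF (Fin n → Bool)),
      ∃ fuel : ℕ,
        -- the program always halts, within the bounds on queries, time and word length
        (∀ o ∈ (DTTest.exec f D fuel P (DTTest.State.start n s d ⌈1 / ε⌉₊)).support,
          ∃ τ : DTTest.State, o = some τ ∧
            (τ.queries : ℝ) ≤ DTTest.softO C ((s : ℝ) ^ 2 / ε) ∧
            (τ.time : ℝ) ≤ (s : ℝ) ^ (C * d) / ε + n * DTTest.softO C ((s : ℝ) ^ 2 / ε) ∧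
            (τ.peak : ℝ) ≤ ((n : ℝ) + s + d + 1 / ε + (s : ℝ) ^ d) ^ C) ∧
        -- it accepts members of the class
        (f ∈ DTTest.DT n d s →
          2 / 3 ≤ DTTest.prob
            (DTTest.exec f D fuel P (DTTest.State.start n s d ⌈1 / ε⌉₊)) DTTest.accepts) ∧
        -- it rejects functions that are far from the class
        (DTTest.Far D ε f (DTTest.DT n d s) →
          2 / 3 ≤ DTTest.prob
            (DTTest.exec f D fuel P (DTTest.State.start n s d ⌈1 / ε⌉₊)) DTTest.rejects) := by
  obtain ⟨C, hC⟩ : ∃ C : ℕ, 30000000 ≤ C := ⟨_, le_rfl⟩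
  exact ⟨DTTest.Tester.prog.code, C, fun n s d ε hn hs h0 h1 f D =>
    DTTest.tester_correct hC n s d ε hn hs h0 h1 f D⟩
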